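/- Let $K=\mathbb{Q}(q,t)$, let $\lambda$ be a (possibly empty) partition, identified with its Young diagram in English notation, and let $n=|\lambda|$. The content of a box is $c(\square)=\text{column}-\text{row}$. **Tableaux.** A (non-negative) *reverse Young tableau* $T\in\mathrm{RYT}(\lambda)$ is a labelling $T:\lambda\to\mathbb{Z}_{\ge 0}$ that is weakly decreasing along rows and columns; it is *reverse semistandard*, $T\in\mathrm{RSSYT}(\lambda)$, if moreover it is strictly decreasing along columns. $\mathrm{SYT}(\lambda)$ is the set of standard Young tableaux. A *periodic standard tableau* $\tau\in\mathrm{PSYT}(\lambda)$ is a labelling of the boxes by formal products $jq^b$ ($1\le j\le n$, $b\ge 0$), each $j$ occurring in exactly one box, strictly increasing along rows and columns for the order in which $jq^m<kq^\ell$ iff $m>\ell$, or $m=\ell$ and $j<k$. If $\tau(\square)=iq^b$, put $c_\tau(i)=c(\square)$, $w_\tau(i)=b$ and $\mathfrak{p}_\lambda(\tau)(\square)=b$, so that $\mathfrak{p}_\lambda(\tau)\in\mathrm{RYT}(\lambda)$. **Algebras.** All algebras are over $K$. - $\mathcal{H}_n$ is generated by $T_1,\dots,T_{n-1}$ with $(T_i-1)(T_i+t)=0$,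 $T_iT_{i+1}T_i=T_{i+1}T_iT_{i+1}$, and $T_iT_j=T_jT_i$ for $|i-j|>1$. - $\mathcal{A}_n$ is generated by $T_1,\dots,T_{n-1},\theta_1,\dots,\theta_n$ with the relations of $\mathcal{H}_n$, $\theta_i\theta_j=\theta_j\theta_i$, $\theta_{i+1}=tT_i^{-1}\theta_iT_i^{-1}$, and $T_i\theta_j=\theta_jT_i$ for $j\notin\{i,i+1\}$. - $\mathcal{D}_n$ is generated by $T_i$, $\theta_i$ and $X_1,\dots,X_n$ with the relations of $\mathcal{A}_n$, $X_iX_j=X_jX_i$, $X_{i+1}=tT_i^{-1}X_iT_i^{-1}$, $T_iX_j=X_jT_i$ for $j\notin\{i,i+1\}$, and $\pi_nX_i=X_{i+1}\pi_n$ ($1\le i\le n-1$), $\pi_nX_n=qX_1\pi_n$, where $\pi_n=t^{n-1}\theta_1T_1^{-1}\cdots T_{n-1}^{-1}$ (for $n\ge1$; $\mathcal{D}_0=K$). Let $\rho_n:\mathcal{A}_n\to\mathcal{H}_n$ be the homomorphism $T_i\mapsto T_i$, $\theta_i\mapsto\overline\theta_i$, where $\overline\theta_1=1$ and $\overline\theta_{i+1}=tT_i^{-1}\overline\theta_iT_i^{-1}$.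 The trivial idempotent is $$\epsilon^{(n)}=\frac{1}{[n]_t!}\sum_{\sigma\in\mathfrak{S}_n}t^{\binom n2-\ell(\sigma)}T_\sigma\in\mathcal{H}_n,\qquad [n]_t!=\prod_{i=1}^n\frac{1-t^i}{1-t},$$ with $T_\sigma=T_{i_1}\cdots T_{i_r}$ for a reduced expression $\sigma=s_{i_1}\cdots s_{i_r}$. **Modules.** Write again $\lambda$ for the $\mathcal{H}_n$-module with generators $\tau\in\mathrm{SYT}(\lambda)$ and relations: $\overline\theta_i\tau=t^{c_\tau(i)}\tau$; $\overline\varphi_i\tau=(t^{c_\tau(i)}-t^{c_\tau(i+1)})\,s_i(\tau)$ whenever $c_\tau(i)-c_\tau(i+1)>1$, where $\overline\varphi_i=(tT_i^{-1})\overline\theta_i-\overline\theta_i(tT_i^{-1})$ and $s_i(\tau)$ is $\tau$ with $i,i+1$ exchanged; $T_i\tau=\tau$ if $i,i+1$ are in the same row of $\tau$; $T_i\tau=-t\tau$ if they are in the same column. Let $V_\lambda=\mathrm{Ind}_{\mathcal{A}_n}^{\mathcal{D}_n}\rho_n^*(\lambda)$. **Statement.** The space $V_\lambda$ has a $K$-basis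 $\{F_\tau:\tau\in\mathrm{PSYT}(\lambda)\}$ with $\theta_iF_\tau=q^{w_\tau(i)}t^{c_\tau(i)}F_\tau$ for all $1\le i\le n$. For every such basis and every $T\in\mathrm{RYT}(\lambda)$, the space $U_T=\mathrm{span}_K\{F_\tau:\mathfrak{p}_\lambda(\tau)=T\}$ satisfies $$\dim_K\epsilon^{(n)}(U_T)=\begin{cases}1 & \text{if } T\in\mathrm{RSSYT}(\lambda),\\ 0 & \text{if } T\notin\mathrm{RSSYT}(\lambda).\end{cases}$$ -/

import Mathlib

namespace VVMacdonald

open scoped TensorProduct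

/-! ### The ground field `ℚ(q,t)` -/

/-- The field `ℚ(q,t)` of rational functions in two variables. -/
abbrev K : Type := FractionRing (MvPolynomial (Fin 2) ℚ)

noncomputable def q : K := algebraMap (MvPolynomial (Fin 2) ℚ) K (MvPolynomial.X 0)

noncomputable def t : K := algebraMap (MvPolynomial (Fin 2) ℚ) K (MvPolynomial.X 1)

theorem t_ne_zero : t ≠ 0 := by
  intro h
  exact MvPolynomial.X_ne_zero (R := ℚ) (1 : Fin 2)
    ((FaithfulSMul.algebraMap_injective (MvPolynomial (Fin 2) ℚ) K)
      (h.trans (map_zero _).symm))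

/-! ### Tableaux

Boxes of a Young diagram are pairs `(row, column)`, numbered from `0`, in English notation.
Labels `1, …, n` are represented by `Fin n`, the label `j` by `j - 1`. -/

/-- The boxes of a Young diagram. -/
abbrev Box (μ : YoungDiagram) : Type := {b : ℕ × ℕ // b ∈ μ.cells}

/-- The content of a box: column minus row. -/
def content {μ : YoungDiagram} (b : Box μ) : ℤ := (b.1.2 : ℤ) - (b.1.1 : ℤ)

/-- `b` and `c` lie in the same row and `b` is strictly to the left of `c`. -/
def LeftOf {μ : YoungDiagram} (b c : Box μ) : Prop := b.1.1 = c.1.1 ∧ b.1.2 < c.1.2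

/-- `b` and `c` lie in the same column and `b` is strictly above `c`. -/
def Above {μ : YoungDiagram} (b c : Box μ) : Prop := b.1.2 = c.1.2 ∧ b.1.1 < c.1.1

/-- Non-negative reverse Young tableaux: weakly decreasing along rows and columns. -/
structure RYT (μ : YoungDiagram) where
  entry : Box μ → ℕ
  row_weak : ∀ b c, LeftOf b c → entry c ≤ entry b
  col_weak : ∀ b c, Above b c → entry c ≤ entry b

/-- A reverse Young tableau is reverse semi-standard if it is strictly decreasing
along columns. -/
def RYT.IsRSSYT {μ : YoungDiagram} (T : RYT μ) : Prop :=
  ∀ b c, Above b c → T.entry c < T.entry b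

/-- Standard Young tableaux, as bijective labellings of the boxes. -/
structure SYT (μ : YoungDiagram) where
  label : Box μ ≃ Fin μ.card
  row_strict : ∀ b c, LeftOf b c → label b < label c
  col_strict : ∀ b c, Above b c → label b < label c

/-- The order on formal products `j q^m`: `j q^m < k q^l` if `m > l`, or `m = l` and `j < k`. -/
def LabelLT {n : ℕ} (x y : Fin n × ℕ) : Prop :=
  y.2 < x.2 ∨ (x.2 = y.2 ∧ x.1 < y.1)

/-- Non-negative periodic standard Young tableaux: the box `b` carries the formal product
`j q^m` with `j = label b` and `m = expo b`; every `j` occurs in exactly one box. -/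
structure PSYT (μ : YoungDiagram) where
  label : Box μ ≃ Fin μ.card
  expo : Box μ → ℕ
  row_strict : ∀ b c, LeftOf b c → LabelLT (label b, expo b) (label c, expo c)
  col_strict : ∀ b c, Above b c → LabelLT (label b, expo b) (label c, expo c)

/-- The content `c_τ(i)` of the box labelled `i`. -/
def SYT.c {μ : YoungDiagram} (τ : SYT μ) (i : Fin μ.card) : ℤ := content (τ.label.symm i)

/-- The content `c_τ(i)` of the box labelled `i q^b` for some `b`. -/
def PSYT.c {μ : YoungDiagram} (τ : PSYT μ) (i : Fin μ.card) : ℤ := content (τ.label.symm i)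

/-- The exponent `w_τ(i)`: the `b` such that `i q^b` occurs in `τ`. -/
def PSYT.w {μ : YoungDiagram} (τ : PSYT μ) (i : Fin μ.card) : ℕ := τ.expo (τ.label.symm i)

theorem LabelLT.expo_le {n : ℕ} {x y : Fin n × ℕ} (h : LabelLT x y) : y.2 ≤ x.2 := by
  rcases h with h | h
  · exact h.le
  · exact h.1.ge

/-- The map from periodic standard tableaux to reverse tableaux that forgets the labels `j`
and keeps the exponents. -/
def PSYT.shapeRYT {μ : YoungDiagram} (τ : PSYT μ) : RYT μ where
  entry := τ.expo
  row_weak b c h := (τ.row_strict b c h).expo_le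
  col_weak b c h := (τ.col_strict b c h).expo_le

/-! ### Indices

The index `i : Fin (n - 1)` stands for the adjacent pair `lo i`, `hi i` in `Fin n`. -/

def lo {n : ℕ} (i : Fin (n - 1)) : Fin n := ⟨i.1, by omega⟩

def hi {n : ℕ} (i : Fin (n - 1)) : Fin n := ⟨i.1 + 1, by omega⟩

/-! ### The finite Hecke algebra -/

/-- The inverse of an element `x` with `(x - 1)(x + t) = 0`, namely `t⁻¹ (x + (t - 1))`. -/
noncomputable def heckeInv {A : Type} [Semiring A] [Algebra K A] (x : A) : A :=
  t⁻¹ • (x + algebraMap K A (t - 1))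

theorem mul_heckeInv {A : Type} [Ring A] [Algebra K A] {x : A}
    (h : (x - 1) * (x + algebraMap K A t) = 0) : x * heckeInv x = 1 := by
  have h1 : x * (x + algebraMap K A (t - 1)) = algebraMap K A t := by
    have : x * (x + algebraMap K A (t - 1)) - algebraMap K A t
        = (x - 1) * (x + algebraMap K A t) := by
      rw [map_sub, map_one]; noncomm_ring
    exact sub_eq_zero.mp (this.trans h)
  rw [heckeInv, mul_smul_comm, h1, Algebra.smul_def, ← map_mul, inv_mul_cancel₀ t_ne_zero,
    map_one]

theorem heckeInv_mul {A : Type} [Ring A] [Algebra K A] {x : A}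
    (h : (x - 1) * (x + algebraMap K A t) = 0) : heckeInv x * x = 1 := by
  have hc : heckeInv x * x = x * heckeInv x := by
    have h2 : algebraMap K A (t - 1) * x = x * algebraMap K A (t - 1) := Algebra.commutes _ x
    rw [heckeInv, mul_smul_comm, smul_mul_assoc, add_mul, mul_add, h2]
  rw [hc, mul_heckeInv h]

theorem map_heckeInv {A B : Type} [Semiring A] [Algebra K A] [Semiring B] [Algebra K B]
    (f : A →ₐ[K] B) (x : A) : f (heckeInv x) = heckeInv (f x) := by
  simp only [heckeInv, map_smul, map_add, AlgHom.commutes]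

/-- The element `π = t^(n-1) θ₁ T₁⁻¹ ⋯ T_{n-1}⁻¹`, for `n ≥ 1`. -/
noncomputable def piElt {A : Type} [Semiring A] [Algebra K A] {n : ℕ} (hn : 0 < n) (T : Fin (n - 1) → A) (θ : Fin n → A) : A :=
  t ^ (n - 1) • (θ ⟨0, hn⟩ * (List.ofFn fun i => heckeInv (T i)).prod)

/-- The defining relations of the finite Hecke algebra. -/
inductive HeckeRel (n : ℕ) :
    FreeAlgebra K (Fin (n - 1)) → FreeAlgebra K (Fin (n - 1)) → Prop
  | quad (i : Fin (n - 1)) :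
      HeckeRel n ((FreeAlgebra.ι K i - 1) * (FreeAlgebra.ι K i + algebraMap K _ t)) 0
  | braid (i j : Fin (n - 1)) (h : (j : ℕ) = i + 1) :
      HeckeRel n (FreeAlgebra.ι K i * FreeAlgebra.ι K j * FreeAlgebra.ι K i)
        (FreeAlgebra.ι K j * FreeAlgebra.ι K i * FreeAlgebra.ι K j)
  | far (i j : Fin (n - 1)) (h : (i : ℕ) + 1 < j ∨ (j : ℕ) + 1 < i) :
      HeckeRel n (FreeAlgebra.ι K i * FreeAlgebra.ι K j)
        (FreeAlgebra.ι K j * FreeAlgebra.ι K i)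

/-- The finite Hecke algebra of type `A_{n-1}` over `ℚ(q,t)`. -/
def Hecke (n : ℕ) : Type := RingQuot (HeckeRel n)

noncomputable instance (n : ℕ) : Ring (Hecke n) := inferInstanceAs (Ring (RingQuot (HeckeRel n)))

noncomputable instance (n : ℕ) : Algebra K (Hecke n) :=
  inferInstanceAs (Algebra K (RingQuot (HeckeRel n)))

/-- The quotient map from the free algebra. -/
noncomputable def Hecke.mk (n : ℕ) : FreeAlgebra K (Fin (n - 1)) →ₐ[K] Hecke n :=
  RingQuot.mkAlgHom K (HeckeRel n)

theorem Hecke.mk_rel {n : ℕ} {x y : FreeAlgebra K (Fin (n - 1))} (h : HeckeRel n x y) :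
    Hecke.mk n x = Hecke.mk n y :=
  RingQuot.mkAlgHom_rel K h

/-- The universal property of the presentation. -/
noncomputable def Hecke.lift {n : ℕ} {B : Type} [Ring B] [Algebra K B]
    (f : FreeAlgebra K (Fin (n - 1)) →ₐ[K] B) (hf : ∀ ⦃x y⦄, HeckeRel n x y → f x = f y) :
    Hecke n →ₐ[K] B :=
  RingQuot.liftAlgHom K ⟨f, hf⟩

namespace Hecke

variable {n : ℕ}

/-- The generators `T_i`. -/
noncomputable def T (i : Fin (n - 1)) : Hecke n :=
  Hecke.mk n (FreeAlgebra.ι K i)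

theorem quad (i : Fin (n - 1)) : (T i - 1) * (T i + algebraMap K (Hecke n) t) = 0 := by
  simpa [T] using Hecke.mk_rel (HeckeRel.quad i)

theorem braid (i j : Fin (n - 1)) (h : (j : ℕ) = i + 1) :
    (T i * T j * T i : Hecke n) = T j * T i * T j := by
  simpa [T] using Hecke.mk_rel (HeckeRel.braid i j h)

theorem far (i j : Fin (n - 1)) (h : (i : ℕ) + 1 < j ∨ (j : ℕ) + 1 < i) :
    (T i * T j : Hecke n) = T j * T i := by
  simpa [T] using Hecke.mk_rel (HeckeRel.far i j h)

/-- The elements `θ̄₁ = 1`, `θ̄_{i+1} = t T_i⁻¹ θ̄_i T_i⁻¹`, numbered from `0`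
(and `0` for indices out of range). -/
noncomputable def thetaBarNat (n : ℕ) : ℕ → Hecke n
  | 0 => 1
  | k + 1 =>
      if h : k < n - 1 then
        t • (heckeInv (T ⟨k, h⟩) * thetaBarNat n k * heckeInv (T ⟨k, h⟩))
      else 0

/-- The elements `θ̄_i` of the finite Hecke algebra. -/
noncomputable def thetaBar (i : Fin n) : Hecke n := thetaBarNat n i

/-- The elements `φ̄_i = (t T_i⁻¹) θ̄_i - θ̄_i (t T_i⁻¹)`. -/
noncomputable def phiBar (i : Fin (n - 1)) : Hecke n :=
  (t • heckeInv (T i)) * thetaBar (lo i) - thetaBar (lo i) * (t • heckeInv (T i))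

theorem thetaBarNat_succ {k : ℕ} (h : k < n - 1) :
    thetaBarNat n (k + 1)
      = t • (heckeInv (T ⟨k, h⟩) * thetaBarNat n k * heckeInv (T ⟨k, h⟩)) := by
  rw [thetaBarNat, dif_pos h]

theorem commute_heckeInv {x : Hecke n} {i : Fin (n - 1)} (h : Commute x (T i)) :
    Commute x (heckeInv (T i)) := by
  have ht : Commute x (algebraMap K (Hecke n) (t - 1)) := (Algebra.commutes _ x).symm
  exact (h.add_right ht).smul_right _

theorem commute_thetaBarNat_high (k : ℕ) (j : Fin (n - 1)) (h : k < j) :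
    Commute (T j) (thetaBarNat n k) := by
  induction k with
  | zero => exact Commute.one_right _
  | succ k ih =>
    have hk : k < n - 1 := by omega
    rw [thetaBarNat_succ hk]
    have h1 : Commute (T j : Hecke n) (heckeInv (T ⟨k, hk⟩)) :=
      commute_heckeInv (far j ⟨k, hk⟩ (Or.inr h))
    exact ((h1.mul_right (ih (by omega))).mul_right h1).smul_right _

theorem braid_heckeInv (i j : Fin (n - 1)) (h : (j : ℕ) = i + 1) :
    (T i * (heckeInv (T j) * heckeInv (T i)) : Hecke n)
      = heckeInv (T j) * heckeInv (T i) * T j := by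
  have hb := braid i j h
  have hi := mul_heckeInv (quad i)
  have hj := heckeInv_mul (quad j)
  have hj2 := mul_heckeInv (quad j)
  have hi1 := heckeInv_mul (quad i)
  generalize heckeInv (T i : Hecke n) = a at *
  generalize heckeInv (T j : Hecke n) = b at *
  generalize (T i : Hecke n) = x at *
  generalize (T j : Hecke n) = y at *
  calc x * (b * a) = b * (a * (x * (y * (x * (b * a))))) := by
        have e1 : a * (x * (y * (x * (b * a)))) = y * (x * (b * a)) := by
          rw [← mul_assoc, hi1, one_mul]
        rw [e1, ← mul_assoc b y, hj, one_mul]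
    _ = b * (a * ((x * y * x) * (b * a))) := by simp only [mul_assoc]
    _ = b * (a * ((y * x * y) * (b * a))) := by rw [hb]
    _ = b * (a * (y * (x * ((y * b) * a)))) := by simp only [mul_assoc]
    _ = b * (a * y) := by rw [hj2, one_mul, hi, mul_one]
    _ = b * a * y := by rw [mul_assoc]

theorem heckeInv_braid (i j : Fin (n - 1)) (h : (j : ℕ) = i + 1) :
    (T j * (heckeInv (T i) * heckeInv (T j)) : Hecke n)
      = heckeInv (T i) * heckeInv (T j) * T i := by
  have hb := braid i j h
  have hi := mul_heckeInv (quad i)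
  have hj := heckeInv_mul (quad j)
  have hj2 := mul_heckeInv (quad j)
  have hi1 := heckeInv_mul (quad i)
  generalize heckeInv (T i : Hecke n) = a at *
  generalize heckeInv (T j : Hecke n) = b at *
  generalize (T i : Hecke n) = x at *
  generalize (T j : Hecke n) = y at *
  calc y * (a * b) = a * (b * (y * (x * (y * (a * b))))) := by
        have e1 : b * (y * (x * (y * (a * b)))) = x * (y * (a * b)) := by
          rw [← mul_assoc, hj, one_mul]
        rw [e1, ← mul_assoc a x, hi1, one_mul]
    _ = a * (b * ((y * x * y) * (a * b))) := by simp only [mul_assoc]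
    _ = a * (b * ((x * y * x) * (a * b))) := by rw [hb]
    _ = a * (b * (x * (y * ((x * a) * b)))) := by simp only [mul_assoc]
    _ = a * (b * x) := by rw [hi, one_mul, hj2, mul_one]
    _ = a * b * x := by rw [mul_assoc]

theorem commute_thetaBarNat_low (k : ℕ) (hk : k < n) (j : Fin (n - 1)) (h : (j : ℕ) + 1 < k) :
    Commute (T j) (thetaBarNat n k) := by
  induction k with
  | zero => omega
  | succ k ih =>
    have hk' : k < n - 1 := by omega
    rcases Nat.lt_or_ge ((j : ℕ) + 1) k with hj | hj
    · rw [thetaBarNat_succ hk']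
      have h1 : Commute (T j : Hecke n) (heckeInv (T ⟨k, hk'⟩)) :=
        commute_heckeInv (far j ⟨k, hk'⟩ (Or.inl hj))
      exact ((h1.mul_right (ih (by omega) hj)).mul_right h1).smul_right _
    · obtain rfl : k = (j : ℕ) + 1 := by omega
      have b1 := braid_heckeInv j ⟨(j : ℕ) + 1, hk'⟩ rfl
      have b2 := heckeInv_braid j ⟨(j : ℕ) + 1, hk'⟩ rfl
      have b3 : T ⟨(j : ℕ) + 1, hk'⟩ * thetaBarNat n j
          = thetaBarNat n j * T ⟨(j : ℕ) + 1, hk'⟩ :=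
        commute_thetaBarNat_high (n := n) j ⟨(j : ℕ) + 1, hk'⟩ (Nat.lt_succ_self _)
      rw [thetaBarNat_succ hk', thetaBarNat_succ (k := (j : ℕ)) j.2]
      simp only [mul_smul_comm, smul_mul_assoc]
      refine Commute.smul_right (Commute.smul_right ?_ _) _
      change T j * _ = _ * T j
      have ej : (⟨(j : ℕ), j.2⟩ : Fin (n - 1)) = j := rfl
      rw [ej]
      generalize thetaBarNat n (j : ℕ) = z at *
      generalize heckeInv (T j : Hecke n) = a at *
      generalize heckeInv (T ⟨(j : ℕ) + 1, hk'⟩ : Hecke n) = b at *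
      generalize (T j : Hecke n) = x at *
      generalize (T ⟨(j : ℕ) + 1, hk'⟩ : Hecke n) = y at *
      calc x * (b * (a * z * a) * b) = (x * (b * a)) * z * (a * b) := by
            simp only [mul_assoc]
        _ = b * a * (y * z) * (a * b) := by rw [b1]; simp only [mul_assoc]
        _ = b * a * z * (y * (a * b)) := by rw [b3]; simp only [mul_assoc]
        _ = b * (a * z * a) * b * x := by rw [b2]; simp only [mul_assoc]

theorem commute_thetaBarNat_of_lt (k l : ℕ) (hl : l < n) (h : k < l) :
    Commute (thetaBarNat n k) (thetaBarNat n l) := by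
  induction k with
  | zero => exact Commute.one_left _
  | succ k ih =>
    have hk : k < n - 1 := by omega
    have h1 : Commute (thetaBarNat n l) (heckeInv (T ⟨k, hk⟩)) :=
      commute_heckeInv (commute_thetaBarNat_low l hl ⟨k, hk⟩ h).symm
    rw [thetaBarNat_succ hk]
    exact (((h1.mul_right (ih (by omega)).symm).mul_right h1).smul_right _).symm

theorem thetaBar_comm (i j : Fin n) : (thetaBar i * thetaBar j : Hecke n)
    = thetaBar j * thetaBar i := by
  rcases lt_trichotomy i j with h | h | h
  · exact commute_thetaBarNat_of_lt i j j.2 h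
  · rw [h]
  · exact (commute_thetaBarNat_of_lt j i i.2 h).symm

theorem T_thetaBar_comm (i : Fin (n - 1)) (j : Fin n) (h1 : j ≠ lo i) (h2 : j ≠ hi i) :
    (T i * thetaBar j : Hecke n) = thetaBar j * T i := by
  have e1 : (j : ℕ) ≠ i := fun h => h1 (Fin.ext h)
  have e2 : (j : ℕ) ≠ i + 1 := fun h => h2 (Fin.ext h)
  rcases Nat.lt_or_ge (j : ℕ) i with h | h
  · exact commute_thetaBarNat_high j i h
  · exact commute_thetaBarNat_low j j.2 i (by omega)

end Hecke

/-! ### The positive affine Hecke algebra -/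

/-- Generators of the positive affine Hecke algebra. -/
inductive AffGen (n : ℕ) : Type
  | T (i : Fin (n - 1))
  | θ (i : Fin n)

/-- The generator `T_i` in the free algebra. -/
noncomputable def AffGen.tt {n : ℕ} (i : Fin (n - 1)) : FreeAlgebra K (AffGen n) :=
  FreeAlgebra.ι K (AffGen.T i)

/-- The generator `θ_i` in the free algebra. -/
noncomputable def AffGen.th {n : ℕ} (i : Fin n) : FreeAlgebra K (AffGen n) :=
  FreeAlgebra.ι K (AffGen.θ i)

open AffGen in
/-- The defining relations of the positive affine Hecke algebra. -/
inductive AffRel (n : ℕ) : FreeAlgebra K (AffGen n) → FreeAlgebra K (AffGen n) → Prop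
  | quad (i : Fin (n - 1)) : AffRel n ((tt i - 1) * (tt i + algebraMap K _ t)) 0
  | braid (i j : Fin (n - 1)) (h : (j : ℕ) = i + 1) :
      AffRel n (tt i * tt j * tt i) (tt j * tt i * tt j)
  | far (i j : Fin (n - 1)) (h : (i : ℕ) + 1 < j ∨ (j : ℕ) + 1 < i) :
      AffRel n (tt i * tt j) (tt j * tt i)
  | theta_comm (i j : Fin n) : AffRel n (th i * th j) (th j * th i)
  | theta_step (i : Fin (n - 1)) :
      AffRel n (th (hi i)) (t • (heckeInv (tt i) * th (lo i) * heckeInv (tt i)))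
  | theta_far (i : Fin (n - 1)) (j : Fin n) (h1 : j ≠ lo i) (h2 : j ≠ hi i) :
      AffRel n (tt i * th j) (th j * tt i)

/-- The positive affine Hecke algebra. -/
def AHA (n : ℕ) : Type := RingQuot (AffRel n)

noncomputable instance (n : ℕ) : Ring (AHA n) := inferInstanceAs (Ring (RingQuot (AffRel n)))

noncomputable instance (n : ℕ) : Algebra K (AHA n) :=
  inferInstanceAs (Algebra K (RingQuot (AffRel n)))

/-- The quotient map from the free algebra. -/
noncomputable def AHA.mk (n : ℕ) : FreeAlgebra K (AffGen n) →ₐ[K] AHA n :=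
  RingQuot.mkAlgHom K (AffRel n)

theorem AHA.mk_rel {n : ℕ} {x y : FreeAlgebra K (AffGen n)} (h : AffRel n x y) :
    AHA.mk n x = AHA.mk n y :=
  RingQuot.mkAlgHom_rel K h

/-- The universal property of the presentation. -/
noncomputable def AHA.lift {n : ℕ} {B : Type} [Ring B] [Algebra K B]
    (f : FreeAlgebra K (AffGen n) →ₐ[K] B) (hf : ∀ ⦃x y⦄, AffRel n x y → f x = f y) :
    AHA n →ₐ[K] B :=
  RingQuot.liftAlgHom K ⟨f, hf⟩

/-! ### The positive double affine Hecke algebra -/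

/-- Generators of the positive double affine Hecke algebra. -/
inductive DblGen (n : ℕ) : Type
  | T (i : Fin (n - 1))
  | θ (i : Fin n)
  | X (i : Fin n)

noncomputable def DblGen.tt {n : ℕ} (i : Fin (n - 1)) : FreeAlgebra K (DblGen n) :=
  FreeAlgebra.ι K (DblGen.T i)

noncomputable def DblGen.th {n : ℕ} (i : Fin n) : FreeAlgebra K (DblGen n) :=
  FreeAlgebra.ι K (DblGen.θ i)

noncomputable def DblGen.xx {n : ℕ} (i : Fin n) : FreeAlgebra K (DblGen n) :=
  FreeAlgebra.ι K (DblGen.X i)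

open DblGen in
/-- The defining relations of the positive double affine Hecke algebra. -/
inductive DblRel (n : ℕ) : FreeAlgebra K (DblGen n) → FreeAlgebra K (DblGen n) → Prop
  | quad (i : Fin (n - 1)) : DblRel n ((tt i - 1) * (tt i + algebraMap K _ t)) 0
  | braid (i j : Fin (n - 1)) (h : (j : ℕ) = i + 1) :
      DblRel n (tt i * tt j * tt i) (tt j * tt i * tt j)
  | far (i j : Fin (n - 1)) (h : (i : ℕ) + 1 < j ∨ (j : ℕ) + 1 < i) :
      DblRel n (tt i * tt j) (tt j * tt i)
  | theta_comm (i j : Fin n) : DblRel n (th i * th j) (th j * th i)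
  | theta_step (i : Fin (n - 1)) :
      DblRel n (th (hi i)) (t • (heckeInv (tt i) * th (lo i) * heckeInv (tt i)))
  | theta_far (i : Fin (n - 1)) (j : Fin n) (h1 : j ≠ lo i) (h2 : j ≠ hi i) :
      DblRel n (tt i * th j) (th j * tt i)
  | x_comm (i j : Fin n) : DblRel n (xx i * xx j) (xx j * xx i)
  | x_step (i : Fin (n - 1)) :
      DblRel n (xx (hi i)) (t • (heckeInv (tt i) * xx (lo i) * heckeInv (tt i)))
  | x_far (i : Fin (n - 1)) (j : Fin n) (h1 : j ≠ lo i) (h2 : j ≠ hi i) :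
      DblRel n (tt i * xx j) (xx j * tt i)
  | pi_x (hn : 0 < n) (i : Fin (n - 1)) :
      DblRel n (piElt hn tt th * xx (lo i)) (xx (hi i) * piElt hn tt th)
  | pi_x_last (hn : 0 < n) :
      DblRel n (piElt hn tt th * xx ⟨n - 1, by omega⟩) (q • (xx ⟨0, hn⟩ * piElt hn tt th))

/-- The positive double affine Hecke algebra. -/
def DAHA (n : ℕ) : Type := RingQuot (DblRel n)

noncomputable instance (n : ℕ) : Ring (DAHA n) := inferInstanceAs (Ring (RingQuot (DblRel n)))

noncomputable instance (n : ℕ) : Algebra K (DAHA n) :=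
  inferInstanceAs (Algebra K (RingQuot (DblRel n)))

/-- The quotient map from the free algebra. -/
noncomputable def DAHA.mk (n : ℕ) : FreeAlgebra K (DblGen n) →ₐ[K] DAHA n :=
  RingQuot.mkAlgHom K (DblRel n)

theorem DAHA.mk_rel {n : ℕ} {x y : FreeAlgebra K (DblGen n)} (h : DblRel n x y) :
    DAHA.mk n x = DAHA.mk n y :=
  RingQuot.mkAlgHom_rel K h

/-- The universal property of the presentation. -/
noncomputable def DAHA.lift {n : ℕ} {B : Type} [Ring B] [Algebra K B]
    (f : FreeAlgebra K (DblGen n) →ₐ[K] B) (hf : ∀ ⦃x y⦄, DblRel n x y → f x = f y) :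
    DAHA n →ₐ[K] B :=
  RingQuot.liftAlgHom K ⟨f, hf⟩

namespace DAHA

variable {n : ℕ}

noncomputable def T (i : Fin (n - 1)) : DAHA n := DAHA.mk n (DblGen.tt i)

noncomputable def theta (i : Fin n) : DAHA n := DAHA.mk n (DblGen.th i)

end DAHA

/-! ### The homomorphisms between the three algebras -/

/-- The homomorphism `ρ_n` from the affine to the finite Hecke algebra on the free algebra. -/
noncomputable def rhoFree (n : ℕ) : FreeAlgebra K (AffGen n) →ₐ[K] Hecke n :=
  FreeAlgebra.lift K fun g => match g with
    | AffGen.T i => Hecke.T i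
    | AffGen.θ i => Hecke.thetaBar i

theorem rhoFree_tt {n : ℕ} (i : Fin (n - 1)) : rhoFree n (AffGen.tt i) = Hecke.T i := by
  simp [rhoFree, AffGen.tt]

theorem rhoFree_th {n : ℕ} (i : Fin n) : rhoFree n (AffGen.th i) = Hecke.thetaBar i := by
  simp [rhoFree, AffGen.th]

theorem rhoFree_rel {n : ℕ} ⦃x y : FreeAlgebra K (AffGen n)⦄ (h : AffRel n x y) :
    rhoFree n x = rhoFree n y := by
  cases h with
  | quad i => simpa [rhoFree_tt] using Hecke.quad i
  | braid i j h => simpa [rhoFree_tt] using Hecke.braid i j h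
  | far i j h => simpa [rhoFree_tt] using Hecke.far i j h
  | theta_comm i j => simpa [rhoFree_th] using Hecke.thetaBar_comm i j
  | theta_step i =>
    simp only [map_smul, map_mul, map_heckeInv, rhoFree_tt, rhoFree_th]
    exact Hecke.thetaBarNat_succ i.2
  | theta_far i j h1 h2 =>
    simpa [rhoFree_tt, rhoFree_th] using Hecke.T_thetaBar_comm i j h1 h2

/-- The homomorphism `ρ_n` with `T_i ↦ T_i` and `θ_i ↦ θ̄_i`. -/
noncomputable def rho (n : ℕ) : AHA n →ₐ[K] Hecke n :=
  AHA.lift (rhoFree n) rhoFree_rel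

/-- The map from the affine to the double affine Hecke algebra, on the free algebra. -/
noncomputable def affToDblFree (n : ℕ) : FreeAlgebra K (AffGen n) →ₐ[K] DAHA n :=
  FreeAlgebra.lift K fun g => match g with
    | AffGen.T i => DAHA.T i
    | AffGen.θ i => DAHA.theta i

theorem affToDblFree_tt {n : ℕ} (i : Fin (n - 1)) :
    affToDblFree n (AffGen.tt i) = DAHA.T i := by
  simp [affToDblFree, AffGen.tt]

theorem affToDblFree_th {n : ℕ} (i : Fin n) :
    affToDblFree n (AffGen.th i) = DAHA.theta i := by
  simp [affToDblFree, AffGen.th]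

theorem affToDblFree_rel {n : ℕ} ⦃x y : FreeAlgebra K (AffGen n)⦄ (h : AffRel n x y) :
    affToDblFree n x = affToDblFree n y := by
  cases h with
  | quad i =>
    simpa [affToDblFree_tt, DAHA.T] using DAHA.mk_rel (DblRel.quad i)
  | braid i j h =>
    simpa [affToDblFree_tt, DAHA.T] using DAHA.mk_rel (DblRel.braid i j h)
  | far i j h =>
    simpa [affToDblFree_tt, DAHA.T] using DAHA.mk_rel (DblRel.far i j h)
  | theta_comm i j =>
    simpa [affToDblFree_th, DAHA.theta] using DAHA.mk_rel (DblRel.theta_comm i j)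
  | theta_step i =>
    have := DAHA.mk_rel (DblRel.theta_step i)
    simpa only [map_smul, map_mul, map_heckeInv, affToDblFree_tt, affToDblFree_th, DAHA.T,
      DAHA.theta] using this
  | theta_far i j h1 h2 =>
    simpa [affToDblFree_tt, affToDblFree_th, DAHA.T, DAHA.theta] using
      DAHA.mk_rel (DblRel.theta_far i j h1 h2)

/-- The canonical map from the affine to the double affine Hecke algebra. -/
noncomputable def affToDbl (n : ℕ) : AHA n →ₐ[K] DAHA n :=
  AHA.lift (affToDblFree n) affToDblFree_rel

/-- The map from the finite to the double affine Hecke algebra, on the free algebra. -/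
noncomputable def heckeToDblFree (n : ℕ) : FreeAlgebra K (Fin (n - 1)) →ₐ[K] DAHA n :=
  FreeAlgebra.lift K fun i => DAHA.T i

theorem heckeToDblFree_rel {n : ℕ} ⦃x y : FreeAlgebra K (Fin (n - 1))⦄ (h : HeckeRel n x y) :
    heckeToDblFree n x = heckeToDblFree n y := by
  cases h with
  | quad i =>
    simpa [heckeToDblFree, DAHA.T] using DAHA.mk_rel (DblRel.quad i)
  | braid i j h =>
    simpa [heckeToDblFree, DAHA.T] using DAHA.mk_rel (DblRel.braid i j h)
  | far i j h =>
    simpa [heckeToDblFree, DAHA.T] using DAHA.mk_rel (DblRel.far i j h)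

/-- The canonical map from the finite to the double affine Hecke algebra. -/
noncomputable def heckeToDbl (n : ℕ) : Hecke n →ₐ[K] DAHA n :=
  Hecke.lift (heckeToDblFree n) heckeToDblFree_rel

/-! ### The trivial idempotent -/

/-- The simple transposition `s_i`. -/
def simpleTransposition {n : ℕ} (i : Fin (n - 1)) : Equiv.Perm (Fin n) :=
  Equiv.swap (lo i) (hi i)

/-- Every permutation is a product of simple transpositions. -/
theorem exists_word {n : ℕ} (σ : Equiv.Perm (Fin n)) :
    ∃ (k : ℕ) (l : List (Fin (n - 1))),
      l.length = k ∧ (l.map simpleTransposition).prod = σ := by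
  cases n with
  | zero => exact ⟨0, [], rfl, Subsingleton.elim _ _⟩
  | succ m =>
    have h : σ ∈ Submonoid.closure
        (Set.range fun i : Fin m => Equiv.swap i.castSucc i.succ) := by
      rw [Equiv.Perm.mclosure_swap_castSucc_succ]; trivial
    induction h using Submonoid.closure_induction with
    | mem x hx =>
      obtain ⟨i, rfl⟩ := hx
      refine ⟨1, [i], rfl, ?_⟩
      simp only [List.map_cons, List.map_nil, List.prod_cons, List.prod_nil, mul_one]
      rfl
    | one => exact ⟨0, [], rfl, rfl⟩
    | mul x y _ _ hx hy =>
      obtain ⟨_, l, _, rfl⟩ := hx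
      obtain ⟨_, l', _, rfl⟩ := hy
      exact ⟨_, l ++ l', rfl, by simp⟩

open Classical in
/-- The Coxeter length of a permutation: the least length of an expression as a product of
simple transpositions. -/
noncomputable def permLength {n : ℕ} (σ : Equiv.Perm (Fin n)) : ℕ := Nat.find (exists_word σ)

theorem exists_reducedWord {n : ℕ} (σ : Equiv.Perm (Fin n)) :
    ∃ l : List (Fin (n - 1)),
      l.length = permLength σ ∧ (l.map simpleTransposition).prod = σ := by
  classical
  exact Nat.find_spec (exists_word σ)

/-- A reduced expression of a permutation. -/
noncomputable def reducedWord {n : ℕ} (σ : Equiv.Perm (Fin n)) : List (Fin (n - 1)) :=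
  (exists_reducedWord σ).choose

/-- `T_σ = T_{i_1} ⋯ T_{i_r}` for a reduced expression `σ = s_{i_1} ⋯ s_{i_r}`; by the braid
relations the choice of the reduced expression does not matter. -/
noncomputable def Hecke.Tperm {n : ℕ} (σ : Equiv.Perm (Fin n)) : Hecke n :=
  ((reducedWord σ).map Hecke.T).prod

/-- `[n]_t! = ∏_{i=1}^n (1 - t^i) / (1 - t)`. -/
noncomputable def tFactorial (n : ℕ) : K := ∏ i ∈ Finset.Icc 1 n, (1 - t ^ i) / (1 - t)

/-- The normalized trivial idempotent
`([n]_t!)⁻¹ ∑_σ t^(n(n-1)/2 - ℓ(σ)) T_σ` of the finite Hecke algebra. -/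
noncomputable def trivialIdempotent (n : ℕ) : Hecke n :=
  (tFactorial n)⁻¹ •
    ∑ σ : Equiv.Perm (Fin n), t ^ ((n.choose 2 : ℤ) - permLength σ) • Hecke.Tperm σ

/-! ### The finite Hecke module attached to a partition -/

/-- `s_i(τ) = τ'` and `τ' > τ`: the tableau `τ'` arises from `τ` by exchanging the labels
`i`, `i+1`, and `c_τ(i) - c_τ(i+1) > 1`. -/
def SYT.StepUp {μ : YoungDiagram} (i : Fin (μ.card - 1)) (τ τ' : SYT μ) : Prop :=
  (∀ b, τ'.label b = simpleTransposition i (τ.label b)) ∧ 1 < τ.c (lo i) - τ.c (hi i)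

/-- The defining relations among the generators `τ ∈ SYT(μ)`; a relation `x = 0` is
given by the element `x` of the free module. -/
inductive SpechtRel (μ : YoungDiagram) : (SYT μ →₀ Hecke μ.card) → Prop
  | weight (i : Fin μ.card) (τ : SYT μ) :
      SpechtRel μ (Finsupp.single τ (Hecke.thetaBar i)
        - Finsupp.single τ (algebraMap K _ (t ^ τ.c i)))
  | step (i : Fin (μ.card - 1)) (τ τ' : SYT μ) (h : SYT.StepUp i τ τ') :
      SpechtRel μ (Finsupp.single τ (Hecke.phiBar i)
        - Finsupp.single τ' (algebraMap K _ (t ^ τ.c (lo i) - t ^ τ.c (hi i))))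
  | row (i : Fin (μ.card - 1)) (τ : SYT μ)
      (h : (τ.label.symm (lo i)).1.1 = (τ.label.symm (hi i)).1.1) :
      SpechtRel μ (Finsupp.single τ (Hecke.T i) - Finsupp.single τ 1)
  | col (i : Fin (μ.card - 1)) (τ : SYT μ)
      (h : (τ.label.symm (lo i)).1.2 = (τ.label.symm (hi i)).1.2) :
      SpechtRel μ (Finsupp.single τ (Hecke.T i) - Finsupp.single τ (algebraMap K _ (-t)))

/-- The module over the finite Hecke algebra with generators `τ ∈ SYT(μ)` and the
relations above. -/
abbrev Specht (μ : YoungDiagram) : Type :=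
  (SYT μ →₀ Hecke μ.card) ⧸ Submodule.span (Hecke μ.card) {x | SpechtRel μ x}

/-! ### The induced module -/

/-- The relations `(d a) ⊗ m = d ⊗ (ρ(a) m)` that define the tensor product over the affine
Hecke algebra. -/
def balancedRel (μ : YoungDiagram) : Set (DAHA μ.card ⊗[K] Specht μ) :=
  {x | ∃ (d : DAHA μ.card) (a : AHA μ.card) (m : Specht μ),
    x = (d * affToDbl μ.card a) ⊗ₜ[K] m - d ⊗ₜ[K] (rho μ.card a • m)}

/-- The module `V_μ`: the double affine Hecke module induced from the affine Hecke module
`ρ_n^*(μ)`. -/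
abbrev V (μ : YoungDiagram) : Type :=
  (DAHA μ.card ⊗[K] Specht μ) ⧸ Submodule.span (DAHA μ.card) (balancedRel μ)

/-- `F` is a basis of `V_μ` indexed by periodic standard tableaux, in which `F_τ` is a weight
vector for `θ_1, …, θ_n` of weight `q^{w_τ(i)} t^{c_τ(i)}`. -/
def IsWeightBasis {μ : YoungDiagram} (F : Module.Basis (PSYT μ) K (V μ)) : Prop :=
  ∀ (τ : PSYT μ) (i : Fin μ.card),
    DAHA.theta i • F τ = (q ^ τ.w i * t ^ τ.c i) • F τ

/-- `U_T`: the span of the `F_τ` with `τ` lying over `T`. -/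
noncomputable def U {μ : YoungDiagram} (F : Module.Basis (PSYT μ) K (V μ)) (T : RYT μ) :
    Submodule K (V μ) :=
  Submodule.span K {v | ∃ τ : PSYT μ, τ.shapeRYT = T ∧ v = F τ}

/-- The image of a subspace of `V_μ` under the action of the trivial idempotent. -/
noncomputable def symmetrize {μ : YoungDiagram} (W : Submodule K (V μ)) : Submodule K (V μ) :=
  W.map (Algebra.lsmul K K (V μ) (heckeToDbl μ.card (trivialIdempotent μ.card)))

end VVMacdonald

/-! The proof replaces `V μ` by an explicit model and reads both assertions off it. `Model μ` has
the periodic standard tableaux as a basis. On it `θ_i` is diagonal with eigenvalue `q^w t^c`, and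
`T_i` acts in seminormal form, by blocks of size at most two whose entries depend only on the ratio
of two weights. The denominators do not vanish: equal weights mean equal exponents on one diagonal,
and such labels differ by at least three (`PSYT.diagonal`). The shift `1 q^b ↦ n q^{b+1}`, `(i+1)
q^b ↦ i q^b` gives an operator `w`, and `X_1 = T_1 ⋯ T_{n-1} w` completes the action of the double
affine Hecke algebra (`shiftFree_rel`, `shiftRels_model`).

The part of exponent zero receives a map from the finite Hecke module (`spechtMap`), and inducing it
gives `toModel`. The vectors `X^α ⊗ τ` span `V μ` (`span_monomialVec`), while every basis vector of
the model is reached from exponent zero by the `T_i` and the shift (`single_mem_map_layer`). Sorting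
exponents injects the pairs `(α, τ)` into the periodic tableaux and preserves the degree. Comparing
ranks in bounded degree shows that the images of the `X^α ⊗ τ` are independent
(`linearIndepOn_boundedPairs`), so the map is bijective. Neither a basis theorem for the algebra nor
the dimension of the finite module is needed beforehand. Pulling the model basis back gives the
weight basis.

A weight determines its tableau (`PSYT.eq_of_w_c`), so every weight basis is a rescaling of the
model basis, and `U F T` corresponds to `fibre T`. From `T_i ε = ε` the image of `ε` consists of
vectors fixed by all `T_i`, and on fixed vectors `ε` is a nonzero scalar. A fixed vector has equal
coefficients at two labellings over `T` that differ by an admissible swap, and swaps connect every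
labelling to the column reading (`eq_columnReading_of_swap`); hence the fixed vectors in the fibre
form at most a line. If `T` is strict along columns, the sum of all basis vectors in the fibre is
fixed. If not, two vertically adjacent boxes have equal entries and consecutive labels in the column
reading; the corresponding `T_i` multiplies that coefficient by `-t`, so it vanishes, and with it
the whole vector. -/

namespace VVMacdonald

/-! ### Lengths of permutations -/

section Length

variable {n : ℕ}

@[simp] theorem lo_val (i : Fin (n - 1)) : (lo i : ℕ) = i := rfl

@[simp] theorem hi_val (i : Fin (n - 1)) : (hi i : ℕ) = i + 1 := rfl

theorem lo_lt_hi (i : Fin (n - 1)) : lo i < hi i := Nat.lt_succ_self _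

@[simp] theorem simpleTransposition_lo (i : Fin (n - 1)) :
    simpleTransposition i (lo i) = hi i := Equiv.swap_apply_left _ _

@[simp] theorem simpleTransposition_hi (i : Fin (n - 1)) :
    simpleTransposition i (hi i) = lo i := Equiv.swap_apply_right _ _

theorem simpleTransposition_of_ne {i : Fin (n - 1)} {a : Fin n} (h1 : a ≠ lo i) (h2 : a ≠ hi i) :
    simpleTransposition i a = a := Equiv.swap_apply_of_ne_of_ne h1 h2

@[simp] theorem simpleTransposition_apply_apply (i : Fin (n - 1)) (a : Fin n) :
    simpleTransposition i (simpleTransposition i a) = a := Equiv.swap_apply_self _ _ _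

theorem simpleTransposition_mul_self (i : Fin (n - 1)) :
    simpleTransposition i * simpleTransposition i = 1 := Equiv.swap_mul_self _ _

@[simp] theorem simpleTransposition_inv (i : Fin (n - 1)) :
    (simpleTransposition i)⁻¹ = simpleTransposition i := Equiv.swap_inv _ _

@[simp] theorem simpleTransposition_symm (i : Fin (n - 1)) :
    (simpleTransposition i).symm = simpleTransposition i := Equiv.symm_swap _ _

theorem simpleTransposition_mul_cancel (i : Fin (n - 1)) (σ : Equiv.Perm (Fin n)) :
    simpleTransposition i * (simpleTransposition i * σ) = σ := by
  rw [← mul_assoc, simpleTransposition_mul_self, one_mul]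

theorem simpleTransposition_lt {i : Fin (n - 1)} {a b : Fin n} (h : a < b)
    (hne : ¬(a = lo i ∧ b = hi i)) : simpleTransposition i a < simpleTransposition i b := by
  simp only [simpleTransposition, Equiv.swap_apply_def]
  rw [Fin.lt_def] at h
  simp only [Fin.ext_iff, lo_val, hi_val] at *
  split_ifs <;> simp only [Fin.lt_def, lo_val, hi_val] <;> omega

theorem simpleTransposition_far {i j : Fin (n - 1)} (h : (i : ℕ) + 1 < j ∨ (j : ℕ) + 1 < i) :
    simpleTransposition i * simpleTransposition j
      = simpleTransposition j * simpleTransposition i := by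
  refine (Equiv.Perm.disjoint_iff_disjoint_support.mpr ?_).commute
  have e : ∀ k : Fin (n - 1), (simpleTransposition k).support = {lo k, hi k} := fun k =>
    Equiv.Perm.support_swap (lo_lt_hi k).ne
  simp only [e, Finset.disjoint_insert_left, Finset.disjoint_singleton_left,
    Finset.mem_insert, Finset.mem_singleton, Fin.ext_iff, lo_val, hi_val]
  omega

theorem simpleTransposition_braid {i j : Fin (n - 1)} (h : (j : ℕ) = i + 1) :
    simpleTransposition i * simpleTransposition j * simpleTransposition i
      = simpleTransposition j * simpleTransposition i * simpleTransposition j := by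
  have e : hi i = lo j := Fin.ext h.symm
  have h1 : lo i ≠ lo j := fun h' => by simp [Fin.ext_iff] at h'; omega
  have h2 : lo i ≠ hi j := fun h' => by simp [Fin.ext_iff] at h'; omega
  simp only [simpleTransposition, e]
  rw [Equiv.swap_mul_swap_mul_swap h1 h2,
    Equiv.swap_comm (lo i) (lo j), Equiv.swap_comm (lo j) (hi j),
    Equiv.swap_mul_swap_mul_swap (lo_lt_hi j).ne' h2.symm, Equiv.swap_comm]

/-- The pairs `a < b` whose order is reversed by `σ⁻¹`. -/
def invSet (σ : Equiv.Perm (Fin n)) : Finset (Fin n × Fin n) :=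
  Finset.univ.filter fun p => p.1 < p.2 ∧ σ⁻¹ p.2 < σ⁻¹ p.1

theorem mem_invSet {σ : Equiv.Perm (Fin n)} {p : Fin n × Fin n} :
    p ∈ invSet σ ↔ p.1 < p.2 ∧ σ⁻¹ p.2 < σ⁻¹ p.1 := by
  simp [invSet]

/-- The number of inversions. -/
def inversions (σ : Equiv.Perm (Fin n)) : ℕ := (invSet σ).card

/-- Exchanging two neighbours preserves the order of every other pair, so the old inversions are
carried along and the neighbouring pair is the only new one. -/
theorem invSet_simple_mul {σ : Equiv.Perm (Fin n)} {i : Fin (n - 1)}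
    (h : σ⁻¹ (lo i) < σ⁻¹ (hi i)) :
    invSet (simpleTransposition i * σ) = insert (lo i, hi i)
      ((invSet σ).map ((simpleTransposition i).prodCongr (simpleTransposition i)).toEmbedding) := by
  ext ⟨a, b⟩
  simp only [mem_invSet, Finset.mem_insert, Finset.mem_map, mul_inv_rev, Equiv.Perm.mul_apply,
    simpleTransposition_inv, Prod.exists, Prod.mk.injEq]
  constructor
  · rintro ⟨h1, h2⟩
    by_cases hab : a = lo i ∧ b = hi i
    · exact Or.inl hab
    · exact Or.inr ⟨_, _, ⟨simpleTransposition_lt h1 hab, h2⟩, by simp⟩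
  · rintro (⟨rfl, rfl⟩ | ⟨a', b', ⟨h1, h2⟩, he⟩)
    · exact ⟨lo_lt_hi i, by simpa using h⟩
    · simp only [Equiv.coe_toEmbedding, Equiv.prodCongr_apply, Prod.map_apply,
        Prod.mk.injEq] at he
      obtain ⟨rfl, rfl⟩ := he
      refine ⟨simpleTransposition_lt h1 ?_, by simpa using h2⟩
      rintro ⟨rfl, rfl⟩
      exact absurd h2 (not_lt.mpr h.le)

theorem inversions_simple_mul {σ : Equiv.Perm (Fin n)} {i : Fin (n - 1)}
    (h : σ⁻¹ (lo i) < σ⁻¹ (hi i)) :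
    inversions (simpleTransposition i * σ) = inversions σ + 1 := by
  rw [inversions, invSet_simple_mul h, Finset.card_insert_of_notMem, Finset.card_map, inversions]
  simp only [Finset.mem_map, Prod.exists, Equiv.coe_toEmbedding, Equiv.prodCongr_apply,
    Prod.map_apply, Prod.mk.injEq, not_exists, not_and]
  intro a b hab ha hb
  have ha' : a = hi i := by rw [← simpleTransposition_lo, ← ha]; simp
  have hb' : b = lo i := by rw [← simpleTransposition_hi, ← hb]; simp
  subst ha' hb'
  exact absurd (mem_invSet.mp hab).1 (not_lt.mpr (lo_lt_hi i).le)

theorem inversions_simple_mul' {σ : Equiv.Perm (Fin n)} {i : Fin (n - 1)}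
    (h : σ⁻¹ (hi i) < σ⁻¹ (lo i)) :
    inversions σ = inversions (simpleTransposition i * σ) + 1 := by
  rw [← inversions_simple_mul (i := i), simpleTransposition_mul_cancel]
  simpa using h

theorem lo_hi_lt_or (σ : Equiv.Perm (Fin n)) (i : Fin (n - 1)) :
    σ (lo i) < σ (hi i) ∨ σ (hi i) < σ (lo i) :=
  lt_or_gt_of_ne fun h => (lo_lt_hi i).ne (σ.injective h)

theorem exists_descent {σ : Equiv.Perm (Fin n)} (h : σ ≠ 1) :
    ∃ i : Fin (n - 1), σ (hi i) < σ (lo i) := by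
  by_contra! hc
  apply h
  have hm : StrictMono σ := by
    cases n with
    | zero => intro a; exact a.elim0
    | succ m =>
      rw [Fin.strictMono_iff_lt_succ]
      intro i
      exact (lo_hi_lt_or σ i).resolve_right (not_lt.mpr (hc i))
  have : hm.orderIsoOfSurjective σ σ.surjective = OrderIso.refl _ := Subsingleton.elim _ _
  ext a
  have h2 := congrArg (fun f : Fin n ≃o Fin n => f a) this
  simpa using congrArg Fin.val h2

theorem inversions_one : inversions (1 : Equiv.Perm (Fin n)) = 0 := by
  rw [inversions, Finset.card_eq_zero, Finset.eq_empty_iff_forall_notMem]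
  intro p hp
  have := mem_invSet.mp hp
  exact absurd this.1 (not_lt.mpr (by simpa using this.2.le))

/-- The product of the simple transpositions of a word. -/
def wordProd (l : List (Fin (n - 1))) : Equiv.Perm (Fin n) := (l.map simpleTransposition).prod

@[simp] theorem wordProd_cons (i : Fin (n - 1)) (l : List (Fin (n - 1))) :
    wordProd (i :: l) = simpleTransposition i * wordProd l := by simp [wordProd]

theorem inversions_wordProd_le (l : List (Fin (n - 1))) :
    inversions (wordProd l) ≤ l.length := by
  induction l with
  | nil => simp [wordProd, inversions_one]
  | cons i l ih =>
    rw [wordProd_cons, List.length_cons]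
    rcases lo_hi_lt_or (wordProd l)⁻¹ i with h | h
    · rw [inversions_simple_mul h]; omega
    · have := inversions_simple_mul' h; omega

theorem exists_word_inversions (σ : Equiv.Perm (Fin n)) :
    ∃ l : List (Fin (n - 1)), l.length = inversions σ ∧ wordProd l = σ := by
  induction h : inversions σ generalizing σ with
  | zero =>
    refine ⟨[], rfl, ?_⟩
    by_contra hne
    obtain ⟨i, hi⟩ := exists_descent (σ := σ⁻¹) (by simpa using fun h => hne h.symm)
    have := inversions_simple_mul' hi
    omega
  | succ k ih =>
    have hne : σ⁻¹ ≠ 1 := by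
      intro h1
      rw [inv_eq_one] at h1
      rw [h1, inversions_one] at h
      omega
    obtain ⟨i, hi⟩ := exists_descent hne
    have h2 := inversions_simple_mul' hi
    obtain ⟨l, hl, hp⟩ := ih (simpleTransposition i * σ) (by omega)
    exact ⟨i :: l, by simp [hl], by rw [wordProd_cons, hp, simpleTransposition_mul_cancel]⟩

theorem permLength_eq_inversions (σ : Equiv.Perm (Fin n)) : permLength σ = inversions σ := by
  obtain ⟨l, hl, hp⟩ := exists_word_inversions σ
  obtain ⟨l', hl', hp'⟩ := exists_reducedWord σ
  apply le_antisymm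
  · classical
    exact Nat.find_min' (exists_word σ) ⟨l, hl, hp⟩
  · rw [← hl', ← hp']
    exact inversions_wordProd_le l'

/-- A word is reduced if its length is the number of inversions of its product. -/
def IsReducedWord (l : List (Fin (n - 1))) : Prop := l.length = inversions (wordProd l)

/-- Each letter changes the number of inversions by exactly one, and the tail cannot produce more
inversions than letters; so the first letter must raise the count. -/
theorem IsReducedWord.of_cons {i : Fin (n - 1)} {l : List (Fin (n - 1))}
    (h : IsReducedWord (i :: l)) :
    IsReducedWord l ∧ (wordProd (i :: l))⁻¹ (hi i) < (wordProd (i :: l))⁻¹ (lo i) := by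
  have h1 := inversions_wordProd_le l
  rw [IsReducedWord, List.length_cons] at h
  rcases lo_hi_lt_or (wordProd (i :: l))⁻¹ i with h2 | h2
  · have h3 := inversions_simple_mul h2
    rw [← h, wordProd_cons, simpleTransposition_mul_cancel] at h3
    omega
  · refine ⟨?_, h2⟩
    have h3 := inversions_simple_mul' h2
    rw [← h, wordProd_cons, simpleTransposition_mul_cancel] at h3
    rw [IsReducedWord]; omega

/-- Matsumoto's theorem for the symmetric group. -/
theorem prod_map_eq_of_isReducedWord {G : Type*} [Monoid G] (T : Fin (n - 1) → G)
    (braid : ∀ i j : Fin (n - 1), (j : ℕ) = i + 1 → T i * T j * T i = T j * T i * T j)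
    (far : ∀ i j : Fin (n - 1), (i : ℕ) + 1 < j ∨ (j : ℕ) + 1 < i → T i * T j = T j * T i)
    (l l' : List (Fin (n - 1))) (hl : IsReducedWord l) (hl' : IsReducedWord l')
    (h : wordProd l = wordProd l') : (l.map T).prod = (l'.map T).prod := by
  induction hk : l.length using Nat.strong_induction_on generalizing l l' with
  | _ k ih =>
  have hlen : l'.length = k := by rw [hl', ← h, ← hl, hk]
  rcases l with _ | ⟨i, u⟩
  · have : l' = [] := List.length_eq_zero_iff.mp (by rw [hlen, ← hk]; rfl)
    rw [this]
  rcases l' with _ | ⟨j, v⟩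
  · simp at hk hlen; omega
  obtain ⟨hu, di⟩ := hl.of_cons
  obtain ⟨hv, dj⟩ := hl'.of_cons
  rw [← h] at dj
  set σ := wordProd (i :: u) with hσ
  have eu : wordProd u = simpleTransposition i * σ := by
    rw [hσ, wordProd_cons, simpleTransposition_mul_cancel]
  have ev : wordProd v = simpleTransposition j * σ := by
    rw [h, wordProd_cons, simpleTransposition_mul_cancel]
  simp only [List.length_cons] at hk hlen
  simp only [List.map_cons, List.prod_cons]
  -- Both `i` and `j` are left descents of `σ`. When they are far apart, `σ = s_i s_j x` with
  -- lengths adding up, so by induction `u` may be replaced by `j :: x` and `v` by `i :: x` with a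
  -- common tail.
  have farCase : ∀ (i j : Fin (n - 1)) (u v : List (Fin (n - 1))), u.length + 1 = k →
      v.length + 1 = k → IsReducedWord u → IsReducedWord v →
      σ⁻¹ (hi i) < σ⁻¹ (lo i) → σ⁻¹ (hi j) < σ⁻¹ (lo j) →
      wordProd u = simpleTransposition i * σ → wordProd v = simpleTransposition j * σ →
      ((i : ℕ) + 1 < j ∨ (j : ℕ) + 1 < i) → T i * (u.map T).prod = T j * (v.map T).prod := by
    intro i j u v hk hlen hu hv di dj eu ev hij
    have a1 := inversions_simple_mul' di
    have a2 := inversions_simple_mul' dj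
    have n1 : hi j ≠ lo i := fun h' => by simp [Fin.ext_iff] at h'; omega
    have n2 : hi j ≠ hi i := fun h' => by simp [Fin.ext_iff] at h'; omega
    have n3 : lo j ≠ lo i := fun h' => by simp [Fin.ext_iff] at h'; omega
    have n4 : lo j ≠ hi i := fun h' => by simp [Fin.ext_iff] at h'; omega
    have b1 : inversions (simpleTransposition i * σ)
        = inversions (simpleTransposition j * (simpleTransposition i * σ)) + 1 := by
      apply inversions_simple_mul'
      rw [mul_inv_rev, simpleTransposition_inv, Equiv.Perm.mul_apply, Equiv.Perm.mul_apply,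
        simpleTransposition_of_ne n1 n2, simpleTransposition_of_ne n3 n4]
      exact dj
    have hb : simpleTransposition j * (simpleTransposition i * σ)
        = simpleTransposition i * (simpleTransposition j * σ) := by
      rw [← mul_assoc, ← mul_assoc, simpleTransposition_far hij]
    obtain ⟨x, hx, px⟩ := exists_word_inversions
      (simpleTransposition j * (simpleTransposition i * σ))
    have r1 : wordProd (j :: x) = wordProd u := by
      rw [wordProd_cons, px, simpleTransposition_mul_cancel, eu]
    have r2 : wordProd (i :: x) = wordProd v := by
      rw [wordProd_cons, px, hb, simpleTransposition_mul_cancel, ev]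
    have l1 : u.length = inversions (wordProd u) := hu
    have l2 : v.length = inversions (wordProd v) := hv
    rw [eu] at l1
    rw [ev] at l2
    have t1 := ih _ (by omega) u (j :: x) hu
      (by rw [IsReducedWord, r1, eu, List.length_cons]; omega) r1.symm rfl
    have t2 := ih _ (by omega) v (i :: x) hv
      (by rw [IsReducedWord, r2, ev, List.length_cons]; omega) r2.symm rfl
    rw [t1, t2]
    simp only [List.map_cons, List.prod_cons]
    rw [← mul_assoc, ← mul_assoc, far i j hij]
  -- For neighbouring descents `σ` begins with the braid `s_i s_j s_i`, and the common tail `x`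
  -- gives the replacements `j :: i :: x` and `i :: j :: x`.
  have key : ∀ (i j : Fin (n - 1)) (u v : List (Fin (n - 1))), u.length + 1 = k →
      v.length + 1 = k → IsReducedWord u → IsReducedWord v →
      σ⁻¹ (hi i) < σ⁻¹ (lo i) → σ⁻¹ (hi j) < σ⁻¹ (lo j) →
      wordProd u = simpleTransposition i * σ → wordProd v = simpleTransposition j * σ →
      (j : ℕ) = i + 1 → T i * (u.map T).prod = T j * (v.map T).prod := by
    intro i j u v hk hlen hu hv di dj eu ev hij
    have e : hi i = lo j := Fin.ext hij.symm
    have a1 := inversions_simple_mul' di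
    have a2 := inversions_simple_mul' dj
    have n1 : hi j ≠ lo i := fun h' => by simp [Fin.ext_iff] at h'; omega
    have n2 : hi j ≠ hi i := fun h' => by simp [Fin.ext_iff] at h'; omega
    have n3 : lo i ≠ lo j := fun h' => by simp [Fin.ext_iff] at h'; omega
    have n4 : lo i ≠ hi j := fun h' => by simp [Fin.ext_iff] at h'; omega
    have b1 : inversions (simpleTransposition i * σ)
        = inversions (simpleTransposition j * (simpleTransposition i * σ)) + 1 := by
      apply inversions_simple_mul'
      rw [mul_inv_rev, simpleTransposition_inv, Equiv.Perm.mul_apply, Equiv.Perm.mul_apply, ← e,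
        simpleTransposition_hi, simpleTransposition_of_ne n1 n2]
      rw [← e] at dj
      exact dj.trans di
    have b2 : inversions (simpleTransposition j * σ)
        = inversions (simpleTransposition i * (simpleTransposition j * σ)) + 1 := by
      apply inversions_simple_mul'
      rw [mul_inv_rev, simpleTransposition_inv, Equiv.Perm.mul_apply, Equiv.Perm.mul_apply, e,
        simpleTransposition_lo, simpleTransposition_of_ne n3 n4]
      rw [e] at di
      exact dj.trans di
    have c1 : inversions (simpleTransposition j * (simpleTransposition i * σ))
        = inversions (simpleTransposition i * (simpleTransposition j *
          (simpleTransposition i * σ))) + 1 := by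
      apply inversions_simple_mul'
      rw [mul_inv_rev, mul_inv_rev, simpleTransposition_inv, simpleTransposition_inv,
        Equiv.Perm.mul_apply, Equiv.Perm.mul_apply, Equiv.Perm.mul_apply, Equiv.Perm.mul_apply,
        simpleTransposition_of_ne n3 n4, e, simpleTransposition_lo,
        simpleTransposition_lo, simpleTransposition_of_ne n1 n2, e]
      exact dj
    have hb : simpleTransposition i * (simpleTransposition j * (simpleTransposition i * σ))
        = simpleTransposition j * (simpleTransposition i * (simpleTransposition j * σ)) := by
      have := simpleTransposition_braid hij
      simpa only [mul_assoc] using congrArg (· * σ) this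
    obtain ⟨x, hx, px⟩ := exists_word_inversions
      (simpleTransposition i * (simpleTransposition j * (simpleTransposition i * σ)))
    have r1 : wordProd (j :: i :: x) = wordProd u := by
      rw [wordProd_cons, wordProd_cons, px, simpleTransposition_mul_cancel,
        simpleTransposition_mul_cancel, eu]
    have r2 : wordProd (i :: j :: x) = wordProd v := by
      rw [wordProd_cons, wordProd_cons, px, hb, simpleTransposition_mul_cancel,
        simpleTransposition_mul_cancel, ev]
    have l1 : u.length = inversions (wordProd u) := hu
    have l2 : v.length = inversions (wordProd v) := hv
    rw [eu] at l1
    rw [ev] at l2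
    have t1 := ih _ (by omega) u (j :: i :: x) hu
      (by rw [IsReducedWord, r1, eu, List.length_cons, List.length_cons]; omega) r1.symm rfl
    have t2 := ih _ (by omega) v (i :: j :: x) hv
      (by rw [IsReducedWord, r2, ev, List.length_cons, List.length_cons]; omega) r2.symm rfl
    rw [t1, t2]
    simp only [List.map_cons, List.prod_cons]
    rw [← mul_assoc, ← mul_assoc, braid i j hij, mul_assoc, mul_assoc]
  rcases lt_trichotomy ((i : ℕ) + 1) j with hij | hij | hij
  · exact farCase i j u v hk hlen hu hv di dj eu ev (Or.inl hij)
  · exact key i j u v hk hlen hu hv di dj eu ev hij.symm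
  rcases lt_trichotomy ((j : ℕ) + 1) i with hji | hji | hji
  · exact farCase i j u v hk hlen hu hv di dj eu ev (Or.inr hji)
  · exact (key j i v u hlen hk hv hu dj di ev eu hji.symm).symm
  · have : i = j := Fin.ext (by omega)
    subst this
    rw [ih _ (by omega) u v hu hv (by rw [eu, ev]) rfl]

end Length
end VVMacdonald

namespace VVMacdonald

/-! ### The trivial idempotent -/

section Idempotent

variable {n : ℕ}

theorem t_zpow_ne_zero (k : ℤ) : t ^ k ≠ 0 := zpow_ne_zero _ t_ne_zero

/-- The elements `q` and `t` are algebraically independent. -/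
theorem q_pow_mul_t_pow_injective {a b a' b' : ℕ} (h : q ^ a * t ^ b = q ^ a' * t ^ b') :
    a = a' ∧ b = b' := by
  have h1 : (MvPolynomial.X 0 : MvPolynomial (Fin 2) ℚ) ^ a * MvPolynomial.X 1 ^ b
      = MvPolynomial.X 0 ^ a' * MvPolynomial.X 1 ^ b' := by
    apply FaithfulSMul.algebraMap_injective (MvPolynomial (Fin 2) ℚ) K
    simpa [q, t] using h
  -- The evaluations at `(2, 1)` and `(1, 2)` separate the exponents of `q` and `t`.
  have h2 := congrArg (MvPolynomial.aeval ![(2 : ℚ), 1]) h1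
  have h3 := congrArg (MvPolynomial.aeval ![(1 : ℚ), 2]) h1
  simp only [map_mul, map_pow, MvPolynomial.aeval_X, Matrix.cons_val_zero, Matrix.cons_val_one,
    one_pow, mul_one, one_mul] at h2 h3
  exact ⟨pow_right_injective₀ (by norm_num) (by norm_num) h2,
    pow_right_injective₀ (by norm_num) (by norm_num) h3⟩

theorem q_pow_mul_t_zpow_injective {a a' : ℕ} {b b' : ℤ} (h : q ^ a * t ^ b = q ^ a' * t ^ b') :
    a = a' ∧ b = b' := by
  obtain ⟨m, hm⟩ : ∃ m : ℕ, 0 ≤ b + m ∧ 0 ≤ b' + m := ⟨b.natAbs + b'.natAbs, by omega⟩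
  lift b + m to ℕ using hm.1 with c hc
  lift b' + m to ℕ using hm.2 with c' hc'
  have h1 : q ^ a * t ^ c = q ^ a' * t ^ c' := by
    rw [← zpow_natCast t c, ← zpow_natCast t c', hc, hc', zpow_add₀ t_ne_zero,
      zpow_add₀ t_ne_zero, ← mul_assoc, ← mul_assoc, h]
  have := q_pow_mul_t_pow_injective h1
  omega

theorem q_ne_zero : q ≠ 0 := by
  intro h
  exact MvPolynomial.X_ne_zero (R := ℚ) (0 : Fin 2)
    ((FaithfulSMul.algebraMap_injective (MvPolynomial (Fin 2) ℚ) K) (h.trans (map_zero _).symm))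

theorem t_zpow_injective {a b : ℤ} (h : t ^ a = t ^ b) : a = b :=
  (q_pow_mul_t_zpow_injective (a := 0) (a' := 0) (by simpa using h)).2

theorem t_pow_ne_one {k : ℕ} (hk : k ≠ 0) : t ^ k ≠ 1 := by
  intro h
  have := t_zpow_injective (a := k) (b := 0) (by simpa using h)
  omega

theorem t_ne_one : t ≠ 1 := by simpa using t_pow_ne_one one_ne_zero

theorem tFactorial_ne_zero (n : ℕ) : tFactorial n ≠ 0 := by
  rw [tFactorial, Finset.prod_ne_zero_iff]
  intro i hi
  have := Finset.mem_Icc.mp hi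
  exact div_ne_zero (sub_ne_zero.mpr (t_pow_ne_one (by omega)).symm)
    (sub_ne_zero.mpr t_ne_one.symm)

/-- A nonempty sum of powers of `t` does not vanish. -/
theorem sum_t_zpow_ne_zero {ι : Type*} (s : Finset ι) (hs : s.Nonempty) (f : ι → ℤ) :
    ∑ i ∈ s, t ^ f i ≠ 0 := by
  obtain ⟨m, hm⟩ : ∃ m : ℕ, ∀ i ∈ s, 0 ≤ f i + m := by
    refine ⟨∑ i ∈ s, (f i).natAbs, fun i hi => ?_⟩
    have := Finset.single_le_sum (f := fun i => (f i).natAbs) (fun _ _ => Nat.zero_le _) hi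
    omega
  intro h
  have h1 : ∑ i ∈ s, t ^ (f i + m).toNat = 0 := by
    have : ∀ i ∈ s, t ^ (f i + m).toNat = t ^ f i * t ^ (m : ℤ) := fun i hi => by
      rw [← zpow_natCast, Int.toNat_of_nonneg (hm i hi), zpow_add₀ t_ne_zero]
    rw [Finset.sum_congr rfl this, ← Finset.sum_mul, h, zero_mul]
  have h2 : ∑ i ∈ s, (MvPolynomial.X 1 : MvPolynomial (Fin 2) ℚ) ^ (f i + m).toNat = 0 := by
    apply FaithfulSMul.algebraMap_injective (MvPolynomial (Fin 2) ℚ) K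
    simpa [t] using h1
  -- After the negative powers are cleared, the value at `q = t = 1` is the number of terms.
  have h3 := congrArg (MvPolynomial.aeval ![(1 : ℚ), 1]) h2
  simp only [map_sum, map_pow, MvPolynomial.aeval_X, Matrix.cons_val_one,
    Matrix.cons_val_zero, one_pow, Finset.sum_const, map_zero, nsmul_eq_mul, mul_one] at h3
  exact hs.card_ne_zero (by exact_mod_cast h3)

namespace Hecke

theorem isReducedWord_reducedWord (σ : Equiv.Perm (Fin n)) :
    IsReducedWord (reducedWord σ) ∧ wordProd (reducedWord σ) = σ := by
  obtain ⟨h1, h2⟩ := (exists_reducedWord σ).choose_spec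
  have h2' : wordProd (reducedWord σ) = σ := h2
  exact ⟨by rw [IsReducedWord, h2', ← permLength_eq_inversions]; exact h1, h2'⟩

theorem T_mul_T (i : Fin (n - 1)) :
    (T i * T i : Hecke n) = (1 - t) • T i + t • 1 := by
  have h := quad i
  rw [sub_mul, mul_add, one_mul, ← Algebra.commutes, ← Algebra.smul_def, sub_eq_zero,
    Algebra.algebraMap_eq_smul_one] at h
  rw [sub_smul, one_smul, eq_sub_of_add_eq h]
  abel

theorem T_mul_Tperm {σ : Equiv.Perm (Fin n)} {i : Fin (n - 1)}
    (h : σ⁻¹ (lo i) < σ⁻¹ (hi i)) : T i * Tperm σ = Tperm (simpleTransposition i * σ) := by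
  obtain ⟨h1, h2⟩ := isReducedWord_reducedWord σ
  obtain ⟨h3, h4⟩ := isReducedWord_reducedWord (simpleTransposition i * σ)
  have e : wordProd (i :: reducedWord σ) = simpleTransposition i * σ := by
    rw [wordProd_cons, h2]
  have := prod_map_eq_of_isReducedWord (T : Fin (n - 1) → Hecke n) braid far
    (i :: reducedWord σ) (reducedWord (simpleTransposition i * σ))
    (by rw [IsReducedWord, e, inversions_simple_mul h, List.length_cons, h1, h2]) h3
    (by rw [e, h4])
  rw [Tperm, Tperm, ← this, List.map_cons, List.prod_cons]

theorem T_mul_Tperm' {σ : Equiv.Perm (Fin n)} {i : Fin (n - 1)}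
    (h : σ⁻¹ (hi i) < σ⁻¹ (lo i)) :
    T i * Tperm σ = (1 - t) • Tperm σ + t • Tperm (simpleTransposition i * σ) := by
  have h1 : Tperm σ = T i * Tperm (simpleTransposition i * σ) := by
    rw [T_mul_Tperm, simpleTransposition_mul_cancel]
    simpa using h
  rw [h1, ← mul_assoc, T_mul_T, add_mul, smul_mul_assoc, smul_mul_assoc, one_mul]

/-- `T_i ε = ε`. -/
theorem T_mul_trivialIdempotent (i : Fin (n - 1)) :
    T i * trivialIdempotent n = trivialIdempotent n := by
  rw [trivialIdempotent, mul_smul_comm]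
  congr 1
  set g : Equiv.Perm (Fin n) → Hecke n :=
    fun σ => t ^ ((n.choose 2 : ℤ) - permLength σ) • Tperm σ with hg
  -- Left multiplication by `T i` preserves the span of the two terms for `σ` and `s_i σ`. The
  -- weight `t^{-ℓ}` is the one that makes their sum a fixed vector.
  have hT : ∀ σ : Equiv.Perm (Fin n), σ⁻¹ (lo i) < σ⁻¹ (hi i) →
      T i * g σ + T i * g (simpleTransposition i * σ) = g σ + g (simpleTransposition i * σ) := by
    intro σ h
    have hl : ((n.choose 2 : ℤ) - permLength σ)
        = ((n.choose 2 : ℤ) - permLength (simpleTransposition i * σ)) + 1 := by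
      rw [permLength_eq_inversions, permLength_eq_inversions, inversions_simple_mul h]
      push_cast; ring
    have h' : (simpleTransposition i * σ)⁻¹ (hi i) < (simpleTransposition i * σ)⁻¹ (lo i) := by
      simpa using h
    simp only [hg]
    rw [mul_smul_comm, mul_smul_comm, T_mul_Tperm h, T_mul_Tperm' h',
      simpleTransposition_mul_cancel, hl, zpow_add₀ t_ne_zero, zpow_one]
    simp only [smul_add, smul_sub, smul_smul, sub_smul, one_smul]
    abel
  have hT' : ∀ σ : Equiv.Perm (Fin n),
      T i * g σ + T i * g (simpleTransposition i * σ) = g σ + g (simpleTransposition i * σ) := by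
    intro σ
    rcases lo_hi_lt_or σ⁻¹ i with h | h
    · exact hT σ h
    · have := hT (simpleTransposition i * σ) (by simpa using h)
      rw [simpleTransposition_mul_cancel] at this
      rw [add_comm, this, add_comm]
  have hs : ∀ f : Equiv.Perm (Fin n) → Hecke n,
      ∑ σ, f (simpleTransposition i * σ) = ∑ σ, f σ := fun f =>
    Equiv.sum_comp (Equiv.mulLeft (simpleTransposition i)) f
  -- Summing over all `σ` meets every pair `{σ, s_i σ}` twice, so a factor 2 has to be cancelled.
  have h2 := Finset.sum_congr rfl fun σ (_ : σ ∈ Finset.univ) => hT' σ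
  rw [Finset.sum_add_distrib, Finset.sum_add_distrib, hs g, hs (fun σ => T i * g σ),
    ← Finset.mul_sum, ← two_smul K, ← two_smul K] at h2
  exact smul_right_injective _ (two_ne_zero : (2 : K) ≠ 0) h2

/-- The trivial idempotent acts on invariants through a nonzero scalar. -/
theorem exists_trivialIdempotent_smul (n : ℕ) : ∃ k : K, k ≠ 0 ∧
    ∀ {M : Type} [AddCommGroup M] [Module K M] (ρ : Hecke n →ₐ[K] Module.End K M) (v : M),
      (∀ i, ρ (T i) v = v) → ρ (trivialIdempotent n) v = k • v := by
  -- The scalar is in fact 1, since `∑ t^{N-ℓ(σ)} = [n]_t!` for `N` the largest length; its being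
  -- nonzero is enough here.
  refine ⟨(tFactorial n)⁻¹ *
    ∑ σ : Equiv.Perm (Fin n), t ^ ((n.choose 2 : ℤ) - permLength σ),
    mul_ne_zero (inv_ne_zero (tFactorial_ne_zero n))
      (sum_t_zpow_ne_zero _ Finset.univ_nonempty _), ?_⟩
  intro M _ _ ρ v hv
  have hp : ∀ σ : Equiv.Perm (Fin n), ρ (Tperm σ) v = v := by
    intro σ
    rw [Tperm]
    induction reducedWord σ with
    | nil => simp
    | cons i l ih => rw [List.map_cons, List.prod_cons, map_mul, Module.End.mul_apply, ih, hv]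
  simp only [trivialIdempotent, map_smul, map_sum, LinearMap.smul_apply, LinearMap.sum_apply, hp]
  rw [← Finset.sum_smul, smul_smul]

end Hecke
end Idempotent
end VVMacdonald

namespace VVMacdonald

/-! ### Braid relations and the shift operator -/

section Products

variable {G : Type*} [Monoid G]

/-- The product `T_0 T_1 ⋯ T_{k-1}`. -/
def ascProd (T : ℕ → G) : ℕ → G
  | 0 => 1
  | k + 1 => ascProd T k * T k

/-- The product `T_{k-1} ⋯ T_1 T_0`. -/
def descProd (T : ℕ → G) : ℕ → G
  | 0 => 1
  | k + 1 => T k * descProd T k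

theorem ascProd_succ (T : ℕ → G) (k : ℕ) : ascProd T (k + 1) = ascProd T k * T k := rfl

theorem descProd_succ (T : ℕ → G) (k : ℕ) : descProd T (k + 1) = T k * descProd T k := rfl

theorem mul_ascProd_shift (T : ℕ → G) (k : ℕ) :
    T 0 * ascProd (fun i => T (i + 1)) k = ascProd T (k + 1) := by
  induction k with
  | zero => simp [ascProd]
  | succ k ih => rw [ascProd_succ, ← mul_assoc, ih, ascProd_succ T (k + 1)]

theorem descProd_shift_mul (T : ℕ → G) (k : ℕ) :
    descProd (fun i => T (i + 1)) k * T 0 = descProd T (k + 1) := by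
  induction k with
  | zero => simp [descProd]
  | succ k ih => rw [descProd_succ, mul_assoc, ih, descProd_succ T (k + 1)]

theorem ascProd_eq_list_prod (T : ℕ → G) (k : ℕ) :
    (List.ofFn fun i : Fin k => T i).prod = ascProd T k := by
  induction k with
  | zero => simp [ascProd]
  | succ k ih => rw [List.ofFn_succ', List.concat_eq_append, List.prod_append]; simp [ascProd, ih]

theorem commute_ascProd {x : G} {T : ℕ → G} {k : ℕ} (h : ∀ i < k, Commute x (T i)) :
    Commute x (ascProd T k) := by
  induction k with
  | zero => exact Commute.one_right _
  | succ k ih =>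
    exact (ih fun i hi => h i (by omega)).mul_right (h k (by omega))

theorem commute_descProd {x : G} {T : ℕ → G} {k : ℕ} (h : ∀ i < k, Commute x (T i)) :
    Commute x (descProd T k) := by
  induction k with
  | zero => exact Commute.one_right _
  | succ k ih =>
    exact (h k (by omega)).mul_right (ih fun i hi => h i (by omega))

/-- The braid relations among `T_0, …, T_{m-1}`. -/
structure BraidRels (m : ℕ) (T : ℕ → G) : Prop where
  braid : ∀ i, i + 1 < m → T i * T (i + 1) * T i = T (i + 1) * T i * T (i + 1)
  far : ∀ i j, i + 1 < j → j < m → Commute (T i) (T j)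

variable {m : ℕ} {T : ℕ → G}

/-- `T (j + 1)` commutes with every factor except in the stretch `T j * T (j + 1)`, where the braid
relation turns it into `T j`. Passing the product thus lowers an index by one. -/
theorem BraidRels.mul_ascProd (hT : BraidRels m T) {j k : ℕ} (hj : j + 1 < k) (hk : k ≤ m) :
    T (j + 1) * ascProd T k = ascProd T k * T j := by
  induction k with
  | zero => omega
  | succ k ih =>
    rcases Nat.lt_or_ge (j + 1) k with h | h
    · rw [ascProd_succ, ← mul_assoc, ih h (by omega), mul_assoc, mul_assoc,
        hT.far j k h (by omega)]
    · obtain rfl : k = j + 1 := by omega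
      have hc : Commute (T (j + 1)) (ascProd T j) :=
        commute_ascProd fun i hi => (hT.far i (j + 1) (by omega) (by omega)).symm
      rw [ascProd_succ, ascProd_succ, ← mul_assoc, ← mul_assoc, hc.eq]
      simp only [mul_assoc]
      rw [← mul_assoc (T j), hT.braid j (by omega)]
      simp only [mul_assoc]

theorem BraidRels.mul_descProd (hT : BraidRels m T) {j k : ℕ} (hj : j + 1 < k) (hk : k ≤ m) :
    T j * descProd T k = descProd T k * T (j + 1) := by
  induction k with
  | zero => omega
  | succ k ih =>
    rcases Nat.lt_or_ge (j + 1) k with h | h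
    · rw [descProd_succ, ← mul_assoc, (hT.far j k h (by omega)).eq, mul_assoc, ih h (by omega),
        mul_assoc]
    · obtain rfl : k = j + 1 := by omega
      have hc : Commute (T (j + 1)) (descProd T j) :=
        commute_descProd fun i hi => (hT.far i (j + 1) (by omega) (by omega)).symm
      rw [descProd_succ, descProd_succ]
      simp only [mul_assoc]
      rw [← hc.eq, ← mul_assoc, ← mul_assoc, hT.braid j (by omega)]
      simp only [mul_assoc]

theorem BraidRels.ascProd_shift_mul_ascProd (hT : BraidRels m T) {j k : ℕ} (hj : j ≤ k)
    (hk : k + 1 ≤ m) : ascProd (fun i => T (i + 1)) j * ascProd T (k + 1)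
      = ascProd T (k + 1) * ascProd T j := by
  induction j with
  | zero => simp [ascProd]
  | succ j ih =>
    rw [ascProd_succ, mul_assoc, hT.mul_ascProd (by omega) hk, ← mul_assoc, ih (by omega),
      ascProd_succ T j, mul_assoc]

theorem BraidRels.ascProd_mul_descProd (hT : BraidRels m T) {j k : ℕ} (hj : j ≤ k)
    (hk : k + 1 ≤ m) : ascProd T j * descProd T (k + 1)
      = descProd T (k + 1) * ascProd (fun i => T (i + 1)) j := by
  induction j with
  | zero => simp [ascProd]
  | succ j ih =>
    rw [ascProd_succ, mul_assoc, hT.mul_descProd (by omega) hk, ← mul_assoc, ih (by omega),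
      ascProd_succ (fun i => T (i + 1)), mul_assoc]

theorem intertwine_ascProd {w : G} {T T' : ℕ → G} {k : ℕ} (h : ∀ i < k, w * T' i = T i * w) :
    w * ascProd T' k = ascProd T k * w := by
  induction k with
  | zero => simp [ascProd]
  | succ k ih =>
    rw [ascProd_succ, ← mul_assoc, ih fun i hi => h i (by omega), mul_assoc, h k (by omega),
      ascProd_succ, mul_assoc]

theorem intertwine_descProd {w : G} {T T' : ℕ → G} {k : ℕ} (h : ∀ i < k, w * T' i = T i * w) :
    w * descProd T' k = descProd T k * w := by
  induction k with
  | zero => simp [descProd]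
  | succ k ih =>
    rw [descProd_succ, ← mul_assoc, h k (by omega), mul_assoc, ih fun i hi => h i (by omega),
      descProd_succ, mul_assoc]

theorem ascProd_map {H : Type*} [Monoid H] (f : G →* H) (T : ℕ → G) (k : ℕ) :
    f (ascProd T k) = ascProd (fun i => f (T i)) k := by
  induction k with
  | zero => simp [ascProd]
  | succ k ih => rw [ascProd_succ, map_mul, ih, ascProd_succ]

theorem descProd_map {H : Type*} [Monoid H] (f : G →* H) (T : ℕ → G) (k : ℕ) :
    f (descProd T k) = descProd (fun i => f (T i)) k := by
  induction k with
  | zero => simp [descProd]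
  | succ k ih => rw [descProd_succ, map_mul, ih, descProd_succ]

theorem ascProd_inv {H : Type*} [Group H] (T : ℕ → H) (k : ℕ) :
    ascProd (fun i => (T i)⁻¹) k = (descProd T k)⁻¹ := by
  induction k with
  | zero => simp [ascProd, descProd]
  | succ k ih => rw [ascProd_succ, ih, descProd_succ, mul_inv_rev]

end Products

/-! ### The relations of `X_i` and `π` derived from a cyclic shift operator. -/

section Shift

variable {A : Type} [Ring A] [Algebra K A]

/-- The sequence `x_0 = x`, `x_{k+1} = t T_k⁻¹ x_k T_k⁻¹`. -/
noncomputable def stepSeq (T : ℕ → Aˣ) (x : A) : ℕ → A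
  | 0 => x
  | k + 1 => t • ((↑(T k)⁻¹ : A) * stepSeq T x k * (↑(T k)⁻¹ : A))

variable {T : ℕ → Aˣ} {x : A} {m : ℕ}

theorem stepSeq_succ (k : ℕ) :
    stepSeq T x (k + 1) = t • ((↑(T k)⁻¹ : A) * stepSeq T x k * (↑(T k)⁻¹ : A)) := rfl

theorem stepSeq_eq (k : ℕ) : stepSeq T x k
    = t ^ k • ((↑(ascProd T k)⁻¹ : A) * x * (↑(descProd T k)⁻¹ : A)) := by
  induction k with
  | zero => simp [stepSeq, ascProd, descProd]
  | succ k ih =>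
    rw [stepSeq_succ, ih, ascProd_succ, descProd_succ, mul_inv_rev, mul_inv_rev, Units.val_mul,
      Units.val_mul, mul_smul_comm, smul_mul_assoc, smul_smul, pow_succ']
    simp only [mul_assoc]

/-- For `k < j` every factor of `x_k` commutes with `T j`. In `x_{j+2}` the braid relation turns `T
j` into `T (j + 1)` on its way through `T_{j+1}⁻¹ T_j⁻¹`; that passes `x_j` and is turned back on
the other side. Later steps only add factors that commute with `T j`. -/
theorem commute_stepSeq (hT : BraidRels m T)
    (hx : ∀ j, j + 1 < m → Commute (T (j + 1) : A) x) {j k : ℕ} (hj : j < m) (hk : k ≤ m)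
    (h1 : k ≠ j) (h2 : k ≠ j + 1) : Commute (T j : A) (stepSeq T x k) := by
  have hfar : ∀ i j, i + 1 < j → j < m → Commute (T i : A) (T j : A) := fun i j h1 h2 =>
    Commute.units_val_iff.mpr (hT.far i j h1 h2)
  have high : ∀ k < j, Commute (T j : A) (stepSeq T x k) := by
    intro k hkj
    induction k with
    | zero =>
      obtain ⟨j, rfl⟩ : ∃ i, j = i + 1 := ⟨j - 1, by omega⟩
      exact hx j hj
    | succ k ih =>
      have h3 := (hfar k j (by omega) hj).symm.units_inv_right
      rw [stepSeq_succ]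
      exact ((h3.mul_right (ih (by omega))).mul_right h3).smul_right _
  rcases Nat.lt_or_ge k j with h | h
  · exact high k h
  obtain ⟨l, rfl⟩ : ∃ l, k = j + 2 + l := ⟨k - (j + 2), by omega⟩
  clear h1 h2 h
  induction l with
  | zero =>
    have hb := hT.braid j (by omega)
    have b1 : T j * ((T (j + 1))⁻¹ * (T j)⁻¹) = (T (j + 1))⁻¹ * (T j)⁻¹ * T (j + 1) := by
      rw [eq_comm, ← mul_inv_rev, inv_mul_eq_iff_eq_mul, ← mul_assoc, hb]
      simp
    have b2 : T (j + 1) * ((T j)⁻¹ * (T (j + 1))⁻¹) = (T j)⁻¹ * (T (j + 1))⁻¹ * T j := by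
      rw [eq_comm, ← mul_inv_rev, inv_mul_eq_iff_eq_mul, ← mul_assoc, ← hb]
      simp
    have b1' := congrArg Units.val b1
    have b2' := congrArg Units.val b2
    have b3 : Commute (T (j + 1) : A) (stepSeq T x j) := by
      clear high
      have : ∀ k < j + 1, Commute (T (j + 1) : A) (stepSeq T x k) := by
        intro k hkj
        induction k with
        | zero => exact hx j (by omega)
        | succ k ih =>
          have h3 := (hfar k (j + 1) (by omega) (by omega)).symm.units_inv_right
          rw [stepSeq_succ]
          exact ((h3.mul_right (ih (by omega))).mul_right h3).smul_right _
      exact this j (by omega)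
    simp only [Units.val_mul] at b1' b2'
    rw [add_zero, stepSeq_succ, stepSeq_succ]
    simp only [mul_smul_comm, smul_mul_assoc]
    refine Commute.smul_right (Commute.smul_right ?_ _) _
    have b4 := b3.eq
    generalize stepSeq T x j = z at *
    generalize ((↑(T j)⁻¹ : A)) = a at *
    generalize ((↑(T (j + 1))⁻¹ : A)) = b at *
    generalize (T j : A) = x' at *
    generalize (T (j + 1) : A) = y at *
    calc x' * (b * (a * z * a) * b) = (x' * (b * a)) * z * (a * b) := by simp only [mul_assoc]
      _ = b * a * (y * z) * (a * b) := by rw [b1']; simp only [mul_assoc]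
      _ = b * a * z * (y * (a * b)) := by rw [b4]; simp only [mul_assoc]
      _ = b * (a * z * a) * b * x' := by rw [b2']; simp only [mul_assoc]
  | succ l ih =>
    have h3 := (hfar j (j + 2 + l) (by omega) (by omega)).units_inv_right
    rw [← add_assoc, stepSeq_succ]
    exact ((h3.mul_right (ih (by omega))).mul_right h3).smul_right _

/-- The single commutation of `x_0` with `x_1` suffices: later terms differ from `x_1` by factors
commuting with `x_0`, and raising `k` towards `l` only adds factors `T k` with `k + 1 < l`, which
commute with `x_l`. -/
theorem stepSeq_commute (hT : BraidRels m T)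
    (hx : ∀ j, j + 1 < m → Commute (T (j + 1) : A) x)
    (h01 : 0 < m → Commute x (stepSeq T x 1)) {k l : ℕ} (hk : k ≤ m) (hl : l ≤ m) :
    Commute (stepSeq T x k) (stepSeq T x l) := by
  have h0 : ∀ l, l ≤ m → Commute x (stepSeq T x l) := by
    intro l hl
    induction l with
    | zero => exact Commute.refl _
    | succ l ih =>
      rcases l with _ | l
      · exact h01 hl
      · have h3 := (hx l (by omega)).symm.units_inv_right
        rw [stepSeq_succ]
        exact ((h3.mul_right (ih (by omega))).mul_right h3).smul_right _
  have hlt : ∀ k l, k < l → l ≤ m → Commute (stepSeq T x k) (stepSeq T x l) := by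
    intro k l hkl hl
    induction k with
    | zero => exact h0 l hl
    | succ k ih =>
      have h3 := (commute_stepSeq hT hx (j := k) (k := l) (by omega) hl (by omega)
        (by omega)).symm.units_inv_right
      rw [stepSeq_succ]
      exact ((h3.mul_right (ih (by omega)).symm).mul_right h3).smul_right _ |>.symm
  rcases lt_trichotomy k l with h | rfl | h
  · exact hlt k l h hl
  · exact Commute.refl _
  · exact (hlt l k h hk).symm

/-- A family of operators from which a representation of the double affine Hecke algebra is
built: the affine Hecke generators and a shift `w` that intertwines them cyclically. -/
structure ShiftRels (m : ℕ) (T : ℕ → Aˣ) (θ : ℕ → A) (w : A) : Prop where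
  rels : BraidRels m T
  w_T : ∀ j, j + 1 < m → w * T (j + 1) = T j * w
  w_w_T : 0 < m → w * w * T 0 = T (m - 1) * (w * w)
  theta_succ : ∀ k < m, θ (k + 1) = t • ((↑(T k)⁻¹ : A) * θ k * (↑(T k)⁻¹ : A))
  T_theta : ∀ j, j + 1 < m → Commute (T (j + 1) : A) (θ 0)
  w_theta : 0 < m → w * θ 1 = θ 0 * w
  theta_w : θ m * w = q • (w * θ 0)

namespace ShiftRels

variable {θ : ℕ → A} {w : A}

/-- The element `X_0 = T_0 ⋯ T_{m-1} w`. -/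
def X0 (m : ℕ) (T : ℕ → Aˣ) (w : A) : A := (↑(ascProd T m) : A) * w

/-- The element `π = t^m θ_0 T_0⁻¹ ⋯ T_{m-1}⁻¹`. -/
noncomputable def pi (m : ℕ) (T : ℕ → Aˣ) (θ : ℕ → A) : A :=
  t ^ m • (θ 0 * (↑(descProd T m)⁻¹ : A))

/-- The ascending product lowers the index of `T (j + 1)` by one, and `w` raises it again. -/
theorem commute_X0 (h : ShiftRels m T θ w) {j : ℕ} (hj : j + 1 < m) :
    Commute (T (j + 1) : A) (X0 m T w) := by
  have h1 := congrArg Units.val (h.rels.mul_ascProd hj le_rfl)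
  rw [Units.val_mul, Units.val_mul] at h1
  rw [Commute, SemiconjBy, X0, ← mul_assoc, h1, mul_assoc, ← h.w_T j hj, mul_assoc]

theorem inv_T_mul_X0 (k : ℕ) : (↑(T 0)⁻¹ : A) * X0 (k + 1) T w
    = (↑(ascProd (fun i => T (i + 1)) k) : A) * w := by
  rw [X0, ← mul_ascProd_shift, Units.val_mul, ← mul_assoc, Units.inv_mul_cancel_left]

theorem w_ascProd {k : ℕ} (h : ShiftRels (k + 1) T θ w) :
    w * (↑(ascProd (fun i => T (i + 1)) k) : A) = (↑(ascProd T k) : A) * w := by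
  have := intertwine_ascProd (w := w) (T := fun i => (T i : A)) (T' := fun i => (T (i + 1) : A))
    (k := k) fun i hi => h.w_T i (by omega)
  have e := ascProd_map (Units.coeHom A)
  simp only [Units.coeHom_apply] at e
  rwa [e, e]

theorem w_descProd {k : ℕ} (h : ShiftRels (k + 1) T θ w) :
    w * (↑(descProd (fun i => T (i + 1)) k) : A) = (↑(descProd T k) : A) * w := by
  have := intertwine_descProd (w := w) (T := fun i => (T i : A)) (T' := fun i => (T (i + 1) : A))
    (k := k) fun i hi => h.w_T i (by omega)
  have e := descProd_map (Units.coeHom A)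
  simp only [Units.coeHom_apply] at e
  rwa [e, e]

/-- This is where `w² T_0 = T_{m-1} w²` enters. Moving both copies of `w` to the right leaves an
identity between ascending products, which is `BraidRels.ascProd_shift_mul_ascProd`. -/
theorem X0_commute (h : ShiftRels m T θ w) (hm : 0 < m) :
    Commute (X0 m T w) (stepSeq T (X0 m T w) 1) := by
  obtain ⟨k, rfl⟩ : ∃ k, m = k + 1 := ⟨m - 1, by omega⟩
  have h1 := h.w_ascProd
  have h2 : w * w * (↑(T 0)⁻¹ : A) = (↑(T k)⁻¹ : A) * (w * w) := by
    rw [Units.eq_inv_mul_iff_mul_eq, ← mul_assoc, Units.mul_inv_eq_iff_eq_mul]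
    exact (h.w_w_T hm).symm
  have h3 := congrArg Units.val (h.rels.ascProd_shift_mul_ascProd (le_refl k) le_rfl)
  rw [Units.val_mul, Units.val_mul] at h3
  rw [Commute, SemiconjBy, stepSeq_succ, stepSeq, inv_T_mul_X0, mul_smul_comm, smul_mul_assoc]
  congr 1
  calc X0 (k + 1) T w * ((↑(ascProd (fun i => T (i + 1)) k) : A) * w * (↑(T 0)⁻¹ : A))
      = (↑(ascProd T (k + 1)) : A) * (w * (↑(ascProd (fun i => T (i + 1)) k) : A)) * w
        * (↑(T 0)⁻¹ : A) := by rw [X0]; simp only [mul_assoc]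
    _ = ((↑(ascProd T (k + 1)) : A) * (↑(ascProd T k) : A)) * (w * w * (↑(T 0)⁻¹ : A)) := by
        rw [h1]; simp only [mul_assoc]
    _ = (↑(ascProd (fun i => T (i + 1)) k) : A) * ((↑(ascProd T (k + 1)) : A)
        * (↑(T k)⁻¹ : A)) * (w * w) := by rw [← h3, h2]; simp only [mul_assoc]
    _ = (↑(ascProd (fun i => T (i + 1)) k) : A) * ((↑(ascProd T k) : A) * w) * w := by
        rw [ascProd_succ, Units.val_mul, Units.mul_inv_cancel_right]; simp only [mul_assoc]
    _ = (↑(ascProd (fun i => T (i + 1)) k) : A) * w * ((↑(ascProd (fun i => T (i + 1)) k) : A) * w) := by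
        rw [← h1]; simp only [mul_assoc]
    _ = (↑(ascProd (fun i => T (i + 1)) k) : A) * w * ((↑(T 0)⁻¹ : A) * X0 (k + 1) T w) := by
        rw [inv_T_mul_X0]
    _ = _ := by simp only [mul_assoc]

theorem theta_eq (h : ShiftRels m T θ w) {k : ℕ} (hk : k ≤ m) : θ k = stepSeq T (θ 0) k := by
  induction k with
  | zero => rfl
  | succ k ih => rw [h.theta_succ k (by omega), ih (by omega), stepSeq_succ]

theorem pi_T (h : ShiftRels m T θ w) {j : ℕ} (hj : j + 1 < m) :
    pi m T θ * T j = T (j + 1) * pi m T θ := by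
  have h1 : (descProd T m)⁻¹ * T j = T (j + 1) * (descProd T m)⁻¹ := by
    rw [inv_mul_eq_iff_eq_mul, ← mul_assoc, ← h.rels.mul_descProd hj le_rfl,
      mul_inv_cancel_right]
  have h2 := congrArg Units.val h1
  rw [Units.val_mul, Units.val_mul] at h2
  rw [pi, smul_mul_assoc, mul_smul_comm, mul_assoc, h2, ← mul_assoc, ← (h.T_theta j hj).eq,
    mul_assoc]

/-- With `θ_m = t^m (T_0 ⋯ T_{m-1})⁻¹ θ_0 (T_{m-1} ⋯ T_0)⁻¹` this is `θ_m w = q w θ_0` multiplied by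
the ascending product on the left and by the inverse descending product on the right. -/
theorem pi_X_last (h : ShiftRels m T θ w) :
    pi m T θ * stepSeq T (X0 m T w) m = q • (X0 m T w * pi m T θ) := by
  have h1 := h.theta_w
  rw [h.theta_eq le_rfl, stepSeq_eq, smul_mul_assoc] at h1
  have h2 : t ^ m • (θ 0 * (↑(descProd T m)⁻¹ : A) * w) = q • (X0 m T w * θ 0) := by
    have h3 := congrArg (fun z => (↑(ascProd T m) : A) * z) h1
    simp only [mul_smul_comm, ← mul_assoc, Units.mul_inv, one_mul] at h3
    rw [h3, X0]
  rw [stepSeq_eq, X0, Units.inv_mul_cancel_left, pi, mul_smul_comm, mul_smul_comm,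
    smul_mul_assoc, ← mul_assoc, ← smul_mul_assoc (t ^ m) _ (↑(descProd T m)⁻¹ : A), h2, X0,
    smul_mul_assoc, mul_assoc _ (θ 0), smul_comm]

theorem pi_X_zero (h : ShiftRels m T θ w) (hm : 0 < m) :
    pi m T θ * X0 m T w = stepSeq T (X0 m T w) 1 * pi m T θ := by
  obtain ⟨k, rfl⟩ : ∃ k, m = k + 1 := ⟨m - 1, by omega⟩
  have h1 : (descProd T (k + 1))⁻¹ * ascProd T (k + 1)
      = ascProd (fun i => T (i + 1)) k * (descProd T k)⁻¹ := by
    rw [inv_mul_eq_iff_eq_mul, ← mul_assoc, eq_mul_inv_iff_mul_eq,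
      ← h.rels.ascProd_mul_descProd le_rfl le_rfl, ascProd_succ, descProd_succ, mul_assoc]
  have h2 := congrArg Units.val h1
  rw [Units.val_mul, Units.val_mul] at h2
  have h3 : w * (↑(descProd (fun i => T (i + 1)) k)⁻¹ : A) = (↑(descProd T k)⁻¹ : A) * w := by
    rw [Units.eq_inv_mul_iff_mul_eq, ← mul_assoc, Units.mul_inv_eq_iff_eq_mul]
    exact h.w_descProd.symm
  have h4 : t • (w * (↑(T 0)⁻¹ : A) * θ 0) = θ 0 * w * (T 0 : A) := by
    rw [← h.w_theta hm, h.theta_succ 0 hm, mul_smul_comm, smul_mul_assoc]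
    simp only [mul_assoc, Units.inv_mul, mul_one]
  have h5 : Commute (θ 0) (↑(ascProd (fun i => T (i + 1)) k) : A) := by
    have e := ascProd_map (Units.coeHom A)
    simp only [Units.coeHom_apply] at e
    rw [e]
    exact commute_ascProd fun i hi => (h.T_theta i (by omega)).symm
  rw [stepSeq_succ, stepSeq, inv_T_mul_X0, pi, X0, mul_smul_comm, smul_mul_assoc, smul_mul_assoc]
  congr 1
  calc θ 0 * (↑(descProd T (k + 1))⁻¹ : A) * ((↑(ascProd T (k + 1)) : A) * w)
      = θ 0 * ((↑(descProd T (k + 1))⁻¹ : A) * (↑(ascProd T (k + 1)) : A)) * w := by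
        simp only [mul_assoc]
    _ = (θ 0 * (↑(ascProd (fun i => T (i + 1)) k) : A)) * ((↑(descProd T k)⁻¹ : A) * w) := by
        rw [h2]; simp only [mul_assoc]
    _ = (↑(ascProd (fun i => T (i + 1)) k) : A) * (θ 0 * w * (T 0 : A)) * ((↑(T 0)⁻¹ : A)
        * (↑(descProd (fun i => T (i + 1)) k)⁻¹ : A)) := by
        rw [h5.eq, ← h3, mul_assoc _ (θ 0 * w * (T 0 : A)), mul_assoc (θ 0 * w) (T 0 : A),
          Units.mul_inv_cancel_left]
        simp only [mul_assoc]
    _ = t • ((↑(ascProd (fun i => T (i + 1)) k) : A) * w * (↑(T 0)⁻¹ : A)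
        * (θ 0 * (↑(descProd T (k + 1))⁻¹ : A))) := by
        rw [← h4, ← descProd_shift_mul, mul_inv_rev, Units.val_mul, mul_smul_comm, smul_mul_assoc]
        simp only [mul_assoc]

/-- Conjugation by `π` raises the index of each `T j`, so it carries one step of the recursion for
the `X_i` to the next, and the case `i = 0` propagates. -/
theorem pi_X (h : ShiftRels m T θ w) {i : ℕ} (hi : i < m) :
    pi m T θ * stepSeq T (X0 m T w) i = stepSeq T (X0 m T w) (i + 1) * pi m T θ := by
  induction i with
  | zero => exact h.pi_X_zero hi
  | succ i ih =>
    have h1 : pi m T θ * (↑(T i)⁻¹ : A) = (↑(T (i + 1))⁻¹ : A) * pi m T θ := by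
      rw [Units.eq_inv_mul_iff_mul_eq, ← mul_assoc, Units.mul_inv_eq_iff_eq_mul]
      exact (h.pi_T hi).symm
    rw [stepSeq_succ (i + 1), stepSeq_succ i, mul_smul_comm, smul_mul_assoc]
    congr 1
    calc _ = (pi m T θ * (↑(T i)⁻¹ : A)) * stepSeq T (X0 m T w) i * (↑(T i)⁻¹ : A) := by
          simp only [mul_assoc]
      _ = (↑(T (i + 1))⁻¹ : A) * (pi m T θ * stepSeq T (X0 m T w) i) * (↑(T i)⁻¹ : A) := by
          rw [h1]; simp only [mul_assoc]
      _ = (↑(T (i + 1))⁻¹ : A) * stepSeq T (X0 m T w) (i + 1)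
          * (pi m T θ * (↑(T i)⁻¹ : A)) := by rw [ih (by omega)]; simp only [mul_assoc]
      _ = _ := by rw [h1, ← stepSeq_succ i]; simp only [mul_assoc]

end ShiftRels
end Shift
end VVMacdonald

namespace VVMacdonald

/-! ### Representations of the double affine Hecke algebra -/

section Rep

variable {A : Type} [Ring A] [Algebra K A] {n : ℕ} {T : ℕ → Aˣ} {θ : ℕ → A} {w : A}

/-- The action of the generators of the double affine Hecke algebra. -/
noncomputable def shiftFree (n : ℕ) (T : ℕ → Aˣ) (θ : ℕ → A) (w : A) :
    FreeAlgebra K (DblGen n) →ₐ[K] A :=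
  FreeAlgebra.lift K fun g => match g with
    | DblGen.T i => (T i : A)
    | DblGen.θ i => θ i
    | DblGen.X i => stepSeq T (ShiftRels.X0 (n - 1) T w) i

theorem shiftFree_tt (i : Fin (n - 1)) : shiftFree n T θ w (DblGen.tt i) = T i := by
  simp [shiftFree, DblGen.tt]

theorem shiftFree_th (i : Fin n) : shiftFree n T θ w (DblGen.th i) = θ i := by
  simp [shiftFree, DblGen.th]

theorem shiftFree_xx (i : Fin n) :
    shiftFree n T θ w (DblGen.xx i) = stepSeq T (ShiftRels.X0 (n - 1) T w) i := by
  simp [shiftFree, DblGen.xx]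

theorem heckeInv_unit {u : Aˣ} (h : ((u : A) - 1) * (u + algebraMap K A t) = 0) :
    heckeInv (u : A) = (↑u⁻¹ : A) := by
  rw [eq_comm, ← mul_one (↑u⁻¹ : A), Units.inv_mul_eq_iff_eq_mul]
  exact (mul_heckeInv h).symm

theorem map_piElt {B C : Type} [Semiring B] [Algebra K B] [Semiring C] [Algebra K C]
    (f : B →ₐ[K] C) (hn : 0 < n) (T : Fin (n - 1) → B) (θ : Fin n → B) :
    f (piElt hn T θ) = piElt hn (fun i => f (T i)) (fun i => f (θ i)) := by
  rw [piElt, piElt, map_smul, map_mul, map_list_prod, List.map_ofFn]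
  congr 4
  ext i
  exact map_heckeInv f (T i)

theorem piElt_eq_pi (hn : 0 < n)
    (quad : ∀ i : Fin (n - 1), ((T i : A) - 1) * (T i + algebraMap K A t) = 0) :
    piElt hn (fun i : Fin (n - 1) => (T i : A)) (fun i : Fin n => θ i)
      = ShiftRels.pi (n - 1) T θ := by
  rw [piElt, ShiftRels.pi, ← ascProd_inv, ← ascProd_eq_list_prod]
  have e : ∀ l : List Aˣ, ((l.prod : Aˣ) : A) = (l.map (Units.coeHom A)).prod := fun l =>
    map_list_prod (Units.coeHom A) l
  rw [e, List.map_ofFn]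
  congr 4
  ext i
  exact heckeInv_unit (quad i)

theorem shiftFree_piElt (hn : 0 < n)
    (quad : ∀ i : Fin (n - 1), ((T i : A) - 1) * (T i + algebraMap K A t) = 0) :
    shiftFree n T θ w (piElt hn DblGen.tt DblGen.th) = ShiftRels.pi (n - 1) T θ := by
  rw [map_piElt, ← piElt_eq_pi hn quad]
  simp only [shiftFree_tt, shiftFree_th]

/-- A representation thus needs no separate check of relations for the `X_i`: these follow from the
relations between `w` and the affine generators. -/
theorem shiftFree_rel (h : ShiftRels (n - 1) T θ w)
    (quad : ∀ i : Fin (n - 1), ((T i : A) - 1) * (T i + algebraMap K A t) = 0)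
    (theta_comm : ∀ i j, i < n → j < n → θ i * θ j = θ j * θ i)
    ⦃x y : FreeAlgebra K (DblGen n)⦄ (hr : DblRel n x y) :
    shiftFree n T θ w x = shiftFree n T θ w y := by
  cases hr with
  | quad i => simpa [shiftFree_tt] using quad i
  | braid i j hij =>
    simp only [map_mul, shiftFree_tt]
    have := congrArg Units.val (h.rels.braid i (by omega))
    rw [hij]
    exact this
  | far i j hij =>
    simp only [map_mul, shiftFree_tt]
    rcases hij with hij | hij
    · exact congrArg Units.val (h.rels.far i j hij j.2).eq
    · exact congrArg Units.val (h.rels.far j i hij i.2).eq.symm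
  | theta_comm i j =>
    simp only [map_mul, shiftFree_th]
    exact theta_comm i j i.2 j.2
  | theta_step i =>
    simp only [map_smul, map_mul, map_heckeInv, shiftFree_tt, shiftFree_th,
      heckeInv_unit (quad i)]
    exact h.theta_succ i i.2
  | theta_far i j h1 h2 =>
    simp only [map_mul, shiftFree_tt, shiftFree_th]
    rw [h.theta_eq (by omega)]
    exact commute_stepSeq h.rels h.T_theta i.2 (by omega) (fun e => h1 (Fin.ext e))
      (fun e => h2 (Fin.ext e))
  | x_comm i j =>
    simp only [map_mul, shiftFree_xx]
    exact stepSeq_commute h.rels (fun j hj => h.commute_X0 hj) h.X0_commute (by omega) (by omega)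
  | x_step i =>
    simp only [map_smul, map_mul, map_heckeInv, shiftFree_tt, shiftFree_xx,
      heckeInv_unit (quad i)]
    exact stepSeq_succ _
  | x_far i j h1 h2 =>
    simp only [map_mul, shiftFree_tt, shiftFree_xx]
    exact commute_stepSeq h.rels (fun j hj => h.commute_X0 hj) i.2 (by omega)
      (fun e => h1 (Fin.ext e)) (fun e => h2 (Fin.ext e))
  | pi_x hn i =>
    rw [map_mul, map_mul, shiftFree_piElt hn quad, shiftFree_xx, shiftFree_xx]
    exact h.pi_X i.2
  | pi_x_last hn =>
    rw [map_smul, map_mul, map_mul, shiftFree_piElt hn quad, shiftFree_xx, shiftFree_xx]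
    exact h.pi_X_last

end Rep

/-! ### Relations, generators and universal properties of the presented algebras. -/

namespace DAHA

variable {n : ℕ}

/-- The generators `X_i`. -/
noncomputable def X (i : Fin n) : DAHA n := DAHA.mk n (DblGen.xx i)

theorem quad (i : Fin (n - 1)) : (T i - 1) * (T i + algebraMap K (DAHA n) t) = 0 := by
  simpa [T] using DAHA.mk_rel (DblRel.quad i)

theorem X_comm (i j : Fin n) : X i * X j = X j * X i := by
  simpa [X] using DAHA.mk_rel (DblRel.x_comm i j)

theorem X_step (i : Fin (n - 1)) :
    X (hi i) = t • (heckeInv (T i) * X (lo i) * heckeInv (T i)) := by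
  simpa only [X, T, map_smul, map_mul, map_heckeInv] using DAHA.mk_rel (DblRel.x_step i)

theorem X_far (i : Fin (n - 1)) (j : Fin n) (h1 : j ≠ lo i) (h2 : j ≠ hi i) :
    T i * X j = X j * T i := by
  simpa [X, T] using DAHA.mk_rel (DblRel.x_far i j h1 h2)

theorem theta_step (i : Fin (n - 1)) :
    theta (hi i) = t • (heckeInv (T i) * theta (lo i) * heckeInv (T i)) := by
  simpa only [theta, T, map_smul, map_mul, map_heckeInv] using DAHA.mk_rel (DblRel.theta_step i)

theorem pi_X (hn : 0 < n) (i : Fin (n - 1)) :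
    piElt hn T theta * X (lo i) = X (hi i) * piElt hn T theta := by
  have := DAHA.mk_rel (DblRel.pi_x hn i)
  rw [map_mul, map_mul, map_piElt] at this
  exact this

theorem pi_X_last (hn : 0 < n) :
    piElt hn T theta * X ⟨n - 1, by omega⟩ = q • (X ⟨0, hn⟩ * piElt hn T theta) := by
  have := DAHA.mk_rel (DblRel.pi_x_last hn)
  rw [map_smul, map_mul, map_mul, map_piElt] at this
  exact this

theorem lift_mk {B : Type} [Ring B] [Algebra K B] (f : FreeAlgebra K (DblGen n) →ₐ[K] B)
    (hf : ∀ ⦃x y⦄, DblRel n x y → f x = f y) (x : FreeAlgebra K (DblGen n)) :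
    DAHA.lift f hf (DAHA.mk n x) = f x :=
  RingQuot.liftAlgHom_mkAlgHom_apply K f hf x

theorem mk_surjective : Function.Surjective (DAHA.mk n) :=
  RingQuot.mkAlgHom_surjective K (DblRel n)

/-- A subalgebra that contains the generators is everything. -/
theorem subalgebra_eq_top (S : Subalgebra K (DAHA n)) (hT : ∀ i, T i ∈ S) (hθ : ∀ i, theta i ∈ S)
    (hX : ∀ i, X i ∈ S) : S = ⊤ := by
  rw [eq_top_iff]
  intro d _
  obtain ⟨x, rfl⟩ := mk_surjective d
  induction x using FreeAlgebra.induction with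
  | grade0 r => rw [AlgHom.commutes]; exact S.algebraMap_mem r
  | grade1 g => cases g with
    | T i => exact hT i
    | θ i => exact hθ i
    | X i => exact hX i
  | mul a b ha hb => rw [map_mul]; exact S.mul_mem (ha trivial) (hb trivial)
  | add a b ha hb => rw [map_add]; exact S.add_mem (ha trivial) (hb trivial)

end DAHA

namespace AHA

variable {n : ℕ}

theorem mk_surjective : Function.Surjective (AHA.mk n) :=
  RingQuot.mkAlgHom_surjective K (AffRel n)

theorem lift_mk {B : Type} [Ring B] [Algebra K B] (f : FreeAlgebra K (AffGen n) →ₐ[K] B)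
    (hf : ∀ ⦃x y⦄, AffRel n x y → f x = f y) (x : FreeAlgebra K (AffGen n)) :
    AHA.lift f hf (AHA.mk n x) = f x :=
  RingQuot.liftAlgHom_mkAlgHom_apply K f hf x

end AHA

theorem affToDbl_mk {n : ℕ} (x : FreeAlgebra K (AffGen n)) :
    affToDbl n (AHA.mk n x) = affToDblFree n x := AHA.lift_mk _ _ x

theorem rho_mk {n : ℕ} (x : FreeAlgebra K (AffGen n)) :
    rho n (AHA.mk n x) = rhoFree n x := AHA.lift_mk _ _ x

theorem heckeToDbl_T {n : ℕ} (i : Fin (n - 1)) : heckeToDbl n (Hecke.T i) = DAHA.T i := by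
  have : heckeToDbl n (Hecke.T i) = heckeToDblFree n (FreeAlgebra.ι K i) :=
    RingQuot.liftAlgHom_mkAlgHom_apply K _ _ _
  rw [this]
  simp [heckeToDblFree]

theorem Hecke.mk_surjective {n : ℕ} : Function.Surjective (Hecke.mk n) :=
  RingQuot.mkAlgHom_surjective K (HeckeRel n)

/-- A subalgebra of the Hecke algebra that contains the generators is everything. -/
theorem Hecke.subalgebra_eq_top {n : ℕ} (S : Subalgebra K (Hecke n)) (hT : ∀ i, Hecke.T i ∈ S) :
    S = ⊤ := by
  rw [eq_top_iff]
  intro d _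
  obtain ⟨x, rfl⟩ := Hecke.mk_surjective d
  induction x using FreeAlgebra.induction with
  | grade0 r => rw [AlgHom.commutes]; exact S.algebraMap_mem r
  | grade1 g => exact hT g
  | mul a b ha hb => rw [map_mul]; exact S.mul_mem (ha trivial) (hb trivial)
  | add a b ha hb => rw [map_add]; exact S.add_mem (ha trivial) (hb trivial)

end VVMacdonald

namespace VVMacdonald

/-! ### Combinatorics of tableaux -/

section Tableaux

variable {μ : YoungDiagram}

theorem card_box (μ : YoungDiagram) : Fintype.card (Box μ) = μ.card := by
  simp [YoungDiagram.card]

theorem Box.ext {b c : Box μ} (h1 : b.1.1 = c.1.1) (h2 : b.1.2 = c.1.2) : b = c :=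
  Subtype.ext (Prod.ext h1 h2)

/-- A box weakly to the north-west of a given box. -/
def Box.nw (c : Box μ) (i j : ℕ) (hi : i ≤ c.1.1) (hj : j ≤ c.1.2) : Box μ :=
  ⟨(i, j), μ.up_left_mem hi hj c.2⟩

theorem PSYT.ext' {τ τ' : PSYT μ} (h1 : τ.label = τ'.label) (h2 : τ.expo = τ'.expo) : τ = τ' := by
  cases τ; cases τ'; cases h1; cases h2; rfl

theorem RYT.ext' {T T' : RYT μ} (h : T.entry = T'.entry) : T = T' := by
  cases T; cases T'; cases h; rfl

theorem SYT.ext' {S S' : SYT μ} (h : S.label = S'.label) : S = S' := by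
  cases S; cases S'; cases h; rfl

/-- The relation between boxes that forces an inequality of the labels. -/
def Forced (T : RYT μ) (b c : Box μ) : Prop :=
  (LeftOf b c ∨ Above b c) ∧ T.entry b = T.entry c

/-- Labellings that complete a reverse tableau to a periodic standard tableau. -/
def Compatible (T : RYT μ) (l : Box μ ≃ Fin μ.card) : Prop :=
  ∀ b c, Forced T b c → l b < l c

theorem labelLT_of_compatible {T : RYT μ} {l : Box μ ≃ Fin μ.card} (h : Compatible T l)
    {b c : Box μ} (hbc : LeftOf b c ∨ Above b c) :
    LabelLT (l b, T.entry b) (l c, T.entry c) := by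
  have h1 : T.entry c ≤ T.entry b := hbc.elim (T.row_weak b c) (T.col_weak b c)
  rcases h1.lt_or_eq with h2 | h2
  · exact Or.inl h2
  · exact Or.inr ⟨h2.symm, h b c ⟨hbc, h2.symm⟩⟩

/-- The periodic standard tableau with given labels and exponents. -/
def PSYT.ofCompatible (T : RYT μ) (l : Box μ ≃ Fin μ.card) (h : Compatible T l) : PSYT μ where
  label := l
  expo := T.entry
  row_strict _ _ hbc := labelLT_of_compatible h (Or.inl hbc)
  col_strict _ _ hbc := labelLT_of_compatible h (Or.inr hbc)

theorem PSYT.labelLT (τ : PSYT μ) {b c : Box μ} (h : LeftOf b c ∨ Above b c) :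
    LabelLT (τ.label b, τ.expo b) (τ.label c, τ.expo c) :=
  h.elim (τ.row_strict b c) (τ.col_strict b c)

/-- With `PSYT.ofCompatible` this identifies the periodic tableaux over `T` with the labellings
compatible with `T`. A swap then changes the labelling while `T` stays fixed. -/
theorem PSYT.compatible (τ : PSYT μ) : Compatible τ.shapeRYT τ.label := by
  rintro b c ⟨h1, h2⟩
  rcases τ.labelLT h1 with h | h
  · exact absurd h2 (ne_of_gt h)
  · exact h.2

@[simp] theorem PSYT.shapeRYT_ofCompatible (T : RYT μ) (l : Box μ ≃ Fin μ.card)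
    (h : Compatible T l) : (PSYT.ofCompatible T l h).shapeRYT = T := RYT.ext' rfl

theorem LabelLT.trans {n : ℕ} {x y z : Fin n × ℕ} (h1 : LabelLT x y) (h2 : LabelLT y z) :
    LabelLT x z := by
  simp only [LabelLT, Fin.lt_def] at *
  omega

theorem PSYT.labelLT_of_le (τ : PSYT μ) {b c : Box μ} (h1 : b.1.1 ≤ c.1.1) (h2 : b.1.2 ≤ c.1.2)
    (hne : b ≠ c) : LabelLT (τ.label b, τ.expo b) (τ.label c, τ.expo c) := by
  rcases h1.lt_or_eq with h1' | h1'
  · rcases h2.lt_or_eq with h2' | h2'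
    · have e1 := τ.row_strict b (c.nw b.1.1 c.1.2 h1 le_rfl) ⟨rfl, h2'⟩
      have e2 := τ.col_strict (c.nw b.1.1 c.1.2 h1 le_rfl) c ⟨rfl, h1'⟩
      exact e1.trans e2
    · exact τ.col_strict b c ⟨h2', h1'⟩
  · rcases h2.lt_or_eq with h2' | h2'
    · exact τ.row_strict b c ⟨h1', h2'⟩
    · exact absurd (Box.ext h1' h2') hne

/-- Exponents decrease weakly towards the south-east, so they are constant on the rectangle spanned
by `b` and `c`, where the labels must then increase. -/
theorem PSYT.lt_between (τ : PSYT μ) {b c : Box μ} (he : τ.expo b = τ.expo c) (i j : ℕ) (hi : b.1.1 ≤ i) (hi' : i ≤ c.1.1)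
    (hj : b.1.2 ≤ j) (hj' : j ≤ c.1.2) (hb : b.1 ≠ (i, j)) (hc : c.1 ≠ (i, j)) :
    (τ.label b : ℕ) < τ.label (c.nw i j hi' hj') ∧
      (τ.label (c.nw i j hi' hj') : ℕ) < τ.label c := by
  have e1 := τ.labelLT_of_le (b := b) (c := c.nw i j hi' hj') hi hj
    (fun h => hb (congrArg Subtype.val h))
  have e2 := τ.labelLT_of_le (b := c.nw i j hi' hj') (c := c) hi' hj'
    (fun h => hc (congrArg Subtype.val h).symm)
  simp only [LabelLT, Fin.lt_def] at e1 e2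
  omega

theorem PSYT.lt_of_le (τ : PSYT μ) {b c : Box μ} (h1 : b.1.1 ≤ c.1.1) (h2 : b.1.2 ≤ c.1.2)
    (hne : b ≠ c) (he : τ.expo b = τ.expo c) : (τ.label b : ℕ) < τ.label c := by
  have e1 := τ.labelLT_of_le h1 h2 hne
  simp only [LabelLT, Fin.lt_def] at e1
  omega

/-- Labels of equal exponent on the same diagonal differ by at least three. -/
theorem PSYT.diagonal (τ : PSYT μ) {b c : Box μ} (he : τ.expo b = τ.expo c)
    (hc : content b = content c) (hl : (τ.label b : ℕ) < τ.label c) :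
    (τ.label b : ℕ) + 3 ≤ τ.label c := by
  have hne : b ≠ c := fun h => by rw [h] at hl; exact lt_irrefl _ hl
  simp only [content] at hc
  rcases lt_trichotomy b.1.1 c.1.1 with h | h | h
  -- The boxes just below and just to the right of `b` carry two different labels strictly between
  -- those of `b` and `c`.
  · have e1 := τ.lt_between he (b.1.1 + 1) b.1.2 (by omega) (by omega) le_rfl
      (by omega) (fun h' => by rw [Prod.ext_iff] at h'; simp at h')
      (fun h' => by rw [Prod.ext_iff] at h'; simp at h'; omega)
    have e2 := τ.lt_between he b.1.1 (b.1.2 + 1) le_rfl (by omega) (by omega)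
      (by omega) (fun h' => by rw [Prod.ext_iff] at h'; simp at h')
      (fun h' => by rw [Prod.ext_iff] at h'; simp at h'; omega)
    have hne2 : τ.label (c.nw (b.1.1 + 1) b.1.2 (by omega) (by omega))
        ≠ τ.label (c.nw b.1.1 (b.1.2 + 1) (by omega) (by omega)) := fun h' => by
      have := congrArg Subtype.val (τ.label.injective h')
      simp [Box.nw] at this
    have hne3 := fun h' => hne2 (Fin.ext h')
    omega
  · exact absurd (Box.ext h (by omega)) hne
  · have := τ.lt_of_le (b := c) (c := b) h.le (by omega) hne.symm he.symm
    omega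

/-- Here and in the next three lemmas the labels are consecutive, so the rectangle between the two
boxes contains no third box, since its label would lie strictly between them. Neighbouring contents
and membership in one row or column then determine each other. -/
theorem PSYT.leftOf_of_content (τ : PSYT μ) {b c : Box μ} (he : τ.expo b = τ.expo c)
    (hc : content c = content b + 1) (hl : (τ.label c : ℕ) = τ.label b + 1) : LeftOf b c := by
  have hne : b ≠ c := fun h => by rw [h] at hl; omega
  simp only [content] at hc
  rcases lt_trichotomy b.1.1 c.1.1 with h | h | h
  · have e2 := τ.lt_between he b.1.1 (b.1.2 + 1) le_rfl (by omega) (by omega)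
      (by omega) (fun h' => by rw [Prod.ext_iff] at h'; simp at h')
      (fun h' => by rw [Prod.ext_iff] at h'; simp at h'; omega)
    omega
  · exact ⟨h, by omega⟩
  · have := τ.lt_of_le (b := c) (c := b) h.le (by omega) hne.symm he.symm
    omega

theorem PSYT.above_of_content (τ : PSYT μ) {b c : Box μ} (he : τ.expo b = τ.expo c)
    (hc : content b = content c + 1) (hl : (τ.label c : ℕ) = τ.label b + 1) : Above b c := by
  have hne : b ≠ c := fun h => by rw [h] at hl; omega
  simp only [content] at hc
  rcases lt_trichotomy b.1.2 c.1.2 with h | h | h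
  · have e2 := τ.lt_between he (b.1.1 + 1) b.1.2 (by omega) (by omega) le_rfl
      (by omega) (fun h' => by rw [Prod.ext_iff] at h'; simp at h')
      (fun h' => by rw [Prod.ext_iff] at h'; simp at h'; omega)
    omega
  · exact ⟨h, by omega⟩
  · have := τ.lt_of_le (b := c) (c := b) (by omega) h.le hne.symm he.symm
    omega

theorem PSYT.content_of_leftOf (τ : PSYT μ) {b c : Box μ} (he : τ.expo b = τ.expo c)
    (h : LeftOf b c) (hl : (τ.label c : ℕ) = τ.label b + 1) : content c = content b + 1 := by
  have hne : b ≠ c := fun h => by rw [h] at hl; omega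
  obtain ⟨h1, h2⟩ := h
  by_contra hc
  simp only [content] at hc
  have e2 := τ.lt_between he b.1.1 (b.1.2 + 1) le_rfl (by omega) (by omega)
    (by omega) (fun h' => by rw [Prod.ext_iff] at h'; simp at h')
    (fun h' => by rw [Prod.ext_iff] at h'; simp at h'; omega)
  omega

theorem PSYT.content_of_above (τ : PSYT μ) {b c : Box μ} (he : τ.expo b = τ.expo c)
    (h : Above b c) (hl : (τ.label c : ℕ) = τ.label b + 1) : content b = content c + 1 := by
  have hne : b ≠ c := fun h => by rw [h] at hl; omega
  obtain ⟨h1, h2⟩ := h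
  by_contra hc
  simp only [content] at hc
  have e2 := τ.lt_between he (b.1.1 + 1) b.1.2 (by omega) (by omega) le_rfl
    (by omega) (fun h' => by rw [Prod.ext_iff] at h'; simp at h')
    (fun h' => by rw [Prod.ext_iff] at h'; simp at h'; omega)
  omega

/-- A periodic standard tableau is determined by its weight. -/
theorem PSYT.eq_of_w_c {τ τ' : PSYT μ} (hw : ∀ i, τ.w i = τ'.w i) (hc : ∀ i, τ.c i = τ'.c i) :
    τ = τ' := by
  classical
  -- The induction is on the number of formal products `j q^{w(j)}` that precede `i q^{w(i)}`; the
  -- two tableaux have the same such products because their exponents agree.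
  have key : ∀ k, ∀ i : Fin μ.card,
      (Finset.univ.filter fun j => LabelLT (j, τ.w j) (i, τ.w i)).card = k →
      τ.label.symm i = τ'.label.symm i := by
    intro k
    induction k using Nat.strong_induction_on with
    | _ k ih =>
    intro i hk
    have IH : ∀ j, LabelLT (j, τ.w j) (i, τ.w i) → τ.label.symm j = τ'.label.symm j := by
      intro j hj
      refine ih _ ?_ j rfl
      rw [← hk]
      apply Finset.card_lt_card
      rw [Finset.ssubset_iff_of_subset]
      · refine ⟨j, by simpa using hj, fun hm => ?_⟩
        have := (Finset.mem_filter.mp hm).2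
        simp [LabelLT] at this
      · intro l hl
        simp only [Finset.mem_filter, Finset.mem_univ, true_and] at hl ⊢
        exact hl.trans hj
    by_contra hne
    have hci := hc i
    simp only [PSYT.c, content] at hci
    -- Two boxes of equal content are comparable. In the first case `τ'` has a smaller label at the
    -- box of `i` in `τ`; by induction `τ` has that label there too, although `i` already occupies
    -- the box. The second case is symmetric.
    rcases Nat.le_total (τ.label.symm i).1.1 (τ'.label.symm i).1.1 with h | h
    · have h1 := τ'.labelLT_of_le h (by omega) hne
      rw [Equiv.apply_symm_apply] at h1
      have h2 := IH (τ'.label (τ.label.symm i)) (by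
        rw [hw, hw]
        simpa only [PSYT.w, Equiv.symm_apply_apply] using h1)
      rw [Equiv.symm_apply_apply] at h2
      have h3 := τ.label.symm.injective h2
      exact hne (by rw [← h3, Equiv.symm_apply_apply, h3])
    · have h1 := τ.labelLT_of_le h (by omega) (Ne.symm hne)
      rw [Equiv.apply_symm_apply] at h1
      have h2 := IH (τ.label (τ'.label.symm i)) (by
        simpa only [PSYT.w, Equiv.symm_apply_apply] using h1)
      rw [Equiv.symm_apply_apply] at h2
      have h3 := τ'.label.symm.injective h2
      exact hne ((congrArg τ.label.symm h3).trans (Equiv.symm_apply_apply _ _))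
  have hsymm : τ.label.symm = τ'.label.symm := Equiv.ext fun i => key _ i rfl
  have hl : τ.label = τ'.label := by rw [← Equiv.symm_symm τ.label, hsymm, Equiv.symm_symm]
  refine PSYT.ext' hl (funext fun b => ?_)
  have := hw (τ.label b)
  simpa only [PSYT.w, ← hl, Equiv.symm_apply_apply] using this

/-! ### Swapping labels -/

/-- The swap reverses the order of one pair of labels only, so only a constraint between these two
boxes can be violated. -/
theorem Compatible.swap_iff {T : RYT μ} {l : Box μ ≃ Fin μ.card} (h : Compatible T l)
    (i : Fin (μ.card - 1)) : Compatible T (l.trans (simpleTransposition i)) ↔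
      ¬ Forced T (l.symm (lo i)) (l.symm (hi i)) := by
  constructor
  · intro h' hf
    have := h' _ _ hf
    simp only [Equiv.trans_apply, Equiv.apply_symm_apply, simpleTransposition_lo,
      simpleTransposition_hi] at this
    exact absurd this (not_lt.mpr (lo_lt_hi i).le)
  · intro hf b c hbc
    simp only [Equiv.trans_apply]
    refine simpleTransposition_lt (h b c hbc) ?_
    rintro ⟨h1, h2⟩
    rw [← h1, ← h2, Equiv.symm_apply_apply, Equiv.symm_apply_apply] at hf
    exact hf hbc

theorem Equiv.trans_simpleTransposition_symm {B : Type*} {n : ℕ} (l : B ≃ Fin n)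
    (i : Fin (n - 1)) (j : Fin n) :
    (l.trans (simpleTransposition i)).symm j = l.symm (simpleTransposition i j) := by
  rw [Equiv.symm_trans_apply, simpleTransposition_symm]

theorem Equiv.trans_simpleTransposition_self {B : Type*} {n : ℕ} (l : B ≃ Fin n)
    (i : Fin (n - 1)) : (l.trans (simpleTransposition i)).trans (simpleTransposition i) = l := by
  ext b
  simp

/-- Compatibility passes to labellings closer to a compatible one. -/
theorem Compatible.of_swap {T : RYT μ} {l l' : Box μ ≃ Fin μ.card} {i : Fin (μ.card - 1)}
    (h : Compatible T l) (hs : Compatible T (l'.trans (simpleTransposition i)))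
    (hlt : l (l'.symm (lo i)) < l (l'.symm (hi i))) : Compatible T l' := by
  have := hs.swap_iff i
  rw [Equiv.trans_simpleTransposition_self] at this
  rw [this]
  intro hf
  rw [Equiv.trans_simpleTransposition_symm, Equiv.trans_simpleTransposition_symm,
    simpleTransposition_lo, simpleTransposition_hi] at hf
  exact absurd (h _ _ hf) (not_lt.mpr hlt.le)

/-! ### The weight of a box -/

/-- The weight `q^{T(b)} t^{c(b)}` of a box. -/
noncomputable def boxWeight (T : RYT μ) (b : Box μ) : K := q ^ T.entry b * t ^ content b

theorem boxWeight_ne_zero (T : RYT μ) (b : Box μ) : boxWeight T b ≠ 0 :=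
  mul_ne_zero (pow_ne_zero _ q_ne_zero) (t_zpow_ne_zero _)

theorem boxWeight_injective {T T' : RYT μ} {b c : Box μ} (h : boxWeight T b = boxWeight T' c) :
    T.entry b = T'.entry c ∧ content b = content c := q_pow_mul_t_zpow_injective h

theorem t_mul_boxWeight (T : RYT μ) (b : Box μ) :
    t * boxWeight T b = q ^ T.entry b * t ^ (content b + 1) := by
  rw [boxWeight, zpow_add₀ t_ne_zero, zpow_one]; ring

/-- The bound 2 covers three consecutive labels, as the denominators in the braid relation require;
it comes from the gap of three in `PSYT.diagonal`. -/
theorem Compatible.boxWeight_ne {T : RYT μ} {l : Box μ ≃ Fin μ.card} (h : Compatible T l)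
    {b c : Box μ} (hl : (l b : ℕ) < l c) (hl' : (l c : ℕ) ≤ l b + 2) :
    boxWeight T b ≠ boxWeight T c := by
  intro he
  have h1 := boxWeight_injective he
  have := (PSYT.ofCompatible T l h).diagonal h1.1 h1.2 hl
  change (l b : ℕ) + 3 ≤ l c at this
  omega

/-- The seminormal formulas all rest on this trichotomy: the ratio of consecutive weights is `t` or
`t⁻¹` exactly when the swap leaves the compatible labellings. -/
theorem Compatible.boxWeight_consecutive {T : RYT μ} {l : Box μ ≃ Fin μ.card}
    (h : Compatible T l) {b c : Box μ} (hl : (l c : ℕ) = l b + 1) :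
    (LeftOf b c ∧ T.entry b = T.entry c ∧ boxWeight T c = t * boxWeight T b) ∨
    (Above b c ∧ T.entry b = T.entry c ∧ boxWeight T b = t * boxWeight T c) ∨
    (¬ Forced T b c ∧ boxWeight T b ≠ t * boxWeight T c ∧
      boxWeight T c ≠ t * boxWeight T b) := by
  by_cases hf : Forced T b c
  · obtain ⟨h1 | h1, h2⟩ := hf
    · refine Or.inl ⟨h1, h2, ?_⟩
      have := (PSYT.ofCompatible T l h).content_of_leftOf h2 h1 hl
      rw [t_mul_boxWeight, boxWeight, h2, this]
    · refine Or.inr (Or.inl ⟨h1, h2, ?_⟩)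
      have := (PSYT.ofCompatible T l h).content_of_above h2 h1 hl
      rw [t_mul_boxWeight, boxWeight, h2, this]
  · refine Or.inr (Or.inr ⟨hf, fun he => hf ?_, fun he => hf ?_⟩)
    · rw [t_mul_boxWeight] at he
      obtain ⟨h1, h2⟩ := q_pow_mul_t_zpow_injective he
      exact ⟨Or.inr ((PSYT.ofCompatible T l h).above_of_content h1 h2 hl), h1⟩
    · rw [t_mul_boxWeight] at he
      obtain ⟨h1, h2⟩ := q_pow_mul_t_zpow_injective he
      exact ⟨Or.inl ((PSYT.ofCompatible T l h).leftOf_of_content h1.symm h2 hl), h1.symm⟩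

end Tableaux

end VVMacdonald

namespace VVMacdonald

/-! ### Coefficients of the seminormal form -/

section Coefficients

variable {F : Type*} [Field F] (t : F)

/-- The diagonal coefficient of the seminormal form. -/
def coefA (x y : F) : F := (1 - t) * x / (x - y)

/-- The off-diagonal coefficient of the seminormal form. -/
def coefB (x y : F) : F := (x - t * y) / (x - y)

variable {t}

theorem coefA_add {x y : F} (h : x ≠ y) : coefA t x y + coefA t y x = 1 - t := by
  have h1 := sub_ne_zero.mpr h
  have h2 := sub_ne_zero.mpr h.symm
  rw [coefA, coefA]; field_simp; ring

/-- The normalization of the basis is chosen for this identity. The coefficient of `T_i u` at a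
labelling combines two coefficients of `u` with weights of sum 1, so constant coefficients are
preserved. -/
theorem coefB_eq {x y : F} (h : x ≠ y) : coefB t x y = 1 - coefA t y x := by
  have h1 := sub_ne_zero.mpr h
  have h2 := sub_ne_zero.mpr h.symm
  rw [coefA, coefB]; field_simp; ring

theorem coefA_sq_add {x y : F} (h : x ≠ y) :
    coefA t x y * coefA t x y + coefB t x y * coefB t y x = (1 - t) * coefA t x y + t := by
  rw [coefB_eq h, coefB_eq h.symm]
  linear_combination (coefA t x y - 1) * coefA_add (t := t) h

theorem coefA_smul {k : F} (hk : k ≠ 0) (x y : F) : coefA t (k * x) (k * y) = coefA t x y := by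
  rw [coefA, coefA, ← mul_sub, mul_left_comm, mul_div_mul_left _ _ hk]

theorem coefB_smul {k : F} (hk : k ≠ 0) (x y : F) : coefB t (k * x) (k * y) = coefB t x y := by
  rw [coefB, coefB, ← mul_sub, mul_left_comm, ← mul_sub, mul_div_mul_left _ _ hk]

theorem coefB_t_mul (x : F) : coefB t (t * x) x = 0 := by simp [coefB]

theorem coefB_ne_zero {x y : F} (h : x ≠ y) (h' : x ≠ t * y) : coefB t x y ≠ 0 :=
  div_ne_zero (sub_ne_zero.mpr h') (sub_ne_zero.mpr h)

theorem coefA_self_t_mul {x : F} (hx : x ≠ 0) (ht : t ≠ 1) : coefA t x (t * x) = 1 := by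
  have : x - t * x ≠ 0 := by
    rw [← one_sub_mul]; exact mul_ne_zero (sub_ne_zero.mpr ht.symm) hx
  rw [coefA, div_eq_one_iff_eq this]; ring

theorem coefA_t_mul_self {x : F} (hx : x ≠ 0) (ht : t ≠ 1) : coefA t (t * x) x = -t := by
  have : t * x - x ≠ 0 := by
    rw [← sub_one_mul]; exact mul_ne_zero (sub_ne_zero.mpr ht) hx
  rw [coefA, div_eq_iff this]; ring

/-- The braid relation in seminormal form. -/
theorem braid_of_seminormal {M : Type*} [AddCommGroup M] [Module F M] (P Q : Module.End F M)
    {x y z : F} (hxy : x ≠ y) (hyz : y ≠ z) (hxz : x ≠ z) {f f213 f132 f231 f312 f321 : M}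
    (e1 : P f = coefA t x y • f + coefB t x y • f213)
    (e2 : Q f = coefA t y z • f + coefB t y z • f132)
    (e3 : Q f213 = coefA t x z • f213 + coefB t x z • f231)
    (e4 : P f132 = coefA t x z • f132 + coefB t x z • f312)
    (e5 : P f231 = coefA t y z • f231 + coefB t y z • f321)
    (e6 : Q f312 = coefA t x y • f312 + coefB t x y • f321)
    (e7 : coefB t x y • P f213 = coefB t x y • (coefA t y x • f213 + coefB t y x • f))
    (e8 : coefB t y z • Q f132 = coefB t y z • (coefA t z y • f132 + coefB t z y • f)) :
    P (Q (P f)) = Q (P (Q f)) := by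
  -- The term in `P f213` stays together with its factor `coefB t x y`: only that multiple is known,
  -- since `f213` may be zero for want of a tableau. The same holds for `Q f132`.
  have l : P (Q (P f)) = (coefA t x y * coefA t y z) • P f
      + (coefA t x y * coefB t y z) • P f132 + coefA t x z • (coefB t x y • P f213)
      + (coefB t x y * coefB t x z) • P f231 := by
    rw [e1, map_add, map_smul, map_smul, e2, e3]
    simp only [map_add, map_smul, smul_add, smul_smul]
    rw [e1, mul_comm (coefB t x y) (coefA t x z)]
    simp only [smul_add, smul_smul]
    abel
  have r : Q (P (Q f)) = (coefA t y z * coefA t x y) • Q f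
      + (coefA t y z * coefB t x y) • Q f213 + coefA t x z • (coefB t y z • Q f132)
      + (coefB t y z * coefB t x z) • Q f312 := by
    rw [e2, map_add, map_smul, map_smul, e1, e4]
    simp only [map_add, map_smul, smul_add, smul_smul]
    rw [e2, mul_comm (coefB t y z) (coefA t x z)]
    simp only [smul_add, smul_smul]
    abel
  have h1 := sub_ne_zero.mpr hxy
  have h2 := sub_ne_zero.mpr hyz
  have h3 := sub_ne_zero.mpr hxz
  have h4 := sub_ne_zero.mpr hxy.symm
  have h5 := sub_ne_zero.mpr hyz.symm
  rw [l, r, e7, e8, e1, e2, e3, e4, e5, e6]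
  simp only [coefA, coefB]
  match_scalars <;> field_simp <;> ring

end Coefficients

/-! ### The model of the induced module -/

section Model

variable {μ : YoungDiagram}

/-- The space with basis the periodic standard tableaux. -/
abbrev Model (μ : YoungDiagram) : Type := PSYT μ →₀ K

open Classical in
/-- The basis vector of a labelling, or zero if the labelling is not compatible. -/
noncomputable def vec (T : RYT μ) (l : Box μ ≃ Fin μ.card) : Model μ :=
  if h : Compatible T l then Finsupp.single (PSYT.ofCompatible T l h) 1 else 0

theorem vec_of_compatible {T : RYT μ} {l : Box μ ≃ Fin μ.card} (h : Compatible T l) :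
    vec T l = Finsupp.single (PSYT.ofCompatible T l h) 1 := dif_pos h

theorem vec_of_not {T : RYT μ} {l : Box μ ≃ Fin μ.card} (h : ¬ Compatible T l) :
    vec T l = 0 := dif_neg h

theorem vec_tableau (τ : PSYT μ) : vec τ.shapeRYT τ.label = Finsupp.single τ 1 :=
  vec_of_compatible τ.compatible

theorem Model.ext {M : Type*} [AddCommGroup M] [Module K M] {f g : Model μ →ₗ[K] M}
    (h : ∀ T l, Compatible T l → f (vec T l) = g (vec T l)) : f = g := by
  apply Finsupp.lhom_ext'
  intro τ
  apply LinearMap.ext_ring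
  change f (Finsupp.single τ 1) = g (Finsupp.single τ 1)
  rw [← vec_tableau]
  exact h _ _ τ.compatible

/-- The action of `θ_j` on the model. -/
noncomputable def opTheta (j : Fin μ.card) : Module.End K (Model μ) :=
  Finsupp.linearCombination K fun τ =>
    boxWeight τ.shapeRYT (τ.label.symm j) • Finsupp.single τ 1

theorem opTheta_single (j : Fin μ.card) (τ : PSYT μ) : opTheta j (Finsupp.single τ 1)
    = boxWeight τ.shapeRYT (τ.label.symm j) • Finsupp.single τ 1 := by
  rw [opTheta, Finsupp.linearCombination_single, one_smul]

theorem opTheta_vec (j : Fin μ.card) (T : RYT μ) (l : Box μ ≃ Fin μ.card) :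
    opTheta j (vec T l) = boxWeight T (l.symm j) • vec T l := by
  by_cases h : Compatible T l
  · rw [vec_of_compatible h, opTheta_single]
    rfl
  · rw [vec_of_not h, map_zero, smul_zero]

/-- The action of `T_i` on the model. -/
noncomputable def opT (i : Fin (μ.card - 1)) : Module.End K (Model μ) :=
  Finsupp.linearCombination K fun τ =>
    coefA t (boxWeight τ.shapeRYT (τ.label.symm (lo i)))
        (boxWeight τ.shapeRYT (τ.label.symm (hi i))) • vec τ.shapeRYT τ.label +
      coefB t (boxWeight τ.shapeRYT (τ.label.symm (lo i)))
        (boxWeight τ.shapeRYT (τ.label.symm (hi i))) •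
          vec τ.shapeRYT (τ.label.trans (simpleTransposition i))

/-- The formula survives when neither labelling is compatible, both sides being zero. The case to
exclude is a compatible swap of an incompatible `l`. -/
theorem opT_vec {T : RYT μ} {l : Box μ ≃ Fin μ.card} {i : Fin (μ.card - 1)}
    (h : Compatible T (l.trans (simpleTransposition i)) → Compatible T l) :
    opT i (vec T l) =
      coefA t (boxWeight T (l.symm (lo i))) (boxWeight T (l.symm (hi i))) • vec T l +
      coefB t (boxWeight T (l.symm (lo i))) (boxWeight T (l.symm (hi i))) •
          vec T (l.trans (simpleTransposition i)) := by
  by_cases hl : Compatible T l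
  · rw [vec_of_compatible hl, opT, Finsupp.linearCombination_single, one_smul,
      ← vec_of_compatible hl]
    rfl
  · rw [vec_of_not hl, vec_of_not fun h' => hl (h h'), map_zero, smul_zero, smul_zero, add_zero]

theorem Compatible.lo_hi {T : RYT μ} {l : Box μ ≃ Fin μ.card} (h : Compatible T l)
    (i : Fin (μ.card - 1)) :
    boxWeight T (l.symm (lo i)) ≠ boxWeight T (l.symm (hi i)) :=
  h.boxWeight_ne (by simp) (by simp)

/-- Without the factor `coefB t x y` the identity fails for a forced pair in a column: the swapped
vector is zero, but `coefB t y x` is not. With it, one of the two coefficients vanishes whenever the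
swap is not allowed. -/
theorem coefB_smul_opT_swap {T : RYT μ} {l : Box μ ≃ Fin μ.card} (h : Compatible T l)
    (i : Fin (μ.card - 1)) {x y : K} (hx : x = boxWeight T (l.symm (lo i)))
    (hy : y = boxWeight T (l.symm (hi i))) :
    coefB t x y • opT i (vec T (l.trans (simpleTransposition i)))
      = coefB t x y • (coefA t y x • vec T (l.trans (simpleTransposition i))
        + coefB t y x • vec T l) := by
  by_cases hs : Compatible T (l.trans (simpleTransposition i))
  · rw [opT_vec fun _ => hs, Equiv.trans_simpleTransposition_self,
      Equiv.trans_simpleTransposition_symm, Equiv.trans_simpleTransposition_symm,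
      simpleTransposition_lo, simpleTransposition_hi, hx, hy]
  · rw [vec_of_not hs, map_zero, smul_zero, smul_zero, zero_add, smul_smul, hx, hy]
    rw [h.swap_iff, not_not] at hs
    rcases h.boxWeight_consecutive (b := l.symm (lo i)) (c := l.symm (hi i)) (by simp) with
      h1 | h1 | h1
    · rw [h1.2.2, coefB_t_mul, mul_zero, zero_smul]
    · rw [h1.2.2, coefB_t_mul, zero_mul, zero_smul]
    · exact absurd hs h1.1

theorem opT_opT_vec {T : RYT μ} {l : Box μ ≃ Fin μ.card} (h : Compatible T l)
    (i : Fin (μ.card - 1)) :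
    opT i (opT i (vec T l)) = (1 - t) • opT i (vec T l) + t • vec T l := by
  have hne := h.lo_hi i
  have h1 := coefB_smul_opT_swap h i rfl rfl
  have h2 := opT_vec (i := i) fun _ => h
  generalize boxWeight T (l.symm (lo i)) = x at *
  generalize boxWeight T (l.symm (hi i)) = y at *
  rw [h2, map_add, map_smul, map_smul, h1, h2]
  have e1 := coefA_sq_add (t := t) hne
  have e2 := coefA_add (t := t) hne
  have e3 : coefA t x y * coefB t x y + coefB t x y * coefA t y x = (1 - t) * coefB t x y := by
    rw [← e2]; ring
  calc _ = (coefA t x y * coefA t x y + coefB t x y * coefB t y x) • vec T l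
        + (coefA t x y * coefB t x y + coefB t x y * coefA t y x) •
          vec T (l.trans (simpleTransposition i)) := by
        simp only [smul_add, add_smul, smul_smul]; abel
    _ = _ := by rw [e1, e3]; simp only [smul_add, add_smul, smul_smul]; abel

theorem opT_quad (i : Fin (μ.card - 1)) :
    (opT i - 1) * (opT i + algebraMap K (Module.End K (Model μ)) t) = 0 := by
  apply Model.ext
  intro T l h
  simp only [Module.End.mul_apply, LinearMap.add_apply, LinearMap.sub_apply, map_add,
    Module.algebraMap_end_apply, map_smul, Module.End.one_apply, LinearMap.zero_apply,
    opT_opT_vec h, sub_smul, one_smul, smul_sub]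
  abel

theorem opT_braid (i j : Fin (μ.card - 1)) (hij : (j : ℕ) = i + 1) :
    opT i * opT j * opT i = opT j * opT i * opT (μ := μ) j := by
  apply Model.ext
  intro T l h
  have e : hi i = lo j := Fin.ext hij.symm
  have n1 : lo i ≠ lo j := fun h' => by simp [Fin.ext_iff] at h'; omega
  have n2 : lo i ≠ hi j := fun h' => by simp [Fin.ext_iff] at h'; omega
  have n3 : hi j ≠ hi i := fun h' => by simp [Fin.ext_iff] at h'; omega
  have hji : (lo i : ℕ) < lo j := by simp; omega
  have hjk : (lo j : ℕ) < hi j := lo_lt_hi j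
  have si1 : simpleTransposition i (lo i) = lo j := by rw [simpleTransposition_lo, e]
  have si2 : simpleTransposition i (lo j) = lo i := by rw [← e, simpleTransposition_hi]
  have si3 : simpleTransposition i (hi j) = hi j := simpleTransposition_of_ne n2.symm n3
  have sj1 : simpleTransposition j (lo i) = lo i := simpleTransposition_of_ne n1 n2
  have sj2 : simpleTransposition j (lo j) = hi j := simpleTransposition_lo j
  have sj3 : simpleTransposition j (hi j) = lo j := simpleTransposition_hi j
  simp only [Module.End.mul_apply]
  have hbr : ((l.trans (simpleTransposition j)).trans (simpleTransposition i)).trans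
      (simpleTransposition j) = ((l.trans (simpleTransposition i)).trans
      (simpleTransposition j)).trans (simpleTransposition i) := by
    have := simpleTransposition_braid hij
    ext b
    have h2 := congrArg (fun σ : Equiv.Perm (Fin μ.card) => (σ (l b) : ℕ)) this
    simpa using h2.symm
  refine braid_of_seminormal (t := t) (opT i) (opT j)
    (x := boxWeight T (l.symm (lo i))) (y := boxWeight T (l.symm (lo j)))
    (z := boxWeight T (l.symm (hi j)))
    (f213 := vec T (l.trans (simpleTransposition i)))
    (f132 := vec T (l.trans (simpleTransposition j)))
    (f231 := vec T ((l.trans (simpleTransposition i)).trans (simpleTransposition j)))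
    (f312 := vec T ((l.trans (simpleTransposition j)).trans (simpleTransposition i)))
    (f321 := vec T (((l.trans (simpleTransposition i)).trans
      (simpleTransposition j)).trans (simpleTransposition i)))
    ?_ ?_ ?_ ?_ ?_ ?_ ?_ ?_ ?_ ?_ ?_
  · exact h.boxWeight_ne (by simpa using hji) (by simp; omega)
  · exact h.boxWeight_ne (by simp) (by simp)
  · exact h.boxWeight_ne (by simp; omega) (by simp; omega)
  · rw [opT_vec fun _ => h, e]
  · rw [opT_vec fun _ => h]
  -- From here on the labelling need not be compatible. The condition of `opT_vec` holds because `l`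
  -- is compatible and orders the two boxes concerned increasingly.
  · rw [opT_vec fun h' => h.of_swap h' ?_]
    · simp only [Equiv.trans_simpleTransposition_symm, si2, si3]
    · simp only [Equiv.trans_simpleTransposition_symm, si2, si3, Equiv.apply_symm_apply]
      exact hji.trans hjk
  · rw [opT_vec fun h' => h.of_swap h' ?_]
    · simp only [Equiv.trans_simpleTransposition_symm, e, sj1, sj2]
    · simp only [Equiv.trans_simpleTransposition_symm, e, sj1, sj2, Equiv.apply_symm_apply]
      exact hji.trans hjk
  · rw [opT_vec fun h' => h.of_swap h' ?_]
    · simp only [Equiv.trans_simpleTransposition_symm, e, sj1, sj2, si1, si3]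
    · simp only [Equiv.trans_simpleTransposition_symm, e, sj1, sj2, si1, si3,
        Equiv.apply_symm_apply]
      exact hjk
  · rw [opT_vec fun h' => h.of_swap h' ?_, hbr]
    · simp only [Equiv.trans_simpleTransposition_symm, sj1, si2, si3, sj3]
    · simp only [Equiv.trans_simpleTransposition_symm, sj1, si2, si3, sj3,
        Equiv.apply_symm_apply]
      exact hji
  · exact coefB_smul_opT_swap h i rfl (by rw [e])
  · exact coefB_smul_opT_swap h j rfl rfl

theorem opT_far (i j : Fin (μ.card - 1)) (hij : (i : ℕ) + 1 < j ∨ (j : ℕ) + 1 < i) :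
    opT i * opT j = opT j * opT (μ := μ) i := by
  apply Model.ext
  intro T l h
  have key : ∀ i j : Fin (μ.card - 1), ((i : ℕ) + 1 < j ∨ (j : ℕ) + 1 < i) →
      opT i (vec T (l.trans (simpleTransposition j))) =
      coefA t (boxWeight T (l.symm (lo i))) (boxWeight T (l.symm (hi i))) •
        vec T (l.trans (simpleTransposition j)) +
      coefB t (boxWeight T (l.symm (lo i))) (boxWeight T (l.symm (hi i))) •
          vec T ((l.trans (simpleTransposition j)).trans (simpleTransposition i)) := by
    intro i j hij
    have n1 : simpleTransposition j (lo i) = lo i := simpleTransposition_of_ne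
      (fun h' => by simp [Fin.ext_iff] at h'; omega) (fun h' => by simp [Fin.ext_iff] at h'; omega)
    have n2 : simpleTransposition j (hi i) = hi i := simpleTransposition_of_ne
      (fun h' => by simp [Fin.ext_iff] at h'; omega) (fun h' => by simp [Fin.ext_iff] at h'; omega)
    rw [opT_vec fun h' => h.of_swap h' ?_]
    · simp only [Equiv.trans_simpleTransposition_symm, n1, n2]
    · simp only [Equiv.trans_simpleTransposition_symm, n1, n2, Equiv.apply_symm_apply]
      exact lo_lt_hi i
  have hc : (l.trans (simpleTransposition j)).trans (simpleTransposition i)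
      = (l.trans (simpleTransposition i)).trans (simpleTransposition j) := by
    ext b
    have h2 := congrArg (fun σ : Equiv.Perm (Fin μ.card) => (σ (l b) : ℕ))
      (simpleTransposition_far hij)
    simpa using h2
  rw [Module.End.mul_apply, Module.End.mul_apply, opT_vec (i := i) fun _ => h,
    opT_vec (i := j) fun _ => h]
  simp only [map_add, map_smul]
  rw [key i j hij, key j i hij.symm, hc, opT_vec (i := i) fun _ => h,
    opT_vec (i := j) fun _ => h]
  simp only [smul_add, smul_smul]
  simp only [mul_comm]
  abel

/-- This is `θ_{i+1} = t T_i⁻¹ θ_i T_i⁻¹` cleared of inverses. -/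
theorem opT_opTheta_opT (i : Fin (μ.card - 1)) :
    opT i * opTheta (hi i) * opT i = t • opTheta (μ := μ) (lo i) := by
  apply Model.ext
  intro T l h
  have h1 := coefB_smul_opT_swap h i rfl rfl
  have h2 := opT_vec (i := i) fun _ => h
  have hne := h.lo_hi i
  rw [Module.End.mul_apply, Module.End.mul_apply, LinearMap.smul_apply, opTheta_vec, h2,
    map_add, map_smul, map_smul, opTheta_vec, opTheta_vec, Equiv.trans_simpleTransposition_symm,
    simpleTransposition_hi]
  generalize boxWeight T (l.symm (lo i)) = x at *
  generalize boxWeight T (l.symm (hi i)) = y at *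
  rw [smul_comm _ x, map_add, map_smul, map_smul, map_smul, map_smul, h1, h2]
  have e1 := sub_ne_zero.mpr hne
  have e2 := sub_ne_zero.mpr hne.symm
  have c1 : coefA t x y * y * coefA t x y + x * coefB t x y * coefB t y x = t * x := by
    rw [coefA, coefB, coefB]; field_simp; ring
  have c2 : coefA t x y * y * coefB t x y + x * coefB t x y * coefA t y x = 0 := by
    rw [coefA, coefB, coefA]; field_simp; ring
  calc _ = (coefA t x y * y * coefA t x y + x * coefB t x y * coefB t y x) • vec T l
        + (coefA t x y * y * coefB t x y + x * coefB t x y * coefA t y x) •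
          vec T (l.trans (simpleTransposition i)) := by
        simp only [smul_add, add_smul, smul_smul, mul_assoc]; abel
    _ = _ := by rw [c1, c2, zero_smul, add_zero, smul_smul]

theorem opT_opTheta_comm (i : Fin (μ.card - 1)) (j : Fin μ.card) (h1 : j ≠ lo i) (h2 : j ≠ hi i) :
    opT i * opTheta j = opTheta (μ := μ) j * opT i := by
  apply Model.ext
  intro T l h
  simp only [Module.End.mul_apply, opTheta_vec, opT_vec (i := i) fun _ => h, map_add, map_smul,
    Equiv.trans_simpleTransposition_symm, simpleTransposition_of_ne h1 h2, smul_add]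
  rw [smul_comm, smul_comm (boxWeight T (l.symm j)) (coefB _ _ _)]

theorem opTheta_comm (i j : Fin μ.card) :
    opTheta i * opTheta j = opTheta (μ := μ) j * opTheta i := by
  apply Model.ext
  intro T l h
  simp only [Module.End.mul_apply, opTheta_vec, map_smul]
  rw [smul_comm]

end Model
end VVMacdonald

namespace VVMacdonald

/-! ### The shift of periodic standard tableaux -/

section Shift

/-- The cyclic rotation that lowers labels by one. -/
def rotDown (n : ℕ) : Fin n ≃ Fin n := (finRotate n).symm

theorem finRotate_val {n : ℕ} (j : Fin n) :
    (finRotate n j : ℕ) = if (j : ℕ) + 1 = n then 0 else (j : ℕ) + 1 := by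
  cases n with
  | zero => exact j.elim0
  | succ n =>
    rw [coe_finRotate]
    simp only [Fin.ext_iff, Fin.val_last, Nat.add_right_cancel_iff]

theorem rotDown_val {n : ℕ} (j : Fin n) :
    (rotDown n j : ℕ) = if (j : ℕ) = 0 then n - 1 else (j : ℕ) - 1 := by
  obtain ⟨k, rfl⟩ := (finRotate n).surjective j
  have h1 := finRotate_val k
  have h2 := k.2
  rw [rotDown, Equiv.symm_apply_apply]
  split_ifs at h1 <;> split_ifs <;> omega

theorem simpleTransposition_val {n : ℕ} (i : Fin (n - 1)) (a : Fin n) :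
    (simpleTransposition i a : ℕ)
      = if (a : ℕ) = i then (i : ℕ) + 1 else if (a : ℕ) = i + 1 then (i : ℕ) else a := by
  simp only [simpleTransposition, Equiv.swap_apply_def, Fin.ext_iff, lo_val, hi_val]
  split_ifs <;> simp

/-- The increment of the exponent under the shift. -/
def bump {n : ℕ} (j : Fin n) : ℕ := if (j : ℕ) = 0 then 1 else 0

theorem bump_val {n : ℕ} (j : Fin n) : bump j = if (j : ℕ) = 0 then 1 else 0 := rfl

/-- `1 q^b` is the first product of exponent `b`, and its image `n q^{b+1}` is the last of exponent
`b + 1`; these are adjacent places in the order, so nothing is overtaken. -/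
theorem LabelLT.rotDown {n : ℕ} {x y : Fin n × ℕ} (h : LabelLT x y) :
    LabelLT (rotDown n x.1, x.2 + bump x.1) (rotDown n y.1, y.2 + bump y.1) := by
  simp only [LabelLT, Fin.lt_def, rotDown_val, bump] at *
  split_ifs <;> omega

/-- The condition keeps the subtraction from being truncated. It is needed for `y` alone, because `n
q^0` is the largest product and cannot be `x`. -/
theorem LabelLT.rotUp {n : ℕ} {x y : Fin n × ℕ} (h : LabelLT x y)
    (hy : (y.1 : ℕ) + 1 = n → 0 < y.2) :
    LabelLT (finRotate n x.1, x.2 - bump (finRotate n x.1))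
      (finRotate n y.1, y.2 - bump (finRotate n y.1)) := by
  have e1 := finRotate_val x.1
  have e2 := finRotate_val y.1
  have e3 := bump_val (finRotate n x.1)
  have e4 := bump_val (finRotate n y.1)
  simp only [LabelLT, Fin.lt_def] at *
  split_ifs at e1 <;> split_ifs at e2 <;> split_ifs at e3 <;> split_ifs at e4 <;> omega

variable {μ : YoungDiagram}

/-- The shift `1 q^b ↦ n q^{b+1}`, `(i+1) q^b ↦ i q^b` of periodic standard tableaux. -/
def PSYT.shift (τ : PSYT μ) : PSYT μ where
  label := τ.label.trans (rotDown μ.card)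
  expo b := τ.expo b + bump (τ.label b)
  row_strict b c h := (τ.row_strict b c h).rotDown
  col_strict b c h := (τ.col_strict b c h).rotDown

/-- The inverse of the shift, where it is defined. -/
def PSYT.unshift (τ : PSYT μ) (h : ∀ b, (τ.label b : ℕ) + 1 = μ.card → 0 < τ.expo b) :
    PSYT μ where
  label := τ.label.trans (finRotate μ.card)
  expo b := τ.expo b - bump (finRotate μ.card (τ.label b))
  row_strict b c hbc := (τ.row_strict b c hbc).rotUp (h c)
  col_strict b c hbc := (τ.col_strict b c hbc).rotUp (h c)

theorem PSYT.shift_unshift (τ : PSYT μ)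
    (h : ∀ b, (τ.label b : ℕ) + 1 = μ.card → 0 < τ.expo b) : (τ.unshift h).shift = τ := by
  apply PSYT.ext'
  · exact Equiv.ext fun b => (finRotate μ.card).symm_apply_apply _
  · funext b
    simp only [PSYT.shift, PSYT.unshift, Equiv.trans_apply]
    have h1 := h b
    have h2 := finRotate_val (τ.label b)
    have h3 := (τ.label b).2
    have h4 := bump_val (finRotate μ.card (τ.label b))
    split_ifs at h2 <;> split_ifs at h4 <;> omega

/-- The total exponent. -/
def PSYT.degree (τ : PSYT μ) : ℕ := ∑ b, τ.expo b

theorem PSYT.degree_shift (τ : PSYT μ) (hn : 0 < μ.card) :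
    τ.shift.degree = τ.degree + 1 := by
  rw [PSYT.degree, PSYT.degree, PSYT.shift, Finset.sum_add_distrib]
  congr 1
  rw [← Equiv.sum_comp τ.label.symm]
  simp only [Equiv.apply_symm_apply]
  rw [Finset.sum_eq_single (⟨0, hn⟩ : Fin μ.card)]
  · simp [bump]
  · intro j _ hj
    rw [bump, if_neg]
    exact fun h => hj (Fin.ext h)
  · simp

/-- The operator that shifts tableaux. -/
noncomputable def opShift (μ : YoungDiagram) : Module.End K (Model μ) :=
  Finsupp.lmapDomain K K PSYT.shift

theorem opShift_single (τ : PSYT μ) :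
    opShift μ (Finsupp.single τ 1) = Finsupp.single τ.shift 1 := by
  simp [opShift]

/-- A map of tableaux that carries the pair `lo i, hi i` to `lo i', hi i'` intertwines `T_i`
and `T_{i'}`. -/
theorem lmapDomain_opT (f : PSYT μ → PSYT μ) (i i' : Fin (μ.card - 1)) (k : ℕ) (τ : PSYT μ)
    (hlo : (f τ).label.symm (lo i') = τ.label.symm (lo i))
    (hhi : (f τ).label.symm (hi i') = τ.label.symm (hi i))
    (elo : (f τ).expo (τ.label.symm (lo i)) = τ.expo (τ.label.symm (lo i)) + k)
    (ehi : (f τ).expo (τ.label.symm (hi i)) = τ.expo (τ.label.symm (hi i)) + k)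
    (hswap : ∀ τ' : PSYT μ, τ'.label = τ.label.trans (simpleTransposition i) →
      τ'.expo = τ.expo → (f τ').label = (f τ).label.trans (simpleTransposition i') ∧
        (f τ').expo = (f τ).expo) :
    Finsupp.lmapDomain K K f (opT i (Finsupp.single τ 1)) = opT i' (Finsupp.single (f τ) 1) := by
  -- Both weights acquire the same factor `q^k`, and the seminormal coefficients are homogeneous of
  -- degree zero.
  have hw : ∀ b, (f τ).expo b = τ.expo b + k →
      boxWeight (f τ).shapeRYT b = q ^ k * boxWeight τ.shapeRYT b := by
    intro b hb
    change q ^ (f τ).expo b * _ = q ^ k * (q ^ τ.expo b * _)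
    rw [hb, pow_add]; ring
  have hF : Forced (f τ).shapeRYT (τ.label.symm (lo i)) (τ.label.symm (hi i)) ↔
      Forced τ.shapeRYT (τ.label.symm (lo i)) (τ.label.symm (hi i)) := by
    change (_ ∧ (f τ).expo _ = (f τ).expo _) ↔ (_ ∧ τ.expo _ = τ.expo _)
    rw [elo, ehi, Nat.add_right_cancel_iff]
  have hv : Finsupp.lmapDomain K K f
      (vec τ.shapeRYT (τ.label.trans (simpleTransposition i)))
      = vec (f τ).shapeRYT ((f τ).label.trans (simpleTransposition i')) := by
    by_cases hs : Compatible τ.shapeRYT (τ.label.trans (simpleTransposition i))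
    · have hs' : Compatible (f τ).shapeRYT ((f τ).label.trans (simpleTransposition i')) := by
        rw [(f τ).compatible.swap_iff, hlo, hhi, hF]
        rwa [τ.compatible.swap_iff] at hs
      rw [vec_of_compatible hs, vec_of_compatible hs', Finsupp.lmapDomain_apply,
        Finsupp.mapDomain_single]
      congr 1
      obtain ⟨h1, h2⟩ := hswap (PSYT.ofCompatible _ _ hs) rfl rfl
      exact PSYT.ext' h1 h2
    · have hs' : ¬ Compatible (f τ).shapeRYT ((f τ).label.trans (simpleTransposition i')) := by
        rw [(f τ).compatible.swap_iff, hlo, hhi, hF]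
        rwa [τ.compatible.swap_iff] at hs
      rw [vec_of_not hs, vec_of_not hs', map_zero]
  rw [← vec_tableau, ← vec_tableau, opT_vec fun _ => τ.compatible,
    opT_vec fun _ => (f τ).compatible, map_add, map_smul, map_smul, hv, hlo, hhi, hw _ elo,
    hw _ ehi, coefA_smul (pow_ne_zero _ q_ne_zero), coefB_smul (pow_ne_zero _ q_ne_zero)]
  congr 2
  rw [vec_tableau, vec_tableau, Finsupp.lmapDomain_apply, Finsupp.mapDomain_single]

theorem PSYT.shift_label_symm (τ : PSYT μ) (j : Fin μ.card) :
    τ.shift.label.symm j = τ.label.symm (finRotate μ.card j) := by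
  simp [PSYT.shift, rotDown]

theorem opShift_opT (i i' : Fin (μ.card - 1)) (h : (i : ℕ) = i' + 1) :
    opShift μ * opT i = opT i' * opShift μ := by
  have r1 : finRotate μ.card (lo i') = lo i := by
    ext; rw [finRotate_val, if_neg] <;> simp <;> omega
  have r2 : finRotate μ.card (hi i') = hi i := by
    ext; rw [finRotate_val, if_neg] <;> simp <;> omega
  apply Model.ext
  intro T l hl
  rw [vec_of_compatible hl, Module.End.mul_apply, Module.End.mul_apply, opShift_single]
  generalize PSYT.ofCompatible T l hl = τ
  apply lmapDomain_opT PSYT.shift i i' 0 τ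
  · rw [PSYT.shift_label_symm, r1]
  · rw [PSYT.shift_label_symm, r2]
  · simp only [PSYT.shift, Equiv.apply_symm_apply, bump, lo_val]
    rw [if_neg (by omega)]
  · simp [PSYT.shift, bump]
  · intro τ' h1 h2
    simp only [PSYT.shift, h1, h2]
    constructor
    · ext b
      simp only [Equiv.trans_apply]
      have e1 := simpleTransposition_val i (τ.label b)
      have e2 := rotDown_val (simpleTransposition i (τ.label b))
      have e3 := rotDown_val (τ.label b)
      have e4 := simpleTransposition_val i' (rotDown μ.card (τ.label b))
      have e5 := (τ.label b).2
      split_ifs at e1 <;> split_ifs at e2 <;> split_ifs at e3 <;> split_ifs at e4 <;> omega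
    · funext b
      simp only [Equiv.trans_apply]
      have e1 := simpleTransposition_val i (τ.label b)
      have e2 := bump_val (simpleTransposition i (τ.label b))
      have e3 := bump_val (τ.label b)
      split_ifs at e1 <;> split_ifs at e2 <;> split_ifs at e3 <;> omega

/-- Two shifts wrap both labels 1 and 2 around to `n - 1` and `n`, so both exponents grow by one,
which is the case `k = 1` of `lmapDomain_opT`. -/
theorem opShift_opShift_opT (i i' : Fin (μ.card - 1)) (h : (i : ℕ) = 0)
    (h' : (i' : ℕ) + 2 = μ.card) :
    opShift μ * opShift μ * opT i = opT i' * (opShift μ * opShift μ) := by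
  have r1 : finRotate μ.card (finRotate μ.card (lo i')) = lo i := by
    ext
    have e1 := finRotate_val (lo i')
    have e2 := finRotate_val (finRotate μ.card (lo i'))
    have e3 := lo_val i
    have e4 := lo_val i'
    split_ifs at e1 <;> split_ifs at e2 <;> omega
  have r2 : finRotate μ.card (finRotate μ.card (hi i')) = hi i := by
    ext
    have e1 := finRotate_val (hi i')
    have e2 := finRotate_val (finRotate μ.card (hi i'))
    have e3 := hi_val i
    have e4 := hi_val i'
    split_ifs at e1 <;> split_ifs at e2 <;> omega
  apply Model.ext
  intro T l hl
  have e : opShift μ * opShift μ = Finsupp.lmapDomain K K (PSYT.shift ∘ PSYT.shift) := by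
    rw [Finsupp.lmapDomain_comp]; rfl
  rw [e, vec_of_compatible hl, Module.End.mul_apply, Module.End.mul_apply,
    Finsupp.lmapDomain_apply K K _ (Finsupp.single _ _), Finsupp.mapDomain_single]
  generalize PSYT.ofCompatible T l hl = τ
  apply lmapDomain_opT (PSYT.shift ∘ PSYT.shift) i i' 1 τ
  · rw [Function.comp_apply, PSYT.shift_label_symm, PSYT.shift_label_symm, r1]
  · rw [Function.comp_apply, PSYT.shift_label_symm, PSYT.shift_label_symm, r2]
  · simp only [Function.comp_apply, PSYT.shift, Equiv.trans_apply, Equiv.apply_symm_apply,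
      rotDown_val, lo_val, bump]
    split_ifs <;> omega
  · simp only [Function.comp_apply, PSYT.shift, Equiv.trans_apply, Equiv.apply_symm_apply,
      rotDown_val, hi_val, bump]
    split_ifs <;> omega
  · intro τ' h1 h2
    simp only [Function.comp_apply, PSYT.shift, h1, h2]
    constructor
    · ext b
      simp only [Equiv.trans_apply]
      have e1 := simpleTransposition_val i (τ.label b)
      have e2 := rotDown_val (simpleTransposition i (τ.label b))
      have e3 := rotDown_val (rotDown μ.card (simpleTransposition i (τ.label b)))
      have e4 := rotDown_val (τ.label b)
      have e5 := rotDown_val (rotDown μ.card (τ.label b))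
      have e6 := simpleTransposition_val i' (rotDown μ.card (rotDown μ.card (τ.label b)))
      have e7 := (τ.label b).2
      split_ifs at e1 <;> split_ifs at e2 <;> split_ifs at e4 <;> split_ifs at e3 <;>
        split_ifs at e5 <;> split_ifs at e6 <;> omega
    · funext b
      simp only [Equiv.trans_apply]
      have e1 := simpleTransposition_val i (τ.label b)
      have e2 := rotDown_val (simpleTransposition i (τ.label b))
      have e3 := bump_val (simpleTransposition i (τ.label b))
      have e4 := rotDown_val (τ.label b)
      have e5 := bump_val (τ.label b)
      have e6 := bump_val (rotDown μ.card (simpleTransposition i (τ.label b)))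
      have e7 := bump_val (rotDown μ.card (τ.label b))
      have e8 := (τ.label b).2
      split_ifs at e1 <;> split_ifs at e2 <;> split_ifs at e4 <;> split_ifs at e3 <;>
        split_ifs at e5 <;> split_ifs at e6 <;> split_ifs at e7 <;> omega

theorem opShift_opTheta (j j' : Fin μ.card) (h : (j : ℕ) = j' + 1) :
    opShift μ * opTheta j = opTheta j' * opShift μ := by
  apply Model.ext
  intro T l hl
  rw [vec_of_compatible hl, Module.End.mul_apply, Module.End.mul_apply, opShift_single,
    opTheta_single, opTheta_single, map_smul, opShift_single, PSYT.shift_label_symm]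
  have r1 : finRotate μ.card j' = j := by
    ext; rw [finRotate_val, if_neg] <;> omega
  congr 1
  rw [r1]
  simp [boxWeight, PSYT.shapeRYT, PSYT.shift, bump, h]

theorem opTheta_opShift (j j' : Fin μ.card) (h : (j : ℕ) = 0) (h' : (j' : ℕ) + 1 = μ.card) :
    opTheta j' * opShift μ = q • (opShift μ * opTheta j) := by
  apply Model.ext
  intro T l hl
  rw [LinearMap.smul_apply, vec_of_compatible hl, Module.End.mul_apply, Module.End.mul_apply,
    opShift_single, opTheta_single, opTheta_single, map_smul, opShift_single,
    PSYT.shift_label_symm, smul_smul]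
  have r1 : finRotate μ.card j' = j := by
    ext; rw [finRotate_val, if_pos h', h]
  congr 1
  rw [r1]
  simp only [boxWeight, PSYT.shapeRYT, PSYT.shift, Equiv.apply_symm_apply, bump, h, if_true, pow_succ]
  ring

/-- A solution of the quadratic relation as a unit. -/
noncomputable def heckeUnit {A : Type} [Ring A] [Algebra K A] (x : A)
    (h : (x - 1) * (x + algebraMap K A t) = 0) : Aˣ :=
  ⟨x, heckeInv x, mul_heckeInv h, heckeInv_mul h⟩

open Classical in
/-- The operators `T_i`, extended by one. -/
noncomputable def unitT (μ : YoungDiagram) (k : ℕ) : (Module.End K (Model μ))ˣ :=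
  if h : k < μ.card - 1 then heckeUnit (opT ⟨k, h⟩) (opT_quad _) else 1

open Classical in
/-- The operators `θ_i`, extended by zero. -/
noncomputable def natTheta (μ : YoungDiagram) (k : ℕ) : Module.End K (Model μ) :=
  if h : k < μ.card then opTheta ⟨k, h⟩ else 0

theorem unitT_val {k : ℕ} (h : k < μ.card - 1) :
    (unitT μ k : Module.End K (Model μ)) = opT ⟨k, h⟩ := by
  rw [unitT, dif_pos h]; rfl

theorem natTheta_of_lt {k : ℕ} (h : k < μ.card) : natTheta μ k = opTheta ⟨k, h⟩ := by
  rw [natTheta, dif_pos h]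

theorem shiftRels_model (μ : YoungDiagram) :
    ShiftRels (μ.card - 1) (unitT μ) (natTheta μ) (opShift μ) where
  rels :=
    { braid := fun i hi => by
        apply Units.ext
        simp only [Units.val_mul]
        rw [unitT_val hi, unitT_val (show i < μ.card - 1 by omega)]
        exact opT_braid _ _ rfl
      far := fun i j h1 h2 => by
        apply Units.ext
        simp only [Units.val_mul]
        rw [unitT_val h2, unitT_val (show i < μ.card - 1 by omega)]
        exact opT_far _ _ (Or.inl h1) }
  w_T j hj := by
    rw [unitT_val hj, unitT_val (show j < μ.card - 1 by omega)]
    exact opShift_opT _ _ rfl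
  w_w_T hm := by
    rw [unitT_val hm, unitT_val (show μ.card - 1 - 1 < μ.card - 1 by omega)]
    exact opShift_opShift_opT _ _ rfl (by simp only; omega)
  theta_succ k hk := by
    rw [natTheta_of_lt (show k + 1 < μ.card by omega), natTheta_of_lt (show k < μ.card by omega)]
    have h1 := opT_opTheta_opT (μ := μ) ⟨k, hk⟩
    rw [← smul_mul_assoc, ← mul_smul_comm, Units.eq_mul_inv_iff_mul_eq,
      Units.eq_inv_mul_iff_mul_eq, unitT_val hk, ← mul_assoc]
    exact h1
  T_theta j hj := by
    rw [natTheta_of_lt (show 0 < μ.card by omega), unitT_val hj]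
    exact opT_opTheta_comm _ _ (fun h => by simp [Fin.ext_iff] at h)
      (fun h => by simp [Fin.ext_iff] at h)
  w_theta hm := by
    rw [natTheta_of_lt (show 0 < μ.card by omega), natTheta_of_lt (show 1 < μ.card by omega)]
    exact opShift_opTheta _ _ rfl
  theta_w := by
    -- For the empty diagram the truncated index `μ.card - 1` is 0 and out of range, so both sides
    -- are the default value zero.
    rcases Nat.eq_zero_or_pos μ.card with h | h
    · rw [natTheta, natTheta, dif_neg (by omega), dif_neg (by omega)]; simp
    · rw [natTheta_of_lt (show 0 < μ.card by omega),
        natTheta_of_lt (show μ.card - 1 < μ.card by omega)]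
      exact opTheta_opShift _ _ rfl (by simp only; omega)

/-- The representation of the double affine Hecke algebra on the model. -/
noncomputable def rep (μ : YoungDiagram) : DAHA μ.card →ₐ[K] Module.End K (Model μ) :=
  DAHA.lift (shiftFree μ.card (unitT μ) (natTheta μ) (opShift μ))
    (shiftFree_rel (shiftRels_model μ)
      (fun i => by rw [unitT_val i.2]; exact opT_quad i)
      (fun i j hi hj => by
        rw [natTheta_of_lt hi, natTheta_of_lt hj]; exact opTheta_comm _ _))

theorem rep_T (i : Fin (μ.card - 1)) : rep μ (DAHA.T i) = opT i := by
  rw [rep, DAHA.T, DAHA.lift_mk, shiftFree_tt, unitT_val i.2]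

theorem rep_theta (j : Fin μ.card) : rep μ (DAHA.theta j) = opTheta j := by
  rw [rep, DAHA.theta, DAHA.lift_mk, shiftFree_th, natTheta_of_lt j.2]

/-- The shift operator comes from an element of the double affine Hecke algebra. -/
theorem rep_shift (hn : 0 < μ.card) :
    rep μ ((descProd (fun k => if h : k < μ.card - 1 then heckeInv (DAHA.T ⟨k, h⟩) else 1)
      (μ.card - 1)) * DAHA.X ⟨0, hn⟩) = opShift μ := by
  have h1 : rep μ (DAHA.X ⟨0, hn⟩) = (↑(ascProd (unitT μ) (μ.card - 1)) : Module.End K (Model μ))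
      * opShift μ := by
    rw [rep, DAHA.X, DAHA.lift_mk, shiftFree_xx]; rfl
  have h2 : rep μ (descProd (fun k => if h : k < μ.card - 1 then heckeInv (DAHA.T ⟨k, h⟩) else 1)
      (μ.card - 1)) = (↑(ascProd (unitT μ) (μ.card - 1))⁻¹ : Module.End K (Model μ)) := by
    have e1 := descProd_map (rep μ : DAHA μ.card →* Module.End K (Model μ))
    have e2 : ∀ k, descProd (fun i => (unitT μ i)⁻¹) k = (ascProd (unitT μ) k)⁻¹ := fun k => by
      induction k with
      | zero => simp [ascProd, descProd]
      | succ k ih => rw [descProd_succ, ih, ascProd_succ, mul_inv_rev]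
    have e3 := descProd_map (Units.coeHom (Module.End K (Model μ)))
    simp only [Units.coeHom_apply] at e3
    rw [← e2, e3]
    refine (e1 _ _).trans ?_
    congr 1
    funext k
    by_cases hk : k < μ.card - 1
    · simp only [hk, dif_pos, MonoidHom.coe_coe]
      rw [map_heckeInv, rep_T, unitT, dif_pos hk]
      rfl
    · simp only [hk, dif_neg, not_false_eq_true, map_one]
      rw [unitT, dif_neg hk]
      simp
  rw [map_mul, h1, h2, Units.inv_mul_cancel_left]

end Shift
end VVMacdonald

namespace VVMacdonald

/-! ### The map from the induced module to the model -/

section ToModel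

variable {μ : YoungDiagram}

/-- The reverse tableau with all entries zero. -/
def RYT.zero (μ : YoungDiagram) : RYT μ where
  entry _ := 0
  row_weak _ _ _ := le_rfl
  col_weak _ _ _ := le_rfl

theorem SYT.compatible (S : SYT μ) : Compatible (RYT.zero μ) S.label := by
  rintro b c ⟨h | h, -⟩
  · exact S.row_strict b c h
  · exact S.col_strict b c h

/-- A compatible labelling of the zero tableau is a standard tableau. -/
def SYT.ofCompatible (l : Box μ ≃ Fin μ.card) (h : Compatible (RYT.zero μ) l) : SYT μ where
  label := l
  row_strict b c hbc := h b c ⟨Or.inl hbc, rfl⟩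
  col_strict b c hbc := h b c ⟨Or.inr hbc, rfl⟩

theorem boxWeight_zero (b : Box μ) : boxWeight (RYT.zero μ) b = t ^ content b := by
  simp [boxWeight, RYT.zero]

/-- The span of the basis vectors with all exponents zero. -/
noncomputable def zeroPart (μ : YoungDiagram) : Submodule K (Model μ) :=
  Submodule.span K (Set.range fun l => vec (RYT.zero μ) l)

theorem vec_mem_zeroPart (l : Box μ ≃ Fin μ.card) : vec (RYT.zero μ) l ∈ zeroPart μ :=
  Submodule.subset_span ⟨l, rfl⟩

theorem opT_mem_zeroPart (i : Fin (μ.card - 1)) {v : Model μ} (hv : v ∈ zeroPart μ) :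
    opT i v ∈ zeroPart μ := by
  induction hv using Submodule.span_induction with
  | mem v hv =>
    obtain ⟨l, rfl⟩ := hv
    by_cases h : Compatible (RYT.zero μ) l
    · simp only
      rw [opT_vec fun _ => h]
      exact add_mem (Submodule.smul_mem _ _ (vec_mem_zeroPart _))
        (Submodule.smul_mem _ _ (vec_mem_zeroPart _))
    · simp only [vec_of_not h, map_zero, zero_mem]
  | zero => rw [map_zero]; exact zero_mem _
  | add v w _ _ hv hw => rw [map_add]; exact add_mem hv hw
  | smul k v _ hv => rw [map_smul]; exact Submodule.smul_mem _ _ hv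

/-- In a standard tableau the smallest label occupies the corner, whose content is 0. This matches
`θ̄_1 = 1`. -/
theorem opTheta_zero_apply (hn : 0 < μ.card) {v : Model μ} (hv : v ∈ zeroPart μ) :
    opTheta ⟨0, hn⟩ v = v := by
  induction hv using Submodule.span_induction with
  | mem v hv =>
    obtain ⟨l, rfl⟩ := hv
    by_cases h : Compatible (RYT.zero μ) l
    · simp only
      rw [opTheta_vec, boxWeight_zero]
      have hb : content (l.symm ⟨0, hn⟩) = 0 := by
        set b := l.symm ⟨0, hn⟩ with hbdef
        have hlb : l b = ⟨0, hn⟩ := l.apply_symm_apply _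
        by_contra hc
        have hne : b.nw 0 0 (Nat.zero_le _) (Nat.zero_le _) ≠ b := fun h' => by
          rw [← h'] at hc
          simp [content, Box.nw] at hc
        have := (PSYT.ofCompatible _ l h).lt_of_le (b := b.nw 0 0 (Nat.zero_le _) (Nat.zero_le _))
          (c := b) (Nat.zero_le _) (Nat.zero_le _) hne rfl
        change (l _ : ℕ) < l b at this
        rw [hlb] at this
        exact Nat.not_lt_zero _ this
      rw [hb, zpow_zero, one_smul]
    · simp only [vec_of_not h, map_zero]
  | zero => rw [map_zero]
  | add v w _ _ hv hw => rw [map_add, hv, hw]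
  | smul k v _ hv => rw [map_smul, hv]

/-- The Hecke algebra acting on the model. -/
noncomputable def heckeRep (μ : YoungDiagram) : Hecke μ.card →ₐ[K] Module.End K (Model μ) :=
  (rep μ).comp (heckeToDbl μ.card)

theorem heckeRep_T (i : Fin (μ.card - 1)) : heckeRep μ (Hecke.T i) = opT i := by
  rw [heckeRep, AlgHom.comp_apply, heckeToDbl_T, rep_T]

theorem heckeRep_mem_zeroPart (a : Hecke μ.card) {v : Model μ} (hv : v ∈ zeroPart μ) :
    heckeRep μ a v ∈ zeroPart μ := by
  obtain ⟨x, rfl⟩ := Hecke.mk_surjective a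
  induction x using FreeAlgebra.induction generalizing v with
  | grade0 r =>
    rw [AlgHom.commutes, AlgHom.commutes, Module.algebraMap_end_apply]
    exact Submodule.smul_mem _ _ hv
  | grade1 i =>
    have := heckeRep_T (μ := μ) i
    rw [Hecke.T] at this
    rw [this]
    exact opT_mem_zeroPart i hv
  | mul a b ha hb =>
    rw [map_mul, map_mul, Module.End.mul_apply]
    exact ha (hb hv)
  | add a b ha hb =>
    rw [map_add, map_add, LinearMap.add_apply]
    exact add_mem (ha hv) (hb hv)

/-- Both families obey the recursion `x_{i+1} = t T_i⁻¹ x_i T_i⁻¹` and start with the identity on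
`zeroPart μ`, which the Hecke algebra preserves. -/
theorem heckeRep_thetaBar (i : Fin μ.card) {v : Model μ} (hv : v ∈ zeroPart μ) :
    heckeRep μ (Hecke.thetaBar i) v = opTheta i v := by
  obtain ⟨k, hk⟩ := i
  rw [Hecke.thetaBar]
  induction k generalizing v with
  | zero =>
    rw [opTheta_zero_apply hk hv, Hecke.thetaBarNat, map_one, Module.End.one_apply]
  | succ k ih =>
    have hk' : k < μ.card - 1 := by omega
    have h1 := congrArg (rep μ) (DAHA.theta_step (n := μ.card) ⟨k, hk'⟩)
    rw [rep_theta] at h1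
    have e : (hi ⟨k, hk'⟩ : Fin μ.card) = ⟨k + 1, hk⟩ := rfl
    rw [e] at h1
    simp only [h1, Hecke.thetaBarNat_succ hk', map_smul, map_mul, map_heckeInv, heckeRep_T, rep_T,
      rep_theta, Module.End.mul_apply, LinearMap.smul_apply]
    have h2 : heckeInv (opT ⟨k, hk'⟩) v ∈ zeroPart μ := by
      rw [← heckeRep_T, ← map_heckeInv]
      exact heckeRep_mem_zeroPart _ hv
    have h3 := ih h2 (by omega)
    simp only at h3
    rw [h3]
    rfl

/-- On `zeroPart μ` the affine algebra acts through `ρ_n`; this makes the balancing relations of the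
induced module hold in the model. -/
theorem rep_affToDbl (a : AHA μ.card) {v : Model μ} (hv : v ∈ zeroPart μ) :
    rep μ (affToDbl μ.card a) v = heckeRep μ (rho μ.card a) v := by
  obtain ⟨x, rfl⟩ := AHA.mk_surjective a
  induction x using FreeAlgebra.induction generalizing v with
  | grade0 r => simp only [AlgHom.commutes]
  | grade1 g =>
    rw [affToDbl_mk, rho_mk]
    cases g with
    | T i =>
      rw [show FreeAlgebra.ι K (AffGen.T i) = AffGen.tt i from rfl, affToDblFree_tt, rhoFree_tt,
        heckeRep_T, rep_T]
    | θ i =>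
      rw [show FreeAlgebra.ι K (AffGen.θ i) = AffGen.th i from rfl, affToDblFree_th, rhoFree_th,
        heckeRep_thetaBar i hv, rep_theta]
  | mul a b ha hb =>
    simp only [map_mul, Module.End.mul_apply]
    rw [hb hv, ha (heckeRep_mem_zeroPart _ hv)]
  | add a b ha hb =>
    simp only [map_add, LinearMap.add_apply]
    rw [ha hv, hb hv]

/-! ### Normalized basis vectors -/

open Classical in
/-- The factor of a pair of boxes in the normalization of the seminormal basis. -/
noncomputable def normFactor (l : Box μ ≃ Fin μ.card) (p : Box μ × Box μ) : K :=
  if content p.1 + 1 < content p.2 ∧ l p.1 < l p.2 then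
    coefB t (t ^ content p.2) (t ^ content p.1) else 1

/-- The normalization of the seminormal basis. -/
noncomputable def normConst (S : SYT μ) : K := ∏ p, normFactor S.label p

theorem coefB_content_ne_zero {b c : Box μ} (h : content b + 1 < content c) :
    coefB t (t ^ content c) (t ^ content b) ≠ 0 := by
  refine coefB_ne_zero (fun h' => ?_) (fun h' => ?_)
  · have := t_zpow_injective h'
    omega
  · rw [← zpow_one_add₀ t_ne_zero] at h'
    have := t_zpow_injective h'
    omega

theorem normConst_ne_zero (S : SYT μ) : normConst S ≠ 0 := by
  rw [normConst, Finset.prod_ne_zero_iff]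
  intro p _
  rw [normFactor]
  split_ifs with h
  · exact coefB_content_ne_zero h.1
  · exact one_ne_zero

theorem SYT.StepUp.label_eq {i : Fin (μ.card - 1)} {S S' : SYT μ} (h : S.StepUp i S') :
    S'.label = S.label.trans (simpleTransposition i) := Equiv.ext h.1

/-- A step up puts exactly one new pair of boxes, with contents more than one apart, into the same
order by label as by content. The product gains precisely that factor, which absorbs the
off-diagonal coefficient of `T_i`. -/
theorem normConst_stepUp {i : Fin (μ.card - 1)} {S S' : SYT μ} (h : S.StepUp i S') :
    normConst S' = normConst S * coefB t (t ^ S.c (lo i)) (t ^ S.c (hi i)) := by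
  classical
  have hc := h.2
  have hp : ∀ p : Box μ × Box μ, normFactor S'.label p = normFactor S.label p *
      if p = (S.label.symm (hi i), S.label.symm (lo i)) then
        coefB t (t ^ S.c (lo i)) (t ^ S.c (hi i)) else 1 := by
    rintro ⟨b, c⟩
    rw [normFactor, normFactor, h.1, h.1]
    by_cases hbc : (b, c) = (S.label.symm (hi i), S.label.symm (lo i))
    · rw [if_pos hbc]
      obtain ⟨rfl, rfl⟩ := Prod.mk.inj hbc
      simp only [Equiv.apply_symm_apply, simpleTransposition_lo, simpleTransposition_hi, lo_lt_hi]
      rw [if_pos ⟨by rw [SYT.c, SYT.c] at hc; omega, trivial⟩,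
        if_neg fun h' => absurd h'.2 (not_lt.mpr (lo_lt_hi i).le), one_mul]
      rfl
    · rw [if_neg hbc, mul_one]
      by_cases hcc : content b + 1 < content c
      · have key : simpleTransposition i (S.label b) < simpleTransposition i (S.label c) ↔
            S.label b < S.label c := by
          constructor
          · intro h'
            have := simpleTransposition_lt (i := i) h' fun h2 => ?_
            · simpa using this
            · apply hbc
              have e1 := congrArg (simpleTransposition i) h2.1
              have e2 := congrArg (simpleTransposition i) h2.2
              rw [simpleTransposition_apply_apply] at e1 e2
              rw [simpleTransposition_lo] at e1
              rw [simpleTransposition_hi] at e2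
              rw [← e1, ← e2, Equiv.symm_apply_apply, Equiv.symm_apply_apply]
          · intro h'
            refine simpleTransposition_lt h' fun h2 => ?_
            rw [SYT.c, SYT.c, ← h2.1, ← h2.2, Equiv.symm_apply_apply,
              Equiv.symm_apply_apply] at hc
            omega
        simp only [key]
      · rw [if_neg fun h' => hcc h'.1, if_neg fun h' => hcc h'.1]
  rw [normConst, normConst, Finset.prod_congr rfl fun p _ => hp p, Finset.prod_mul_distrib,
    Finset.prod_ite_eq' Finset.univ, if_pos (Finset.mem_univ _)]

/-- The normalized basis vector of a standard tableau. -/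
noncomputable def normVec (S : SYT μ) : Model μ := normConst S • vec (RYT.zero μ) S.label

theorem normVec_mem (S : SYT μ) : normVec S ∈ zeroPart μ :=
  Submodule.smul_mem _ _ (vec_mem_zeroPart _)

theorem opTheta_normVec (i : Fin μ.card) (S : SYT μ) :
    opTheta i (normVec S) = t ^ S.c i • normVec S := by
  rw [normVec, map_smul, opTheta_vec, boxWeight_zero, smul_comm]
  rfl

theorem opT_normVec_row (i : Fin (μ.card - 1)) (S : SYT μ)
    (h : (S.label.symm (lo i)).1.1 = (S.label.symm (hi i)).1.1) :
    opT i (normVec S) = normVec S := by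
  rw [normVec, map_smul, opT_vec fun _ => S.compatible]
  rcases S.compatible.boxWeight_consecutive (b := S.label.symm (lo i))
    (c := S.label.symm (hi i)) (by simp) with h1 | h1 | h1
  · rw [h1.2.2, coefA_self_t_mul (boxWeight_ne_zero _ _) t_ne_one, one_smul, vec_of_not
      (l := S.label.trans _), smul_zero, add_zero]
    rw [S.compatible.swap_iff, not_not]
    exact ⟨Or.inl h1.1, rfl⟩
  · exact absurd h1.1.2 (by omega)
  · refine absurd ⟨Or.inl ⟨h, ?_⟩, rfl⟩ h1.1
    by_contra hle
    have := (PSYT.ofCompatible _ _ S.compatible).lt_of_le (b := S.label.symm (hi i))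
      (c := S.label.symm (lo i)) h.ge (not_lt.mp hle)
      (fun h' => (lo_lt_hi i).ne' (S.label.symm.injective h')) rfl
    change (S.label _ : ℕ) < S.label _ at this
    simp at this

theorem opT_normVec_col (i : Fin (μ.card - 1)) (S : SYT μ)
    (h : (S.label.symm (lo i)).1.2 = (S.label.symm (hi i)).1.2) :
    opT i (normVec S) = -t • normVec S := by
  rw [normVec, map_smul, opT_vec fun _ => S.compatible]
  rcases S.compatible.boxWeight_consecutive (b := S.label.symm (lo i))
    (c := S.label.symm (hi i)) (by simp) with h1 | h1 | h1
  · exact absurd h1.1.2 (by omega)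
  · rw [h1.2.2, coefA_t_mul_self (boxWeight_ne_zero _ _) t_ne_one, vec_of_not
      (l := S.label.trans _), smul_zero, add_zero, smul_comm]
    rw [S.compatible.swap_iff, not_not]
    exact ⟨Or.inr h1.1, rfl⟩
  · refine absurd ⟨Or.inr ⟨h, ?_⟩, rfl⟩ h1.1
    by_contra hle
    have := (PSYT.ofCompatible _ _ S.compatible).lt_of_le (b := S.label.symm (hi i))
      (c := S.label.symm (lo i)) (not_lt.mp hle) h.ge
      (fun h' => (lo_lt_hi i).ne' (S.label.symm.injective h')) rfl
    change (S.label _ : ℕ) < S.label _ at this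
    simp at this

theorem t_smul_heckeInv {A : Type} [Ring A] [Algebra K A] (x : A) :
    t • heckeInv x = x + algebraMap K A (t - 1) := by
  rw [heckeInv, smul_smul, mul_inv_cancel₀ t_ne_zero, one_smul]

/-- `φ̄` is the commutator of `T + t - 1` with `θ`. Diagonal terms cancel in it, and the
off-diagonal term is multiplied by the difference of the two eigenvalues. -/
theorem phi_combination {F M : Type*} [Field F] [AddCommGroup M] [Module F M]
    (t x y a b k : F) (u v : M) :
    x • (a • k • u + (k * b) • v + (t • k • u - k • u)) -
      (a • x • k • u + (k * b) • y • v + (t • x • k • u - x • k • u))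
      = (x - y) • (k * b) • v := by
  module

theorem heckeRep_phiBar_normVec {i : Fin (μ.card - 1)} {S S' : SYT μ} (h : S.StepUp i S') :
    heckeRep μ (Hecke.phiBar i) (normVec S)
      = (t ^ S.c (lo i) - t ^ S.c (hi i)) • normVec S' := by
  have h1 : opT i (normVec S) ∈ zeroPart μ := opT_mem_zeroPart i (normVec_mem S)
  have hne : t ^ S.c (lo i) ≠ t ^ S.c (hi i) := fun h' => by
    have := t_zpow_injective h'
    have := h.2
    omega
  rw [Hecke.phiBar, t_smul_heckeInv]
  simp only [map_sub, map_mul, map_add, AlgHom.commutes, LinearMap.sub_apply,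
    Module.End.mul_apply, LinearMap.add_apply, Module.algebraMap_end_apply, heckeRep_T,
    heckeRep_thetaBar (lo i) (normVec_mem S), heckeRep_thetaBar (lo i) h1, opTheta_normVec,
    map_smul]
  have e : opT i (normVec S) = coefA t (t ^ S.c (lo i)) (t ^ S.c (hi i)) • normVec S +
      (normConst S * coefB t (t ^ S.c (lo i)) (t ^ S.c (hi i))) •
        vec (RYT.zero μ) S'.label := by
    rw [normVec, map_smul, opT_vec fun _ => S.compatible, boxWeight_zero, boxWeight_zero,
      h.label_eq]
    change normConst S • (coefA t (t ^ S.c (lo i)) (t ^ S.c (hi i)) • vec _ S.label +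
      coefB t (t ^ S.c (lo i)) (t ^ S.c (hi i)) • vec _ _) = _
    rw [smul_add, smul_smul _ (coefB _ _ _), smul_comm]
  have e2 : opTheta (lo i) (vec (RYT.zero μ) S'.label)
      = t ^ S.c (hi i) • vec (RYT.zero μ) S'.label := by
    rw [opTheta_vec, boxWeight_zero, h.label_eq, Equiv.trans_simpleTransposition_symm,
      simpleTransposition_lo]
    rfl
  rw [e, map_add, map_smul, map_smul, opTheta_normVec, e2, normVec, normVec,
    normConst_stepUp h]
  simp only [one_smul]
  exact phi_combination _ _ _ _ _ _ _ _

/-! ### The module homomorphisms -/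

noncomputable instance : Module (DAHA μ.card) (Model μ) :=
  Module.compHom (Model μ) (rep μ : DAHA μ.card →+* Module.End K (Model μ))

noncomputable instance : Module (Hecke μ.card) (Model μ) :=
  Module.compHom (Model μ) (heckeRep μ : Hecke μ.card →+* Module.End K (Model μ))

theorem dbl_smul_def (d : DAHA μ.card) (v : Model μ) : d • v = rep μ d v := rfl

theorem hecke_smul_def (d : Hecke μ.card) (v : Model μ) : d • v = heckeRep μ d v := rfl

instance : IsScalarTower K (DAHA μ.card) (Model μ) :=
  ⟨fun k d v => by rw [dbl_smul_def, dbl_smul_def, map_smul]; rfl⟩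

instance : IsScalarTower K (Hecke μ.card) (Model μ) :=
  ⟨fun k d v => by rw [hecke_smul_def, hecke_smul_def, map_smul]; rfl⟩

/-- The map from the finite Hecke module to the model. -/
noncomputable def spechtMap (μ : YoungDiagram) : Specht μ →ₗ[Hecke μ.card] Model μ :=
  Submodule.liftQ _ (Finsupp.linearCombination (Hecke μ.card) normVec) <| by
    rw [Submodule.span_le]
    intro x hx
    rw [SetLike.mem_coe, LinearMap.mem_ker]
    cases hx with
    | weight i S =>
      rw [map_sub, Finsupp.linearCombination_single, Finsupp.linearCombination_single,
        hecke_smul_def, hecke_smul_def, heckeRep_thetaBar i (normVec_mem S), opTheta_normVec,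
        AlgHom.commutes, Module.algebraMap_end_apply, sub_self]
    | step i S S' h =>
      rw [map_sub, Finsupp.linearCombination_single, Finsupp.linearCombination_single,
        hecke_smul_def, hecke_smul_def, heckeRep_phiBar_normVec h,
        AlgHom.commutes, Module.algebraMap_end_apply, sub_self]
    | row i S h =>
      rw [map_sub, Finsupp.linearCombination_single, Finsupp.linearCombination_single,
        hecke_smul_def, one_smul, heckeRep_T, opT_normVec_row i S h, sub_self]
    | col i S h =>
      rw [map_sub, Finsupp.linearCombination_single, Finsupp.linearCombination_single,
        hecke_smul_def, hecke_smul_def, heckeRep_T, opT_normVec_col i S h,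
        AlgHom.commutes, Module.algebraMap_end_apply, sub_self]

/-- The generators of the finite Hecke module. -/
noncomputable def spechtGen (S : SYT μ) : Specht μ :=
  Submodule.Quotient.mk (Finsupp.single S 1)

theorem spechtMap_gen (S : SYT μ) : spechtMap μ (spechtGen S) = normVec S := by
  rw [spechtMap, spechtGen, Submodule.liftQ_apply, Finsupp.linearCombination_single, one_smul]

theorem spechtMap_mem (m : Specht μ) : spechtMap μ m ∈ zeroPart μ := by
  obtain ⟨x, rfl⟩ := Submodule.Quotient.mk_surjective _ m
  rw [spechtMap, Submodule.liftQ_apply, Finsupp.linearCombination_apply]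
  exact Submodule.sum_mem _ fun S _ => heckeRep_mem_zeroPart _ (normVec_mem S)

/-- The map from the induced module to the model. -/
noncomputable def toModel (μ : YoungDiagram) : V μ →ₗ[DAHA μ.card] Model μ :=
  Submodule.liftQ _ (TensorProduct.AlgebraTensorModule.lift
    (LinearMap.toSpanSingleton (DAHA μ.card) (Specht μ →ₗ[K] Model μ)
      ((spechtMap μ).restrictScalars K))) <| by
    rw [Submodule.span_le]
    rintro x ⟨d, a, m, rfl⟩
    rw [SetLike.mem_coe, LinearMap.mem_ker, map_sub]
    simp only [TensorProduct.AlgebraTensorModule.lift_tmul, LinearMap.toSpanSingleton_apply,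
      LinearMap.smul_apply, LinearMap.restrictScalars_apply]
    rw [mul_smul, dbl_smul_def (affToDbl _ a), rep_affToDbl a (spechtMap_mem m), map_smul,
      hecke_smul_def, sub_self]

/-- The element `d ⊗ m` of the induced module. -/
noncomputable def V.tmul (d : DAHA μ.card) (m : Specht μ) : V μ :=
  Submodule.Quotient.mk (d ⊗ₜ[K] m)

theorem toModel_tmul (d : DAHA μ.card) (m : Specht μ) :
    toModel μ (V.tmul d m) = d • spechtMap μ m := rfl

end ToModel
end VVMacdonald

namespace VVMacdonald

/-! ### Spanning sets of the induced module -/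

section Stabilizer

variable {A : Type} [Ring A] [Algebra K A] {N : Type} [AddCommGroup N] [Module K N] [Module A N]
  [IsScalarTower K A N]

/-- The subalgebra of elements that preserve a subspace. -/
def stabilizer (A : Type) [Ring A] [Algebra K A] [Module A N] [IsScalarTower K A N]
    (P : Submodule K N) : Subalgebra K A where
  carrier := {a | ∀ v ∈ P, a • v ∈ P}
  mul_mem' ha hb v hv := by rw [mul_smul]; exact ha _ (hb v hv)
  add_mem' ha hb v hv := by rw [add_smul]; exact P.add_mem (ha v hv) (hb v hv)
  algebraMap_mem' r v hv := by rw [algebraMap_smul]; exact P.smul_mem r hv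

theorem mem_stabilizer {P : Submodule K N} {a : A} :
    a ∈ stabilizer A P ↔ ∀ v ∈ P, a • v ∈ P := Iff.rfl

theorem heckeInv_mem {S : Subalgebra K A} {x : A} (h : x ∈ S) : heckeInv x ∈ S :=
  S.smul_mem (S.add_mem h (S.algebraMap_mem _)) _

end Stabilizer

/-! ### Spanning of the finite Hecke module by its generators. -/

section Specht

variable {μ : YoungDiagram}

theorem mk_single (S : SYT μ) (a : Hecke μ.card) :
    (Submodule.Quotient.mk (Finsupp.single S a) : Specht μ) = a • spechtGen S := by
  rw [spechtGen, ← Submodule.Quotient.mk_smul, Finsupp.smul_single, smul_eq_mul, mul_one]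

theorem spechtRel_eq_zero {x : SYT μ →₀ Hecke μ.card} (h : SpechtRel μ x) :
    (Submodule.Quotient.mk x : Specht μ) = 0 :=
  (Submodule.Quotient.mk_eq_zero _).mpr (Submodule.subset_span h)

theorem thetaBar_smul_gen (i : Fin μ.card) (S : SYT μ) :
    Hecke.thetaBar i • spechtGen S = t ^ S.c i • spechtGen S := by
  have := spechtRel_eq_zero (SpechtRel.weight i S)
  rwa [Submodule.Quotient.mk_sub, mk_single, mk_single, sub_eq_zero, algebraMap_smul] at this

theorem phiBar_smul_gen {i : Fin (μ.card - 1)} {S S' : SYT μ} (h : S.StepUp i S') :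
    Hecke.phiBar i • spechtGen S = (t ^ S.c (lo i) - t ^ S.c (hi i)) • spechtGen S' := by
  have := spechtRel_eq_zero (SpechtRel.step i S S' h)
  rwa [Submodule.Quotient.mk_sub, mk_single, mk_single, sub_eq_zero, algebraMap_smul] at this

/-- The elements `θ̄` are moved to the right, where they act on generators by scalars; the relation
for `φ̄_i τ` can then be solved for `T_i τ`. -/
theorem Hecke.phiBar_eq {n : ℕ} (i : Fin (n - 1)) :
    Hecke.phiBar i = (Hecke.T i + algebraMap K _ (t - 1)) * Hecke.thetaBar (lo i)
      - Hecke.T i * Hecke.thetaBar (hi i) := by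
  have h1 : (Hecke.thetaBar (hi i) : Hecke n) = t • (heckeInv (Hecke.T i)
      * Hecke.thetaBar (lo i) * heckeInv (Hecke.T i)) := Hecke.thetaBarNat_succ i.2
  rw [Hecke.phiBar, h1, mul_smul_comm, mul_smul_comm, mul_assoc (heckeInv _),
    ← mul_assoc (Hecke.T i), mul_heckeInv (Hecke.quad i), one_mul, ← t_smul_heckeInv]

theorem smul_T_smul_gen {i : Fin (μ.card - 1)} {S S' : SYT μ} (h : S.StepUp i S') :
    (t ^ S.c (lo i) - t ^ S.c (hi i)) • Hecke.T i • spechtGen S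
      = (t ^ S.c (lo i) - t ^ S.c (hi i)) • spechtGen S'
        - ((t - 1) * t ^ S.c (lo i)) • spechtGen S := by
  have h1 : Hecke.phiBar i • spechtGen S = t ^ S.c (lo i) • Hecke.T i • spechtGen S
      + ((t - 1) * t ^ S.c (lo i)) • spechtGen S - t ^ S.c (hi i) • Hecke.T i • spechtGen S := by
    rw [Hecke.phiBar_eq, sub_smul, mul_smul, mul_smul, thetaBar_smul_gen, thetaBar_smul_gen,
      add_smul, algebraMap_smul, smul_comm (Hecke.T i), smul_comm (Hecke.T i), mul_smul (t - 1)]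
  rw [← phiBar_smul_gen h, h1, sub_smul (t ^ S.c (lo i))]
  abel

theorem stepUp_sub_ne_zero {i : Fin (μ.card - 1)} {S S' : SYT μ} (h : S.StepUp i S') :
    t ^ S.c (lo i) - t ^ S.c (hi i) ≠ 0 := fun h' => by
  have := t_zpow_injective (sub_eq_zero.mp h')
  have := h.2
  omega

/-- The finite Hecke module is spanned by its generators. -/
theorem span_spechtGen : Submodule.span K (Set.range (spechtGen (μ := μ))) = ⊤ := by
  set P := Submodule.span K (Set.range (spechtGen (μ := μ))) with hP
  have hgen : ∀ S, spechtGen S ∈ P := fun S => Submodule.subset_span ⟨S, rfl⟩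
  have hstep : ∀ (i : Fin (μ.card - 1)) (S S' : SYT μ), S.StepUp i S' →
      Hecke.T i • spechtGen S ∈ P := by
    intro i S S' h
    rw [← P.smul_mem_iff (stepUp_sub_ne_zero h), smul_T_smul_gen h]
    exact P.sub_mem (P.smul_mem _ (hgen _)) (P.smul_mem _ (hgen _))
  have hT : ∀ i, Hecke.T i ∈ stabilizer (Hecke μ.card) P := by
    intro i
    rw [mem_stabilizer]
    intro v hv
    induction hv using Submodule.span_induction with
    | mem v hv =>
      obtain ⟨S, rfl⟩ := hv
      rcases S.compatible.boxWeight_consecutive (b := S.label.symm (lo i))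
        (c := S.label.symm (hi i)) (by simp) with h1 | h1 | h1
      · have := spechtRel_eq_zero (SpechtRel.row i S h1.1.1)
        rw [Submodule.Quotient.mk_sub, mk_single, mk_single, sub_eq_zero, one_smul] at this
        rw [this]
        exact hgen S
      · have := spechtRel_eq_zero (SpechtRel.col i S h1.1.1)
        rw [Submodule.Quotient.mk_sub, mk_single, mk_single, sub_eq_zero,
          algebraMap_smul] at this
        rw [this]
        exact P.smul_mem _ (hgen S)
      · have hne := S.compatible.lo_hi i
        rw [← S.compatible.swap_iff] at h1
        set S' := SYT.ofCompatible _ h1.1 with hS'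
        have hlo : S'.c (lo i) = S.c (hi i) := by
          rw [SYT.c, SYT.c, hS', SYT.ofCompatible, Equiv.trans_simpleTransposition_symm,
            simpleTransposition_lo]
        have hhi : S'.c (hi i) = S.c (lo i) := by
          rw [SYT.c, SYT.c, hS', SYT.ofCompatible, Equiv.trans_simpleTransposition_symm,
            simpleTransposition_hi]
        -- The contents differ by none of `0, 1, -1`, so one of the two tableaux is a step up from
        -- the other.
        have c1 : S.c (lo i) ≠ S.c (hi i) := fun h => hne (by
          rw [boxWeight_zero, boxWeight_zero]; exact congrArg (t ^ ·) h)
        have c2 : S.c (lo i) ≠ S.c (hi i) + 1 := fun h => h1.2.1 (by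
          rw [boxWeight_zero, boxWeight_zero, ← zpow_one_add₀ t_ne_zero, add_comm]
          exact congrArg (t ^ ·) h)
        have c3 : S.c (hi i) ≠ S.c (lo i) + 1 := fun h => h1.2.2 (by
          rw [boxWeight_zero, boxWeight_zero, ← zpow_one_add₀ t_ne_zero, add_comm]
          exact congrArg (t ^ ·) h)
        rcases lt_or_ge (1 : ℤ) (S.c (lo i) - S.c (hi i)) with h2 | h2
        · exact hstep i S S' ⟨fun b => rfl, h2⟩
        · have hup : S'.StepUp i S := ⟨fun b => by
            rw [hS']; simp [SYT.ofCompatible], by rw [hlo, hhi]; omega⟩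
          -- Here `S` is the upper tableau. It is written through `T_i S'` and `S'`, so that `T_i S`
          -- involves `T_i² S'`, which the quadratic relation reduces.
          have e := smul_T_smul_gen hup
          rw [eq_sub_iff_add_eq] at e
          have hS := hstep i S' S hup
          rw [← P.smul_mem_iff (stepUp_sub_ne_zero hup), smul_comm, ← e, smul_add,
            smul_comm, ← mul_smul, Hecke.T_mul_T, add_smul, smul_assoc, smul_assoc, one_smul,
            smul_comm _ ((t - 1) * _)]
          exact P.add_mem (P.smul_mem _ (P.add_mem (P.smul_mem _ hS) (P.smul_mem _ (hgen _))))
            (P.smul_mem _ hS)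
    | zero => rw [smul_zero]; exact P.zero_mem
    | add v w _ _ hv hw => rw [smul_add]; exact P.add_mem hv hw
    | smul k v _ hv => rw [smul_comm]; exact P.smul_mem _ hv
  have htop := Hecke.subalgebra_eq_top _ hT
  rw [eq_top_iff]
  intro m _
  obtain ⟨x, rfl⟩ := Submodule.Quotient.mk_surjective _ m
  induction x using Finsupp.induction_linear with
  | zero => exact P.zero_mem
  | add x y hx hy => rw [Submodule.Quotient.mk_add]; exact P.add_mem (hx trivial) (hy trivial)
  | single S a =>
    rw [mk_single]
    have : a ∈ stabilizer (Hecke μ.card) P := by rw [htop]; trivial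
    exact this _ (hgen S)

end Specht

/-! ### Layers of the induced module by degree in the `X_i`, and the monomial spanning set. -/

section Layers

variable {μ : YoungDiagram}

/-- The inclusion of the finite Hecke module into the induced module. -/
noncomputable def ofSpecht (μ : YoungDiagram) : Specht μ →ₗ[K] V μ :=
  ((Submodule.mkQ (Submodule.span (DAHA μ.card) (balancedRel μ))).restrictScalars K).comp
    (TensorProduct.mk K (DAHA μ.card) (Specht μ) 1)

theorem ofSpecht_apply (m : Specht μ) : ofSpecht μ m = V.tmul 1 m := rfl

theorem smul_ofSpecht (d : DAHA μ.card) (m : Specht μ) : d • ofSpecht μ m = V.tmul d m := by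
  rw [ofSpecht_apply, V.tmul, V.tmul, ← Submodule.Quotient.mk_smul, TensorProduct.smul_tmul',
    smul_eq_mul, mul_one]

theorem affToDbl_smul_ofSpecht (a : AHA μ.card) (m : Specht μ) :
    affToDbl μ.card a • ofSpecht μ m = ofSpecht μ (rho μ.card a • m) := by
  rw [smul_ofSpecht, ofSpecht_apply, V.tmul, V.tmul, Submodule.Quotient.eq]
  apply Submodule.subset_span
  exact ⟨1, a, m, by rw [one_mul]⟩

theorem toModel_ofSpecht (m : Specht μ) : toModel μ (ofSpecht μ m) = spechtMap μ m := by
  rw [ofSpecht_apply, toModel_tmul, one_smul]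

/-- The homogeneous layers of the induced module. -/
noncomputable def layer (μ : YoungDiagram) : ℕ → Submodule K (V μ)
  | 0 => LinearMap.range (ofSpecht μ)
  | d + 1 => ⨆ j : Fin μ.card, (layer μ d).map (Algebra.lsmul K K (V μ) (DAHA.X j))

theorem X_smul_mem_layer {d : ℕ} (j : Fin μ.card) {v : V μ} (hv : v ∈ layer μ d) :
    DAHA.X j • v ∈ layer μ (d + 1) :=
  Submodule.mem_iSup_of_mem j ⟨v, hv, rfl⟩

theorem mem_stabilizer_layer_succ {d : ℕ} {a : DAHA μ.card}
    (h : ∀ j : Fin μ.card, ∀ v ∈ layer μ d, a • (DAHA.X j : DAHA μ.card) • v ∈ layer μ (d + 1)) :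
    a ∈ stabilizer (DAHA μ.card) (layer μ (d + 1)) := by
  rw [mem_stabilizer]
  have : layer μ (d + 1) ≤ (layer μ (d + 1)).comap (Algebra.lsmul K K (V μ) a) := by
    conv_lhs => rw [layer]
    refine iSup_le fun j => ?_
    rw [Submodule.map_le_iff_le_comap]
    intro v hv
    exact h j v hv
  exact fun v hv => this hv

theorem affToDbl_mem_stabilizer (a : AHA μ.card) :
    affToDbl μ.card a ∈ stabilizer (DAHA μ.card) (layer μ 0) := by
  rintro v ⟨m, rfl⟩
  rw [affToDbl_smul_ofSpecht]
  exact ⟨_, rfl⟩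

theorem affToDbl_tt (i : Fin (μ.card - 1)) :
    affToDbl μ.card (AHA.mk _ (AffGen.tt i)) = DAHA.T i := by
  rw [affToDbl_mk, affToDblFree_tt]

theorem affToDbl_th (i : Fin μ.card) :
    affToDbl μ.card (AHA.mk _ (AffGen.th i)) = DAHA.theta i := by
  rw [affToDbl_mk, affToDblFree_th]

theorem T_mul_X_hi {n : ℕ} (i : Fin (n - 1)) :
    (DAHA.T i * DAHA.X (hi i) : DAHA n) = t • (DAHA.X (lo i) * heckeInv (DAHA.T i)) := by
  rw [DAHA.X_step, mul_smul_comm, ← mul_assoc, ← mul_assoc, mul_heckeInv (DAHA.quad i), one_mul]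

theorem T_mul_X_lo {n : ℕ} (i : Fin (n - 1)) :
    (DAHA.T i * DAHA.X (lo i) : DAHA n)
      = DAHA.X (hi i) * DAHA.T i - algebraMap K _ (t - 1) * DAHA.X (lo i) := by
  rw [eq_sub_iff_add_eq, ← add_mul, ← t_smul_heckeInv, DAHA.X_step, smul_mul_assoc,
    smul_mul_assoc, mul_assoc, heckeInv_mul (DAHA.quad i), mul_one]

/-- Moving `T_i` to the right of some `X_j` leaves a combination of terms `X_k` times an element of
the finite Hecke algebra, so the degree in `X` is kept. -/
theorem T_mem_stabilizer (i : Fin (μ.card - 1)) (d : ℕ) :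
    DAHA.T i ∈ stabilizer (DAHA μ.card) (layer μ d) := by
  induction d with
  | zero =>
    rw [← affToDbl_tt]
    exact affToDbl_mem_stabilizer _
  | succ d ih =>
    refine mem_stabilizer_layer_succ fun j v hv => ?_
    rw [← mul_smul]
    by_cases h1 : j = lo i
    · rw [h1, T_mul_X_lo, sub_smul, mul_smul, mul_smul, algebraMap_smul]
      exact sub_mem (X_smul_mem_layer _ (ih v hv))
        (Submodule.smul_mem _ _ (X_smul_mem_layer _ hv))
    · by_cases h2 : j = hi i
      · rw [h2, T_mul_X_hi, smul_assoc, mul_smul]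
        exact Submodule.smul_mem _ _ (X_smul_mem_layer _ (heckeInv_mem ih v hv))
      · rw [DAHA.X_far i j h1 h2, mul_smul]
        exact X_smul_mem_layer _ (ih v hv)

theorem pi_mem_stabilizer (hn : 0 < μ.card) (d : ℕ) :
    piElt hn DAHA.T DAHA.theta ∈ stabilizer (DAHA μ.card) (layer μ d) := by
  induction d with
  | zero =>
    refine Subalgebra.smul_mem _ (Subalgebra.mul_mem _ ?_ (Subalgebra.list_prod_mem _ ?_)) _
    · rw [← affToDbl_th]
      exact affToDbl_mem_stabilizer _
    · intro x hx
      rw [List.mem_ofFn] at hx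
      obtain ⟨i, rfl⟩ := hx
      exact heckeInv_mem (T_mem_stabilizer i 0)
  | succ d ih =>
    refine mem_stabilizer_layer_succ fun j v hv => ?_
    rw [← mul_smul]
    rcases Nat.lt_or_ge j (μ.card - 1) with h | h
    · have e : j = lo ⟨j, h⟩ := rfl
      rw [e, DAHA.pi_X, mul_smul]
      exact X_smul_mem_layer _ (ih v hv)
    · have e : j = ⟨μ.card - 1, by omega⟩ := Fin.ext (by simp only; omega)
      rw [e, DAHA.pi_X_last, smul_assoc, mul_smul]
      exact Submodule.smul_mem _ _ (X_smul_mem_layer _ (ih v hv))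

theorem mem_of_mul_heckeInv_prod {n : ℕ} {S : Subalgebra K (DAHA n)} (hT : ∀ i, DAHA.T i ∈ S)
    {x : DAHA n} (l : List (Fin (n - 1)))
    (h : x * (l.map fun i => heckeInv (DAHA.T i)).prod ∈ S) : x ∈ S := by
  induction l using List.reverseRecOn with
  | nil => simpa using h
  | append_singleton l a ih =>
    apply ih
    rw [List.map_append, List.prod_append, List.map_singleton, List.prod_singleton,
      ← mul_assoc] at h
    have := S.mul_mem h (hT a)
    rwa [mul_assoc _ _ (DAHA.T a), heckeInv_mul (DAHA.quad a), mul_one] at this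

/-- The presentation has no relation that moves `θ_i` past `X_j` directly. `π` permutes the `X_j`
cyclically up to `q`, hence preserves the layers; `θ_1` is recovered from it by undoing the factors
`T_i⁻¹`, and the other `θ_i` by recursion. -/
theorem theta_mem_stabilizer (i : Fin μ.card) (d : ℕ) :
    DAHA.theta i ∈ stabilizer (DAHA μ.card) (layer μ d) := by
  obtain ⟨k, hk⟩ := i
  induction k with
  | zero =>
    have h := pi_mem_stabilizer hk d
    rw [piElt] at h
    have h2 := Subalgebra.smul_mem _ h (t ^ (μ.card - 1))⁻¹
    rw [smul_smul, inv_mul_cancel₀ (pow_ne_zero _ t_ne_zero), one_smul] at h2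
    refine mem_of_mul_heckeInv_prod (fun i => T_mem_stabilizer i d)
      (List.finRange (μ.card - 1)) ?_
    rwa [← List.ofFn_eq_map]
  | succ k ih =>
    have e : (⟨k + 1, hk⟩ : Fin μ.card) = hi ⟨k, by omega⟩ := rfl
    rw [e, DAHA.theta_step]
    have hI := heckeInv_mem (T_mem_stabilizer (μ := μ) ⟨k, by omega⟩ d)
    exact Subalgebra.smul_mem _ (Subalgebra.mul_mem _ (Subalgebra.mul_mem _ hI
      (ih (by omega))) hI) _

/-- The sum of the layers is stable under all generators of the algebra and contains every `1 ⊗ m`,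
so it contains every `d ⊗ m`. -/
theorem iSup_layer (μ : YoungDiagram) : ⨆ d, layer μ d = ⊤ := by
  have hle : ∀ a : DAHA μ.card, (∀ d, ∀ v ∈ layer μ d, a • v ∈ ⨆ d, layer μ d) →
      a ∈ stabilizer (DAHA μ.card) (⨆ d, layer μ d) := by
    intro a h
    have : ⨆ d, layer μ d ≤ (⨆ d, layer μ d).comap (Algebra.lsmul K K (V μ) a) :=
      iSup_le fun d v hv => h d v hv
    exact fun v hv => this hv
  have htop := DAHA.subalgebra_eq_top (stabilizer (DAHA μ.card) (⨆ d, layer μ d))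
    (fun i => hle _ fun d v hv => Submodule.mem_iSup_of_mem d (T_mem_stabilizer i d v hv))
    (fun i => hle _ fun d v hv => Submodule.mem_iSup_of_mem d (theta_mem_stabilizer i d v hv))
    (fun i => hle _ fun d v hv => Submodule.mem_iSup_of_mem (d + 1) (X_smul_mem_layer i hv))
  rw [eq_top_iff]
  intro v _
  obtain ⟨x, rfl⟩ := Submodule.Quotient.mk_surjective _ v
  induction x using TensorProduct.induction_on with
  | zero => exact Submodule.zero_mem _
  | tmul d m =>
    have hd : d ∈ stabilizer (DAHA μ.card) (⨆ d, layer μ d) := by rw [htop]; trivial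
    have := hd (ofSpecht μ m) (Submodule.mem_iSup_of_mem 0 ⟨m, rfl⟩)
    rwa [smul_ofSpecht] at this
  | add x y hx hy =>
    rw [Submodule.Quotient.mk_add]
    exact Submodule.add_mem _ (hx trivial) (hy trivial)

theorem pairwise_commute_X_pow (n : ℕ) : Pairwise fun i j : Fin n =>
    ∀ x y : Multiplicative ℕ, Commute (powersHom (DAHA n) (DAHA.X i) x)
      (powersHom (DAHA n) (DAHA.X j) y) := fun i j _ a b => by
  have h : Commute (DAHA.X i) (DAHA.X j : DAHA n) := DAHA.X_comm i j
  simp only [powersHom_apply]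
  exact h.pow_pow _ _

/-- The monomials in the `X_i`. -/
noncomputable def monomial (n : ℕ) : (Fin n → Multiplicative ℕ) →* DAHA n :=
  MonoidHom.noncommPiCoprod (fun i => powersHom (DAHA n) (DAHA.X i)) (pairwise_commute_X_pow n)

theorem X_mul_monomial {n : ℕ} (j : Fin n) (α : Fin n → ℕ) :
    DAHA.X j * monomial n (fun i => Multiplicative.ofAdd (α i))
      = monomial n (fun i => Multiplicative.ofAdd ((α + Pi.single j 1 : Fin n → ℕ) i)) := by
  have h : (monomial n (Pi.mulSingle j (Multiplicative.ofAdd 1)) : DAHA n) = DAHA.X j := by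
    rw [monomial, MonoidHom.noncommPiCoprod_mulSingle]
    simp [powersHom_apply]
  rw [← h, ← map_mul]
  congr 1
  funext i
  by_cases hij : i = j
  · subst hij
    simp [mul_comm]
  · simp [hij]

/-- The vectors `X^α ⊗ τ`. -/
noncomputable def monomialVec (p : (Fin μ.card → ℕ) × SYT μ) : V μ :=
  monomial μ.card (fun i => Multiplicative.ofAdd (p.1 i)) • ofSpecht μ (spechtGen p.2)

theorem layer_le_span (d : ℕ) : layer μ d
    ≤ Submodule.span K (monomialVec '' {p : (Fin μ.card → ℕ) × SYT μ | ∑ i, p.1 i = d}) := by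
  induction d with
  | zero =>
    rintro v ⟨m, rfl⟩
    have hm : m ∈ Submodule.span K (Set.range (spechtGen (μ := μ))) := by
      rw [span_spechtGen]; trivial
    have := Submodule.mem_map_of_mem (f := ofSpecht μ) hm
    rw [Submodule.map_span] at this
    refine Submodule.span_mono ?_ this
    rintro _ ⟨_, ⟨S, rfl⟩, rfl⟩
    refine ⟨(0, S), by simp, ?_⟩
    have h1 : (fun i : Fin μ.card => Multiplicative.ofAdd ((0 : Fin μ.card → ℕ) i)) = 1 := rfl
    rw [monomialVec, h1, map_one, one_smul]
  | succ d ih =>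
    rw [layer]
    refine iSup_le fun j => ?_
    refine (Submodule.map_mono ih).trans ?_
    rw [Submodule.map_span, Submodule.span_le]
    rintro _ ⟨_, ⟨p, hp, rfl⟩, rfl⟩
    apply Submodule.subset_span
    refine ⟨(p.1 + Pi.single j 1, p.2), ?_, ?_⟩
    · simp only [Set.mem_ofPred_eq] at hp
      simp [Finset.sum_add_distrib, hp]
    · rw [monomialVec, ← X_mul_monomial, mul_smul]
      rfl

theorem span_monomialVec :
    Submodule.span K (Set.range (monomialVec (μ := μ))) = ⊤ := by
  rw [eq_top_iff, ← iSup_layer]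
  exact iSup_le fun d => (layer_le_span d).trans (Submodule.span_mono (Set.image_subset_range _ _))

end Layers
end VVMacdonald

namespace VVMacdonald

/-! ### The induced module is isomorphic to the model -/

section ModelEquiv

variable {μ : YoungDiagram}

/-- The map from the induced module to the model, as a linear map over the ground field. -/
noncomputable def toModelK (μ : YoungDiagram) : V μ →ₗ[K] Model μ :=
  (toModel μ).restrictScalars K

theorem toModelK_smul (d : DAHA μ.card) (v : V μ) :
    toModelK μ (d • v) = rep μ d (toModelK μ v) :=
  (toModel μ).map_smul d v

theorem rep_mem_map_layer {d e : ℕ} {a : DAHA μ.card} (ha : ∀ v ∈ layer μ d, a • v ∈ layer μ e)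
    {x : Model μ} (hx : x ∈ (layer μ d).map (toModelK μ)) :
    rep μ a x ∈ (layer μ e).map (toModelK μ) := by
  obtain ⟨v, hv, rfl⟩ := hx
  exact ⟨a • v, ha v hv, toModelK_smul a v⟩

theorem opT_mem_map_layer {d : ℕ} (i : Fin (μ.card - 1)) {x : Model μ}
    (hx : x ∈ (layer μ d).map (toModelK μ)) : opT i x ∈ (layer μ d).map (toModelK μ) := by
  rw [← rep_T]
  exact rep_mem_map_layer (T_mem_stabilizer i d) hx

theorem opShift_mem_map_layer (hn : 0 < μ.card) {d : ℕ} {x : Model μ}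
    (hx : x ∈ (layer μ d).map (toModelK μ)) :
    opShift μ x ∈ (layer μ (d + 1)).map (toModelK μ) := by
  rw [← rep_shift hn]
  refine rep_mem_map_layer (fun v hv => ?_) hx
  rw [mul_smul]
  have hX := X_smul_mem_layer (⟨0, hn⟩ : Fin μ.card) hv
  suffices ∀ k, descProd (fun k => if h : k < μ.card - 1 then
      heckeInv (DAHA.T ⟨k, h⟩ : DAHA μ.card) else 1) k • (DAHA.X ⟨0, hn⟩ : DAHA μ.card) • v
      ∈ layer μ (d + 1) from this _
  intro k
  induction k with
  | zero => rwa [descProd, one_smul]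
  | succ k ih =>
    rw [descProd_succ, mul_smul]
    by_cases h : k < μ.card - 1
    · rw [dif_pos h]
      exact heckeInv_mem (T_mem_stabilizer _ _) _ ih
    · rwa [dif_neg h, one_smul]

/-- A tableau of positive degree is, up to swaps, the shift of one of smaller degree: a label with
positive exponent is moved up until it is `n`, and then the shift can be undone. -/
theorem single_mem_map_layer (τ : PSYT μ) :
    Finsupp.single τ 1 ∈ (layer μ τ.degree).map (toModelK μ) := by
  generalize hd : τ.degree = d
  induction d generalizing τ with
  | zero =>
    have hT : τ.shapeRYT = RYT.zero μ := RYT.ext' <| funext fun b =>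
      (Finset.sum_eq_zero_iff.mp hd) b (Finset.mem_univ b)
    have hc : Compatible (RYT.zero μ) τ.label := hT ▸ τ.compatible
    have h1 := spechtMap_gen (SYT.ofCompatible _ hc)
    rw [← toModel_ofSpecht] at h1
    rw [← vec_tableau, hT, ← Submodule.smul_mem_iff _ (normConst_ne_zero (SYT.ofCompatible _ hc))]
    exact ⟨_, ⟨_, rfl⟩, h1⟩
  | succ d ih =>
    have hpos : ∃ j, 0 < τ.w j := by
      by_contra! h
      have : τ.degree = 0 := Finset.sum_eq_zero fun b _ => by
        have := h (τ.label b)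
        rw [PSYT.w, Equiv.symm_apply_apply] at this
        omega
      omega
    obtain ⟨j, hj⟩ := hpos
    -- The inner induction is on the distance from the last label to a label `j` of positive
    -- exponent.
    generalize hk : μ.card - 1 - (j : ℕ) = k
    induction k generalizing τ j with
    | zero =>
      have hlast : ∀ b, (τ.label b : ℕ) + 1 = μ.card → 0 < τ.expo b := fun b hb => by
        have : j = τ.label b := Fin.ext (by have := j.2; omega)
        rwa [this, PSYT.w, Equiv.symm_apply_apply] at hj
      have hs := τ.shift_unshift hlast
      have hn : 0 < μ.card := j.pos
      have hdeg := (τ.unshift hlast).degree_shift hn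
      rw [hs] at hdeg
      rw [← hs, ← opShift_single]
      exact opShift_mem_map_layer hn (ih _ (by omega))
    | succ k ihk =>
      obtain ⟨i, rfl⟩ : ∃ i : Fin (μ.card - 1), lo i = j := ⟨⟨j, by omega⟩, rfl⟩
      have hlv : ((lo i : Fin μ.card) : ℕ) = i := rfl
      have hhv : ((hi i : Fin μ.card) : ℕ) = i + 1 := rfl
      rcases Nat.eq_zero_or_pos (τ.w (hi i)) with h0 | h0
      · have hne : τ.shapeRYT.entry (τ.label.symm (lo i))
            ≠ τ.shapeRYT.entry (τ.label.symm (hi i)) := fun h => by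
          change τ.w (lo i) = τ.w (hi i) at h
          omega
        have hsw := (τ.compatible.swap_iff i).mpr fun h => hne h.2
        have h1 := ihk (PSYT.ofCompatible _ _ hsw) hd (hi i) (by
          rw [PSYT.w]
          change 0 < τ.expo ((τ.label.trans (simpleTransposition i)).symm (hi i))
          rw [Equiv.trans_simpleTransposition_symm, simpleTransposition_hi]
          exact hj) (by omega)
        rw [← vec_of_compatible] at h1
        -- The exponents at `lo i` and `hi i` differ, so the swap is admissible, and `T_i` leads
        -- from the swapped tableau back to `τ` with a nonzero coefficient.
        have h2 := opT_mem_map_layer i h1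
        rw [opT_vec fun _ => hsw, Equiv.trans_simpleTransposition_self,
          Equiv.trans_simpleTransposition_symm, Equiv.trans_simpleTransposition_symm,
          simpleTransposition_hi, simpleTransposition_lo, vec_tableau] at h2
        have h3 := (Submodule.add_mem_iff_right _ (Submodule.smul_mem _ _ h1)).mp h2
        refine (Submodule.smul_mem_iff _ (coefB_ne_zero (fun h => ?_) fun h => ?_)).mp h3
        · exact hne (boxWeight_injective h).1.symm
        · rw [t_mul_boxWeight] at h
          exact hne (q_pow_mul_t_zpow_injective h).1.symm
      · exact ihk τ hd (hi i) h0 (by omega)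

/-- The periodic standard tableau attached to an exponent vector and a standard tableau. -/
def sortPSYT (p : (Fin μ.card → ℕ) × SYT μ) : PSYT μ :=
  -- The order dual makes the exponents decrease, and stability of the sort keeps indices increasing
  -- among equal exponents; the `k`-th index so obtained goes to the box with standard label `k`.
  let f : Fin μ.card → ℕᵒᵈ := fun i => OrderDual.toDual (p.1 i)
  have h : ∀ i j, i < j → LabelLT (Tuple.sort f i, p.1 (Tuple.sort f i))
      (Tuple.sort f j, p.1 (Tuple.sort f j)) := fun i j hij => by
    obtain ⟨h1, h2⟩ := Tuple.eq_sort_iff.mp (rfl : Tuple.sort f = Tuple.sort f)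
    have h3 : p.1 (Tuple.sort f j) ≤ p.1 (Tuple.sort f i) := h1 hij.le
    rcases h3.lt_or_eq with h4 | h4
    · exact Or.inl h4
    · exact Or.inr ⟨h4.symm, h2 i j hij (congrArg OrderDual.toDual h4.symm)⟩
  { label := p.2.label.trans (Tuple.sort f)
    expo := fun b => p.1 (Tuple.sort f (p.2.label b))
    row_strict := fun b c hbc => h _ _ (p.2.row_strict b c hbc)
    col_strict := fun b c hbc => h _ _ (p.2.col_strict b c hbc) }

theorem sortPSYT_w (p : (Fin μ.card → ℕ) × SYT μ) : (sortPSYT p).w = p.1 := by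
  funext i
  simp [PSYT.w, sortPSYT]

theorem sortPSYT_injective : Function.Injective (sortPSYT (μ := μ)) := by
  rintro ⟨α, S⟩ ⟨α', S'⟩ h
  have h1 := sortPSYT_w (α, S)
  rw [h, sortPSYT_w] at h1
  simp only at h1
  subst h1
  congr 1
  apply SYT.ext'
  have h2 := congrArg PSYT.label h
  ext b
  have h3 := Equiv.congr_fun h2 b
  simp only [sortPSYT, Equiv.trans_apply, EmbeddingLike.apply_eq_iff_eq] at h3
  rw [h3]

theorem PSYT.degree_eq (τ : PSYT μ) : τ.degree = ∑ i, τ.w i :=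
  (Equiv.sum_comp τ.label.symm τ.expo).symm

/-- The pairs of an exponent vector of bounded degree and a standard tableau. -/
def boundedPairs (μ : YoungDiagram) (d : ℕ) : Set ((Fin μ.card → ℕ) × SYT μ) :=
  {p | ∑ i, p.1 i ≤ d}

instance : Finite (SYT μ) :=
  Finite.of_injective SYT.label fun _ _ => SYT.ext'

theorem finite_boundedPairs (d : ℕ) : (boundedPairs μ d).Finite := by
  refine ((Set.finite_Iic (fun _ : Fin μ.card => d)).prod Set.finite_univ).subset ?_
  rintro ⟨α, S⟩ h
  refine ⟨fun i => ?_, trivial⟩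
  exact (Finset.single_le_sum (f := α) (fun _ _ => Nat.zero_le _) (Finset.mem_univ i)).trans h

/-- A finite family is independent once its span has dimension at least its size. The span of these
images contains the basis vectors at `sortPSYT p` for all pairs `p` of degree at most `d`, and these
are independent and equally many. -/
theorem linearIndepOn_boundedPairs (d : ℕ) :
    LinearIndepOn K (fun p => toModelK μ (monomialVec p)) (boundedPairs μ d) := by
  have := (finite_boundedPairs (μ := μ) d).fintype
  have hs : LinearIndependent K
      fun p : boundedPairs μ d => (Finsupp.single (sortPSYT p.1) 1 : Model μ) :=
    (Finsupp.basisSingleOne.linearIndependent.comp _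
      (sortPSYT_injective.comp Subtype.val_injective))
  rw [LinearIndepOn, linearIndependent_iff_card_le_finrank_span]
  have h1 := finrank_span_eq_card hs
  rw [← h1, Set.finrank]
  have hfin : FiniteDimensional K (Submodule.span K (Set.range
      fun p : boundedPairs μ d => toModelK μ (monomialVec p.1))) :=
    FiniteDimensional.span_of_finite _ (Set.finite_range _)
  apply Submodule.finrank_mono
  rw [Submodule.span_le]
  rintro _ ⟨p, rfl⟩
  have h2 := Submodule.map_mono (f := toModelK μ) (layer_le_span (sortPSYT p.1).degree)
    (single_mem_map_layer (sortPSYT p.1))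
  rw [Submodule.map_span] at h2
  refine Submodule.span_mono ?_ h2
  rintro _ ⟨_, ⟨r, hr, rfl⟩, rfl⟩
  refine ⟨⟨r, ?_⟩, rfl⟩
  have hp : ∑ i, p.1.1 i ≤ d := p.2
  have hr' : ∑ i, r.1 i = _ := hr
  rw [PSYT.degree_eq, sortPSYT_w] at hr'
  exact (hr'.trans_le hp : ∑ i, r.1 i ≤ d)

theorem linearIndependent_toModelK :
    LinearIndependent K fun p => toModelK μ (monomialVec p) := by
  rw [← linearIndepOn_univ_iff]
  have : (Set.univ : Set ((Fin μ.card → ℕ) × SYT μ)) = ⋃ d, boundedPairs μ d := by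
    refine (Set.eq_univ_of_forall fun p => ?_).symm
    exact Set.mem_iUnion.mpr ⟨∑ i, p.1 i, (le_rfl : ∑ i, p.1 i ≤ _)⟩
  rw [this]
  refine linearIndepOn_iUnion_of_directed ?_ linearIndepOn_boundedPairs
  exact Monotone.directed_le fun d e h p (hp : _ ≤ d) => (hp.trans h : _ ≤ e)

/-- A spanning family of `V μ` has independent images, so nothing lies in the kernel; surjectivity
is `single_mem_map_layer`. -/
theorem toModelK_bijective : Function.Bijective (toModelK μ) := by
  constructor
  · have hs : ∀ v : V μ, ∃ x, Finsupp.linearCombination K (monomialVec (μ := μ)) x = v := by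
      rw [← Function.Surjective, ← LinearMap.range_eq_top, Finsupp.range_linearCombination,
        span_monomialVec]
    intro v w h
    obtain ⟨x, rfl⟩ := hs v
    obtain ⟨y, rfl⟩ := hs w
    rw [Finsupp.apply_linearCombination, Finsupp.apply_linearCombination] at h
    rw [linearIndependent_toModelK h]
  · rw [← LinearMap.range_eq_top, eq_top_iff, ← Finsupp.basisSingleOne.span_eq, Submodule.span_le]
    rintro _ ⟨τ, rfl⟩
    obtain ⟨v, -, hv⟩ := single_mem_map_layer τ
    exact ⟨v, by rw [hv, Finsupp.coe_basisSingleOne]⟩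

/-- The induced module is isomorphic to the model. -/
noncomputable def modelEquiv (μ : YoungDiagram) : V μ ≃ₗ[K] Model μ :=
  LinearEquiv.ofBijective (toModelK μ) toModelK_bijective

theorem modelEquiv_smul (d : DAHA μ.card) (v : V μ) :
    modelEquiv μ (d • v) = rep μ d (modelEquiv μ v) := toModelK_smul d v

theorem exists_isWeightBasis (μ : YoungDiagram) :
    ∃ F : Module.Basis (PSYT μ) K (V μ), IsWeightBasis F := by
  refine ⟨Module.Basis.ofRepr (modelEquiv μ), fun τ i => ?_⟩
  rw [Module.Basis.coe_ofRepr, ← (modelEquiv μ).injective.eq_iff, modelEquiv_smul, map_smul,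
    LinearEquiv.apply_symm_apply, rep_theta, opTheta_single]
  rfl

end ModelEquiv
end VVMacdonald

namespace VVMacdonald

/-! ### Column reading -/

section ColumnReading

variable {μ : YoungDiagram}

/-- The position of a box in the column reading order. -/
def columnKey (b : Box μ) : ℕ ×ₗ ℕ := toLex (b.1.2, b.1.1)

theorem columnKey_injective : Function.Injective (columnKey (μ := μ)) := fun b c h => by
  have h1 := Prod.ext_iff.mp (toLex.injective h)
  exact Box.ext h1.2 h1.1

theorem columnKey_lt {b c : Box μ} : columnKey b < columnKey c ↔
    b.1.2 < c.1.2 ∨ (b.1.2 = c.1.2 ∧ b.1.1 < c.1.1) := Prod.Lex.lt_iff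

theorem exists_columnReading (μ : YoungDiagram) : ∃ l : Box μ ≃ Fin μ.card,
    ∀ b c, l b < l c ↔ columnKey b < columnKey c := by
  classical
  let e := Equiv.ofInjective (columnKey (μ := μ)) columnKey_injective
  have hc : Fintype.card (Set.range (columnKey (μ := μ))) = μ.card :=
    (Fintype.card_congr e).symm.trans (card_box μ)
  let o := Fintype.orderIsoFinOfCardEq (Set.range (columnKey (μ := μ))) hc
  exact ⟨e.trans o.symm.toEquiv, fun b c => o.symm.lt_iff_lt⟩

/-- The labelling of the boxes column by column. -/
noncomputable def columnReading (μ : YoungDiagram) : Box μ ≃ Fin μ.card :=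
  (exists_columnReading μ).choose

theorem columnReading_lt {b c : Box μ} : columnReading μ b < columnReading μ c ↔
    b.1.2 < c.1.2 ∨ (b.1.2 = c.1.2 ∧ b.1.1 < c.1.1) :=
  ((exists_columnReading μ).choose_spec b c).trans columnKey_lt

theorem columnReading_lt_of_forced {T : RYT μ} {b c : Box μ} (h : Forced T b c) :
    columnReading μ b < columnReading μ c := by
  rw [columnReading_lt]
  exact h.1.elim (fun h => Or.inl h.2) Or.inr

theorem columnReading_compatible (T : RYT μ) : Compatible T (columnReading μ) :=
  fun _ _ h => columnReading_lt_of_forced h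

/-- This is why columns are read: an equality of entries inside a column always shows up at a
consecutive pair of labels. -/
theorem columnReading_succ {b c : Box μ} (h1 : b.1.2 = c.1.2) (h2 : b.1.1 + 1 = c.1.1) :
    (columnReading μ c : ℕ) = columnReading μ b + 1 := by
  have hlt : columnReading μ b < columnReading μ c :=
    columnReading_lt.mpr (Or.inr ⟨h1, by omega⟩)
  by_contra hne
  rw [Fin.lt_def] at hlt
  have hc := (columnReading μ c).2
  obtain ⟨d, hd⟩ := (columnReading μ).surjective ⟨columnReading μ b + 1, by omega⟩
  have e1 : columnReading μ b < columnReading μ d := by rw [hd, Fin.lt_def]; simp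
  have e2 : columnReading μ d < columnReading μ c := by
    rw [hd, Fin.lt_def]; simp only; omega
  rw [columnReading_lt] at e1 e2
  omega

/-- Entries decrease weakly down a column, so if two of them agree, all those between agree too; in
particular the entry just above the lower one does. -/
theorem RYT.exists_adjacent_of_not_isRSSYT {T : RYT μ} (h : ¬ T.IsRSSYT) :
    ∃ b c : Box μ, b.1.2 = c.1.2 ∧ b.1.1 + 1 = c.1.1 ∧ T.entry b = T.entry c := by
  rw [RYT.IsRSSYT] at h
  push Not at h
  obtain ⟨b, c, ⟨h1, h2⟩, h3⟩ := h
  refine ⟨c.nw (c.1.1 - 1) c.1.2 (by omega) le_rfl, c, rfl, by simp only [Box.nw]; omega, ?_⟩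
  set d := c.nw (c.1.1 - 1) c.1.2 (by omega) le_rfl with hd
  have hdc : T.entry c ≤ T.entry d := T.col_weak d c ⟨rfl, by simp only [hd, Box.nw]; omega⟩
  rcases (show b.1.1 ≤ c.1.1 - 1 by omega).lt_or_eq with h4 | h4
  · have := T.col_weak b d ⟨h1, h4⟩
    omega
  · have : b = d := Box.ext h4 h1
    rw [← this] at hdc ⊢
    omega

/-- A function on the compatible labellings that does not change under admissible swaps is
constant. -/
theorem eq_columnReading_of_swap {α : Type*} {T : RYT μ} (f : (Box μ ≃ Fin μ.card) → α)
    (hf : ∀ l i, Compatible T l → Compatible T (l.trans (simpleTransposition i)) →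
      f (l.trans (simpleTransposition i)) = f l)
    (l : Box μ ≃ Fin μ.card) (hl : Compatible T l) : f l = f (columnReading μ) := by
  generalize hk : inversions ((columnReading μ).symm.trans l) = k
  induction k using Nat.strong_induction_on generalizing l with
  | _ k ih =>
  by_cases h1 : (columnReading μ).symm.trans l = 1
  · have : l = columnReading μ := by
      ext b
      have := Equiv.congr_fun h1 (columnReading μ b)
      rw [Equiv.trans_apply, Equiv.symm_apply_apply] at this
      rw [this]
      rfl
    rw [this]
  -- A descent is a swap that brings `l` closer to the column reading. It is admissible, because
  -- forced pairs are already in column reading order and the descent pair is not.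
  · obtain ⟨i, hi⟩ := exists_descent (σ := ((columnReading μ).symm.trans l)⁻¹)
      fun h => h1 (inv_eq_one.mp h)
    have hinv := inversions_simple_mul' hi
    have hc : Compatible T (l.trans (simpleTransposition i)) := by
      rw [hl.swap_iff]
      intro hforced
      exact lt_asymm (columnReading_lt_of_forced hforced) hi
    rw [← hf l i hl hc]
    exact ih (inversions (simpleTransposition i * (columnReading μ).symm.trans l)) (by omega)
      _ hc rfl

end ColumnReading

/-! ### Symmetrization on the model -/

section Symmetrize

variable {μ : YoungDiagram}

theorem vec_apply_eq_zero {T : RYT μ} {l : Box μ ≃ Fin μ.card} {τ : PSYT μ}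
    (h : ¬ (T = τ.shapeRYT ∧ l = τ.label)) : vec T l τ = 0 := by
  by_cases hl : Compatible T l
  · rw [vec_of_compatible hl]
    refine Finsupp.single_eq_of_ne fun h' => h ?_
    rw [h']
    exact ⟨(PSYT.shapeRYT_ofCompatible T l hl).symm, rfl⟩
  · rw [vec_of_not hl, Finsupp.zero_apply]

/-- The coefficient of a vector at the tableau with given shape and labels. -/
noncomputable def coeffAt (T : RYT μ) (l : Box μ ≃ Fin μ.card) : Model μ →ₗ[K] K :=
  Finsupp.linearCombination K fun τ => vec T l τ

open Classical in
theorem coeffAt_of_compatible {T : RYT μ} {l : Box μ ≃ Fin μ.card} (h : Compatible T l)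
    (u : Model μ) : coeffAt T l u = u (PSYT.ofCompatible T l h) := by
  induction u using Finsupp.induction_linear with
  | zero => simp
  | add u v hu hv => rw [map_add, hu, hv, Finsupp.add_apply]
  | single τ k =>
    rw [coeffAt, Finsupp.linearCombination_single, vec_of_compatible h, Finsupp.single_apply,
      Finsupp.single_apply]
    simp [eq_comm]

theorem coeffAt_of_not {T : RYT μ} {l : Box μ ≃ Fin μ.card} (h : ¬ Compatible T l)
    (u : Model μ) : coeffAt T l u = 0 := by
  simp [coeffAt, vec_of_not h, Finsupp.linearCombination_apply]

theorem coeffAt_vec {T T' : RYT μ} {l l' : Box μ ≃ Fin μ.card} (h : Compatible T' l') :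
    coeffAt T l (vec T' l') = vec T l (PSYT.ofCompatible T' l' h) := by
  rw [vec_of_compatible h, coeffAt, Finsupp.linearCombination_single, one_smul]

/-- The transposed matrix of `T_i`: the second term comes from the swapped labelling, where the two
weights have changed places, so `coefB` has its arguments reversed. -/
theorem opT_apply (i : Fin (μ.card - 1)) (u : Model μ) {T : RYT μ} {l : Box μ ≃ Fin μ.card}
    (h : Compatible T l) :
    coeffAt T l (opT i u)
      = coefA t (boxWeight T (l.symm (lo i))) (boxWeight T (l.symm (hi i))) * coeffAt T l u
        + coefB t (boxWeight T (l.symm (hi i))) (boxWeight T (l.symm (lo i)))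
          * coeffAt T (l.trans (simpleTransposition i)) u := by
  have key : (coeffAt T l).comp (opT i)
      = coefA t (boxWeight T (l.symm (lo i))) (boxWeight T (l.symm (hi i))) • coeffAt T l
        + coefB t (boxWeight T (l.symm (hi i))) (boxWeight T (l.symm (lo i)))
          • coeffAt T (l.trans (simpleTransposition i)) := by
    apply Model.ext
    intro T' l' h'
    rw [LinearMap.comp_apply, opT_vec fun _ => h', map_add, map_smul, map_smul,
      LinearMap.add_apply, LinearMap.smul_apply, LinearMap.smul_apply]
    have hv : ∀ (T₁ T₂ : RYT μ) (l₁ l₂ : Box μ ≃ Fin μ.card), Compatible T₁ l₁ →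
        ¬ (T₁ = T₂ ∧ l₁ = l₂) → coeffAt T₁ l₁ (vec T₂ l₂) = 0 := by
      intro T₁ T₂ l₁ l₂ h₁ hne
      by_cases h₂ : Compatible T₂ l₂
      · rw [coeffAt_vec h₂]
        apply vec_apply_eq_zero
        rwa [PSYT.shapeRYT_ofCompatible]
      · rw [vec_of_not h₂, map_zero]
    have hself : ∀ (T₁ : RYT μ) (l₁ : Box μ ≃ Fin μ.card), Compatible T₁ l₁ →
        coeffAt T₁ l₁ (vec T₁ l₁) = 1 := by
      intro T₁ l₁ h₁
      rw [coeffAt_of_compatible h₁, vec_of_compatible h₁, Finsupp.single_eq_same]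
    congr 1
    · by_cases he : T = T' ∧ l = l'
      · obtain ⟨rfl, rfl⟩ := he
        rfl
      · rw [hv _ _ _ _ h he, smul_zero, smul_zero]
    · by_cases he : T = T' ∧ l.trans (simpleTransposition i) = l'
      · obtain ⟨rfl, rfl⟩ := he
        rw [Equiv.trans_simpleTransposition_self, hself _ _ h, hself _ _ h',
          Equiv.trans_simpleTransposition_symm, Equiv.trans_simpleTransposition_symm,
          simpleTransposition_lo, simpleTransposition_hi]
      · have he' : ¬ (T = T' ∧ l = l'.trans (simpleTransposition i)) := fun h₃ => he ⟨h₃.1, by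
          rw [h₃.2, Equiv.trans_simpleTransposition_self]⟩
        rw [hv _ _ _ _ h he', smul_zero]
        by_cases hc : Compatible T (l.trans (simpleTransposition i))
        · rw [hv _ _ _ _ hc he, smul_zero]
        · rw [coeffAt_of_not hc, smul_zero]
  exact LinearMap.congr_fun key u

/-- Since `coefB t y x = 1 - coefA t x y`, invariance says that `coefB t y x` times the difference
of the two coefficients is zero, and this factor is nonzero when the swap is allowed. -/
theorem coeffAt_swap_of_invariant {i : Fin (μ.card - 1)} {u : Model μ} (hu : opT i u = u)
    {T : RYT μ} {l : Box μ ≃ Fin μ.card} (h : Compatible T l)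
    (hs : Compatible T (l.trans (simpleTransposition i))) :
    coeffAt T (l.trans (simpleTransposition i)) u = coeffAt T l u := by
  have h1 := opT_apply i u h
  have hne := h.lo_hi i
  have hf := (h.swap_iff i).mp hs
  rcases h.boxWeight_consecutive (b := l.symm (lo i)) (c := l.symm (hi i)) (by simp)
    with h2 | h2 | h2
  · exact absurd ⟨Or.inl h2.1, h2.2.1⟩ hf
  · exact absurd ⟨Or.inr h2.1, h2.2.1⟩ hf
  · have hB := coefB_ne_zero hne.symm h2.2.2
    rw [hu] at h1
    apply mul_left_cancel₀ hB
    rw [coefB_eq hne.symm] at h1 ⊢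
    linear_combination -h1

theorem t_ne_neg_one : -t ≠ (1 : K) := fun h =>
  t_pow_ne_one two_ne_zero (by rw [← neg_sq, h, one_pow])

/-- For a forced pair in a column `T_i` multiplies the coefficient by `-t`, so invariance makes `1 +
t` annihilate it. -/
theorem coeffAt_eq_zero_of_invariant {i : Fin (μ.card - 1)} {u : Model μ} (hu : opT i u = u)
    {T : RYT μ} {l : Box μ ≃ Fin μ.card} (h : Compatible T l)
    (ha : Above (l.symm (lo i)) (l.symm (hi i)))
    (he : T.entry (l.symm (lo i)) = T.entry (l.symm (hi i))) : coeffAt T l u = 0 := by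
  have h1 := opT_apply i u h
  have hs : ¬ Compatible T (l.trans (simpleTransposition i)) := fun hs =>
    (h.swap_iff i).mp hs ⟨Or.inr ha, he⟩
  rcases h.boxWeight_consecutive (b := l.symm (lo i)) (c := l.symm (hi i)) (by simp)
    with h2 | h2 | h2
  · exact absurd h2.1.1 (ne_of_lt ha.2)
  · rw [hu, h2.2.2, coefA_t_mul_self (boxWeight_ne_zero _ _) t_ne_one, coeffAt_of_not hs,
      mul_zero, add_zero] at h1
    have h3 : (1 - -t) * coeffAt T l u = 0 := by linear_combination h1
    exact (mul_eq_zero.mp h3).resolve_left (sub_ne_zero.mpr t_ne_neg_one.symm)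
  · exact absurd ⟨Or.inr ha, he⟩ h2.1

/-- The span of the basis vectors lying over a reverse tableau. -/
noncomputable def fibre (T : RYT μ) : Submodule K (Model μ) :=
  Finsupp.supported K K {τ | τ.shapeRYT = T}

theorem mem_fibre {T : RYT μ} {u : Model μ} :
    u ∈ fibre T ↔ ∀ τ : PSYT μ, τ.shapeRYT ≠ T → u τ = 0 := by
  rw [fibre, Finsupp.mem_supported']
  rfl

theorem vec_mem_fibre (T : RYT μ) (l : Box μ ≃ Fin μ.card) : vec T l ∈ fibre T := by
  rw [mem_fibre]
  exact fun τ hτ => vec_apply_eq_zero fun h => hτ h.1.symm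

theorem opT_mem_fibre {T : RYT μ} (i : Fin (μ.card - 1)) {u : Model μ} (hu : u ∈ fibre T) :
    opT i u ∈ fibre T := by
  rw [mem_fibre] at hu ⊢
  intro τ hτ
  have h1 := opT_apply i u τ.compatible
  have h0 : ∀ l, coeffAt τ.shapeRYT l u = 0 := fun l => by
    by_cases hl : Compatible τ.shapeRYT l
    · rw [coeffAt_of_compatible hl]
      exact hu _ (by rwa [PSYT.shapeRYT_ofCompatible])
    · exact coeffAt_of_not hl u
  rw [h0, h0, mul_zero, mul_zero, add_zero, coeffAt_of_compatible τ.compatible] at h1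
  exact h1

theorem heckeRep_mem_fibre {T : RYT μ} (a : Hecke μ.card) {u : Model μ} (hu : u ∈ fibre T) :
    heckeRep μ a u ∈ fibre T := by
  have htop := Hecke.subalgebra_eq_top (stabilizer (Hecke μ.card) (fibre T)) fun i v hv => by
    rw [hecke_smul_def, heckeRep_T]
    exact opT_mem_fibre i hv
  have : a ∈ stabilizer (Hecke μ.card) (fibre T) := by rw [htop]; trivial
  exact this u hu

/-- Two invariant vectors over the same reverse tableau agree when they agree at the column
reading. -/
theorem eq_of_invariant {T : RYT μ} {u v : Model μ} (hu : u ∈ fibre T) (hv : v ∈ fibre T)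
    (hu' : ∀ i, opT i u = u) (hv' : ∀ i, opT i v = v)
    (h : coeffAt T (columnReading μ) u = coeffAt T (columnReading μ) v) : u = v := by
  ext τ
  by_cases hτ : τ.shapeRYT = T
  · subst hτ
    have key : ∀ w : Model μ, (∀ i, opT i w = w) →
        w τ = coeffAt τ.shapeRYT (columnReading μ) w := fun w hw => by
      rw [← eq_columnReading_of_swap (fun l => coeffAt τ.shapeRYT l w)
        (fun l i hl hs => coeffAt_swap_of_invariant (hw i) hl hs) τ.label τ.compatible,
        coeffAt_of_compatible τ.compatible]
      rfl
    rw [key u hu', key v hv', h]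
  · rw [mem_fibre.mp hu τ hτ, mem_fibre.mp hv τ hτ]

end Symmetrize
end VVMacdonald

namespace VVMacdonald

/-! ### The rank of the symmetrized fibres -/

section Rank

variable {μ : YoungDiagram}

theorem finite_setOf_shapeRYT (T : RYT μ) : {τ : PSYT μ | τ.shapeRYT = T}.Finite := by
  refine Set.Finite.of_finite_image (f := PSYT.label) (Set.toFinite _) ?_
  intro τ hτ τ' hτ' h
  exact PSYT.ext' h (congrArg RYT.entry ((hτ : τ.shapeRYT = T).trans (hτ' : τ'.shapeRYT = T).symm))

/-- The sum of the basis vectors lying over a reverse tableau. -/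
noncomputable def fibreSum (T : RYT μ) : Model μ :=
  ∑ τ ∈ (finite_setOf_shapeRYT T).toFinset, Finsupp.single τ 1

theorem fibreSum_mem (T : RYT μ) : fibreSum T ∈ fibre T :=
  Submodule.sum_mem _ fun τ hτ => by
    have : τ.shapeRYT = T := (finite_setOf_shapeRYT T).mem_toFinset.mp hτ
    rw [← vec_tableau, this]
    exact vec_mem_fibre T _

theorem coeffAt_fibreSum {T : RYT μ} {l : Box μ ≃ Fin μ.card} (h : Compatible T l) :
    coeffAt T l (fibreSum T) = 1 := by
  classical
  rw [coeffAt_of_compatible h, fibreSum, Finsupp.finsetSum_apply,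
    Finset.sum_eq_single (PSYT.ofCompatible T l h), Finsupp.single_eq_same]
  · exact fun τ _ hτ => Finsupp.single_eq_of_ne hτ.symm
  · intro hn
    exact absurd ((finite_setOf_shapeRYT T).mem_toFinset.mpr
      (PSYT.shapeRYT_ofCompatible T l h)) hn

theorem fibreSum_ne_zero (T : RYT μ) : fibreSum T ≠ 0 := fun h => by
  have := coeffAt_fibreSum (columnReading_compatible T)
  rw [h, map_zero] at this
  exact zero_ne_one this

/-- Each coefficient of the result is `coefA t x y + coefB t y x = 1`. At a forced pair in a row
`coefA` alone is 1; forced pairs in a column, where it would be `-t`, are excluded by strictness. -/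
theorem opT_fibreSum {T : RYT μ} (hT : T.IsRSSYT) (i : Fin (μ.card - 1)) :
    opT i (fibreSum T) = fibreSum T := by
  ext τ
  by_cases hτ : τ.shapeRYT = T
  · subst hτ
    have h := τ.compatible
    have e := opT_apply i (fibreSum τ.shapeRYT) h
    have h1 : ∀ u : Model μ, coeffAt τ.shapeRYT τ.label u = u τ := coeffAt_of_compatible h
    rw [← h1, ← h1, e, coeffAt_fibreSum h, mul_one]
    rcases h.boxWeight_consecutive (b := τ.label.symm (lo i)) (c := τ.label.symm (hi i)) (by simp)
      with h2 | h2 | h2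
    · rw [h2.2.2, coefA_self_t_mul (boxWeight_ne_zero _ _) t_ne_one, coefB_t_mul, zero_mul,
        add_zero]
    · exact absurd (hT _ _ h2.1) (not_lt.mpr h2.2.1.le)
    · rw [coeffAt_fibreSum ((h.swap_iff i).mpr h2.1), mul_one, coefB_eq (h.lo_hi i).symm]
      ring
  · rw [mem_fibre.mp (fibreSum_mem T) τ hτ,
      mem_fibre.mp (opT_mem_fibre i (fibreSum_mem T)) τ hτ]

theorem opT_trivialIdempotent (i : Fin (μ.card - 1)) (u : Model μ) :
    opT i (heckeRep μ (trivialIdempotent μ.card) u)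
      = heckeRep μ (trivialIdempotent μ.card) u := by
  rw [← heckeRep_T, ← Module.End.mul_apply, ← map_mul, Hecke.T_mul_trivialIdempotent]

theorem rank_eq_one_of_le_span {F M : Type*} [Field F] [AddCommGroup M] [Module F M]
    {N : Submodule F M} {v : M} (h1 : v ∈ N) (h2 : v ≠ 0) (h3 : N ≤ Submodule.span F {v}) :
    Module.rank F N = 1 :=
  (rank_submodule_eq_one_iff N).mpr ⟨v, h1, h2, h3⟩

/-- The image consists of invariants, which are determined by their coefficient at the column
reading, and it contains `fibreSum T`, an invariant that the idempotent multiplies by a nonzero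
scalar. -/
theorem rank_map_fibre_of_isRSSYT {T : RYT μ} (hT : T.IsRSSYT) :
    Module.rank K ((fibre T).map (heckeRep μ (trivialIdempotent μ.card))) = 1 := by
  obtain ⟨k, hk, h⟩ := Hecke.exists_trivialIdempotent_smul μ.card
  have h1 := h (heckeRep μ) (fibreSum T) fun i => by
    rw [heckeRep_T, opT_fibreSum hT]
  refine rank_eq_one_of_le_span (v := fibreSum T) ?_ (fibreSum_ne_zero T) ?_
  · rw [← Submodule.smul_mem_iff _ hk, ← h1]
    exact Submodule.mem_map_of_mem (fibreSum_mem T)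
  · rintro _ ⟨u, hu, rfl⟩
    rw [Submodule.mem_span_singleton]
    refine ⟨coeffAt T (columnReading μ) (heckeRep μ (trivialIdempotent μ.card) u), ?_⟩
    apply eq_of_invariant (T := T) (Submodule.smul_mem _ _ (fibreSum_mem T))
      (heckeRep_mem_fibre _ hu) (fun i => by rw [map_smul, opT_fibreSum hT])
      fun i => opT_trivialIdempotent i u
    rw [map_smul, coeffAt_fibreSum (columnReading_compatible T), smul_eq_mul, mul_one]

/-- The column reading gives consecutive labels to two vertically adjacent boxes with equal entries,
so an invariant vanishes at the column reading and therefore everywhere on the fibre. -/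
theorem map_fibre_of_not_isRSSYT {T : RYT μ} (hT : ¬ T.IsRSSYT) :
    (fibre T).map (heckeRep μ (trivialIdempotent μ.card)) = ⊥ := by
  rw [eq_bot_iff]
  rintro _ ⟨u, hu, rfl⟩
  rw [Submodule.mem_bot]
  obtain ⟨b, c, h1, h2, h3⟩ := RYT.exists_adjacent_of_not_isRSSYT hT
  have h4 := columnReading_succ h1 h2
  have hc := (columnReading μ c).2
  obtain ⟨i, hi1, hi2⟩ : ∃ i : Fin (μ.card - 1),
      lo i = columnReading μ b ∧ hi i = columnReading μ c :=
    ⟨⟨columnReading μ b, by omega⟩, rfl, Fin.ext h4.symm⟩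
  have e1 : (columnReading μ).symm (lo i) = b := by rw [hi1, Equiv.symm_apply_apply]
  have e2 : (columnReading μ).symm (hi i) = c := by rw [hi2, Equiv.symm_apply_apply]
  apply eq_of_invariant (T := T) (heckeRep_mem_fibre _ hu) (Submodule.zero_mem _)
    (fun i => opT_trivialIdempotent i u) fun i => map_zero _
  rw [map_zero]
  refine coeffAt_eq_zero_of_invariant (opT_trivialIdempotent i u) (columnReading_compatible T) ?_ ?_
  · rw [e1, e2]
    exact ⟨h1, by omega⟩
  · rw [e1, e2, h3]

/-- A weight basis vector is a multiple of the corresponding basis vector of the model. -/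
theorem IsWeightBasis.exists_smul {F : Module.Basis (PSYT μ) K (V μ)} (hF : IsWeightBasis F)
    (τ : PSYT μ) : ∃ k : K, k ≠ 0 ∧ modelEquiv μ (F τ) = k • Finsupp.single τ 1 := by
  have h0 : ∀ σ, σ ≠ τ → modelEquiv μ (F τ) σ = 0 := by
    intro σ hσ
    by_contra hne
    -- A nonzero coefficient at `σ` forces all eigenvalues of the `θ_i` at `σ` and `τ` to agree,
    -- hence their exponents and contents.
    have key : ∀ i, σ.w i = τ.w i ∧ σ.c i = τ.c i := fun i => by
      have h1 := congrArg (modelEquiv μ) (hF τ i)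
      rw [modelEquiv_smul, map_smul, rep_theta] at h1
      have h2 : ∀ u : Model μ, opTheta i u σ
          = boxWeight σ.shapeRYT (σ.label.symm i) * u σ := fun u => by
        induction u using Finsupp.induction_linear with
        | zero => simp
        | add u v hu hv => rw [map_add, Finsupp.add_apply, hu, hv, Finsupp.add_apply, mul_add]
        | single ρ k =>
          rw [← Finsupp.smul_single_one, map_smul, opTheta_single]
          by_cases hρ : ρ = σ
          · subst hρ
            simp [mul_comm]
          · simp [hρ]
      have h3 := DFunLike.congr_fun h1 σ
      rw [h2, Finsupp.smul_apply, smul_eq_mul] at h3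
      exact q_pow_mul_t_zpow_injective (mul_right_cancel₀ hne h3)
    exact hσ (PSYT.eq_of_w_c (fun i => (key i).1) fun i => (key i).2)
  have h1 : modelEquiv μ (F τ) = modelEquiv μ (F τ) τ • Finsupp.single τ 1 := by
    ext σ
    by_cases hσ : σ = τ
    · subst hσ
      simp
    · rw [h0 σ hσ]
      simp [Ne.symm hσ]
  refine ⟨_, fun h => ?_, h1⟩
  rw [h, zero_smul, LinearEquiv.map_eq_zero_iff] at h1
  exact F.ne_zero τ h1

/-- Weight vectors are unique up to scalars, so the subspace does not depend on the chosen weight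
basis. -/
theorem map_U {F : Module.Basis (PSYT μ) K (V μ)} (hF : IsWeightBasis F) (T : RYT μ) :
    (U F T).map (modelEquiv μ : V μ →ₗ[K] Model μ) = fibre T := by
  rw [U, Submodule.map_span, fibre, Finsupp.supported_eq_span_single]
  apply le_antisymm
  · rw [Submodule.span_le]
    rintro _ ⟨_, ⟨τ, hτ, rfl⟩, rfl⟩
    obtain ⟨k, -, h⟩ := hF.exists_smul τ
    rw [SetLike.mem_coe, LinearEquiv.coe_coe, h]
    exact Submodule.smul_mem _ _ (Submodule.subset_span ⟨τ, hτ, rfl⟩)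
  · rw [Submodule.span_le]
    rintro _ ⟨τ, hτ, rfl⟩
    obtain ⟨k, hk, h⟩ := hF.exists_smul τ
    rw [SetLike.mem_coe, ← Submodule.smul_mem_iff _ hk, ← h]
    exact Submodule.subset_span ⟨F τ, ⟨τ, hτ, rfl⟩, rfl⟩

theorem rank_symmetrize_U {F : Module.Basis (PSYT μ) K (V μ)} (hF : IsWeightBasis F) (T : RYT μ) :
    Module.rank K (symmetrize (U F T))
      = Module.rank K ((fibre T).map (heckeRep μ (trivialIdempotent μ.card))) := by
  have h : (symmetrize (U F T)).map (modelEquiv μ : V μ →ₗ[K] Model μ)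
      = (fibre T).map (heckeRep μ (trivialIdempotent μ.card)) := by
    rw [← map_U hF, symmetrize, ← Submodule.map_comp, ← Submodule.map_comp]
    congr 1
    exact LinearMap.ext fun v => modelEquiv_smul _ v
  rw [← h]
  exact (LinearEquiv.rank_map_eq (modelEquiv μ) _).symm

end Rank
end VVMacdonald

theorem mainTheorem10 (μ : YoungDiagram) :
    (∃ F : Module.Basis (VVMacdonald.PSYT μ) VVMacdonald.K (VVMacdonald.V μ),
      VVMacdonald.IsWeightBasis F) ∧
    ∀ F : Module.Basis (VVMacdonald.PSYT μ) VVMacdonald.K (VVMacdonald.V μ),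
      VVMacdonald.IsWeightBasis F → ∀ T : VVMacdonald.RYT μ,
        (T.IsRSSYT →
          Module.rank VVMacdonald.K (VVMacdonald.symmetrize (VVMacdonald.U F T)) = 1) ∧
        (¬ T.IsRSSYT →
          Module.rank VVMacdonald.K (VVMacdonald.symmetrize (VVMacdonald.U F T)) = 0) := by
  refine ⟨VVMacdonald.exists_isWeightBasis μ, fun F hF T => ⟨fun hT => ?_, fun hT => ?_⟩⟩
  · rw [VVMacdonald.rank_symmetrize_U hF, VVMacdonald.rank_map_fibre_of_isRSSYT hT]
  · rw [VVMacdonald.rank_symmetrize_U hF, VVMacdonald.map_fibre_of_not_isRSSYT hT, rank_bot]
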